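/- **Conventions.** $B^k=\{v\in\mathbb R^k:\|v\|\le 1\}$ and $S^{k-1}=\{v\in\mathbb R^k:\|v\|=1\}$, with the Euclidean norm. For $-1\le\rho\le 1$, $x\sim_\rho y$ means that $(x,y)$ is a centred Gaussian vector in $\mathbb R^n\times\mathbb R^n$ with covariance matrix $\begin{pmatrix}I_n&\rho I_n\\ \rho I_n&I_n\end{pmatrix}$. *Vector-valued Borell conjecture (negative $\rho$).* For all integers $1\le k\le n$, all $-1\le\rho\le 0$ and all measurable $f:\mathbb R^n\to S^{k-1}$, $$\mathbb E_{x\sim_\rho y}\langle f(x),f(y)\rangle\ \ge\ \mathbb E_{x\sim_\rho y}\langle f_{\mathrm{opt}}(x),f_{\mathrm{opt}}(y)\rangle,\qquad f_{\mathrm{opt}}(x)=\frac{(x_1,\dots,x_k)}{\|(x_1,\dots,x_k)\|}.$$ *The quantity $F^*$.* For $k\ge 1$ and $-1\le\rho\le 1$, $$F^*(k,\rho)=\mathbb E_{Z}\left\langle\frac{Zu}{\|Zu\|},\frac{Zv}{\|Zv\|}\right\rangle,$$ where $u,v$ are any unit vectors in some $\mathbb R^d$ with $\langle u,v\rangle=\rho$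 and $Z$ is a random $k\times d$ matrix with i.i.d. standard Gaussian entries (the value does not depend on the choice of $d,u,v$). *Boolean functions.* Let $f:\{-1,1\}^n\to\mathbb R^k$, with multilinear expansion $f(x)=\sum_{S\subseteq[n]}\widehat f(S)\prod_{i\in S}x_i$, $\widehat f(S)\in\mathbb R^k$. Put $$\mathrm{Inf}_i^{\le m}[f]=\sum_{|S|\le m,\ S\ni i}\|\widehat f(S)\|^2 ,\qquad \mathrm{Stab}_\rho[f]=\mathbb E\,\langle f(x),f(y)\rangle ,$$ where $(x,y)$ are $\rho$-correlated Boolean strings: $x$ is uniform on $\{-1,1\}^n$ and, given $x$, independently for each $i$, $y_i=x_i$ with probability $\tfrac12+\tfrac12\rho$ and $y_i=-x_i$ with probability $\tfrac12-\tfrac12\rho$. The value of $f$ on the $\rho$-noisy hypercube is $\mathbb E\big[\tfrac14-\tfrac14\langle f(x),f(y)\rangle\big]$, for the same random pair $(x,y)$. **Theorem.** Assume the vector-valued Borell conjecture. Let $-1<\rho\le 0$. For every $\varepsilon>0$ there are $\delta=\delta(\varepsilon,\rho)>0$ and an integer $m=m(\varepsilon,\rho)\ge 0$ such that the following holds for all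 integers $k\ge 1$ and $n\ge 0$ and every function $f:\{-1,1\}^n\to B^k$. If $\mathrm{Inf}_i^{\le m}[f]\le\delta$ for all $i=1,\dots,n$, then $$\mathrm{Stab}_\rho[f]\ \ge\ F^*(k,\rho)-\varepsilon ,$$ and the value of $f$ on the $\rho$-noisy hypercube is at most $\tfrac14-\tfrac14F^*(k,\rho)+\varepsilon$. -/

import Mathlib

open MeasureTheory ProbabilityTheory
open scoped RealInnerProductSpace

noncomputable section

namespace VectorBorell

/-! ### Correlated Gaussian vectors, noise stability in Gaussian space, and the conjecture -/

/-- The law of a pair `(x, y)` of `ρ`-correlated standard Gaussian vectors in `ℝⁿ`, realised as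
`(x, ρ x + √(1 - ρ²) z)` with `x`, `z` independent standard Gaussian vectors.  For `-1 ≤ ρ ≤ 1`
this is the centred Gaussian law with covariance `[[I, ρ I], [ρ I, I]]`, see
`correlatedGaussian_eq_multivariateGaussian`. -/
def correlatedGaussian (n : ℕ) (ρ : ℝ) :
    Measure (EuclideanSpace ℝ (Fin n) × EuclideanSpace ℝ (Fin n)) :=
  ((stdGaussian (EuclideanSpace ℝ (Fin n))).prod (stdGaussian (EuclideanSpace ℝ (Fin n)))).map
    (fun p => (p.1, ρ • p.1 + √(1 - ρ ^ 2) • p.2))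

/-- The Gaussian noise stability `E ⟪f(x), f(y)⟫` of `f : ℝⁿ → ℝᵏ`, for `ρ`-correlated Gaussian
vectors `x`, `y`. -/
def gaussianStab {n k : ℕ} (ρ : ℝ) (f : EuclideanSpace ℝ (Fin n) → EuclideanSpace ℝ (Fin k)) : ℝ :=
  ∫ p, ⟪f p.1, f p.2⟫ ∂(correlatedGaussian n ρ)

/-- The first `k` coordinates `x_{≤ k}` of a vector `x ∈ ℝⁿ`, for `k ≤ n`. -/
def firstCoords {k n : ℕ} (hkn : k ≤ n) (x : EuclideanSpace ℝ (Fin n)) : EuclideanSpace ℝ (Fin k) :=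
  WithLp.toLp 2 (fun i => x (Fin.castLE hkn i))

/-- The function `f_opt(x) = x_{≤ k} / ‖x_{≤ k}‖` (with value `0` on the null set `x_{≤ k} = 0`). -/
def fOpt {k n : ℕ} (hkn : k ≤ n) (x : EuclideanSpace ℝ (Fin n)) : EuclideanSpace ℝ (Fin k) :=
  NormedSpace.normalize (firstCoords hkn x)

/-- The vector-valued Borell conjecture (negative `ρ`): for all `1 ≤ k ≤ n` and `-1 ≤ ρ ≤ 0`,
among all measurable `f : ℝⁿ → S^{k-1}` the noise stability at `ρ` is minimised by `f_opt`. -/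
def VectorBorellConjecture : Prop :=
  ∀ (k n : ℕ) (_ : 1 ≤ k) (hkn : k ≤ n) (ρ : ℝ), -1 ≤ ρ → ρ ≤ 0 →
    ∀ f : EuclideanSpace ℝ (Fin n) → EuclideanSpace ℝ (Fin k),
      Measurable f → (∀ x, ‖f x‖ = 1) →
        gaussianStab ρ (fOpt hkn) ≤ gaussianStab ρ f

/-! ### The quantity `F*(k, ρ)` -/

/-- The law of a random `k × n` matrix with i.i.d. standard Gaussian entries. -/
def gaussianMatrix (k n : ℕ) : Measure (Fin k → Fin n → ℝ) :=
  Measure.pi fun _ => Measure.pi fun _ => gaussianReal 0 1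

/-- The vector `Z u / ‖Z u‖`, for a `k × n` matrix `Z` and `u ∈ ℝⁿ`. -/
def projRound {k n : ℕ} (Z : Fin k → Fin n → ℝ) (u : EuclideanSpace ℝ (Fin n)) :
    EuclideanSpace ℝ (Fin k) :=
  NormedSpace.normalize (WithLp.toLp 2 (Matrix.mulVec (Matrix.of Z) u.ofLp))

/-- `E_Z ⟪Z u / ‖Z u‖, Z v / ‖Z v‖⟫` for a random `k × n` matrix `Z` with i.i.d. standard Gaussian
entries. -/
def projRoundValue (k : ℕ) {n : ℕ} (u v : EuclideanSpace ℝ (Fin n)) : ℝ :=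
  ∫ Z, ⟪projRound Z u, projRound Z v⟫ ∂(gaussianMatrix k n)

/-- `F*(k, ρ) = E_Z ⟪Z u / ‖Z u‖, Z v / ‖Z v‖⟫` for unit vectors `u`, `v` with `⟪u, v⟫ = ρ`.  The
value does not depend on the choice of `u` and `v` or of their dimension, see
`projRoundValue_eq_FStar`; here they are `(1, 0)` and `(ρ, √(1 - ρ²))`. -/
def FStar (k : ℕ) (ρ : ℝ) : ℝ :=
  projRoundValue k (!₂[1, 0] : EuclideanSpace ℝ (Fin 2)) !₂[ρ, √(1 - ρ ^ 2)]

/-! ### Analysis on the hypercube `{-1, 1}ⁿ`, modelled as `Fin n → ℤˣ` -/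

/-- The character `χ_S(x) = ∏_{i ∈ S} x_i`. -/
def chi {n : ℕ} (S : Finset (Fin n)) (x : Fin n → ℤˣ) : ℝ :=
  ∏ i ∈ S, ((x i : ℤ) : ℝ)

/-- The vector-valued Fourier coefficient `f̂(S) = E_x [χ_S(x) f(x)]`.  These are the coefficients
of the unique multilinear expansion of `f`, see `eq_sum_chi_iff`. -/
def fourierCoeff {n k : ℕ} (f : (Fin n → ℤˣ) → EuclideanSpace ℝ (Fin k)) (S : Finset (Fin n)) :
    EuclideanSpace ℝ (Fin k) :=
  ((2 : ℝ) ^ n)⁻¹ • ∑ x, chi S x • f x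

/-- The degree-`≤ m` influence `∑_{|S| ≤ m, i ∈ S} ‖f̂(S)‖²` of the coordinate `i` on `f`. -/
def lowDegInfluence {n k : ℕ} (m : ℕ) (i : Fin n)
    (f : (Fin n → ℤˣ) → EuclideanSpace ℝ (Fin k)) : ℝ :=
  ∑ S : Finset (Fin n) with S.card ≤ m ∧ i ∈ S, ‖fourierCoeff f S‖ ^ 2

/-- The probability that a string which is `ρ`-correlated to `x ∈ {-1, 1}ⁿ` equals `y`:
independently for each `i`, `y_i` is `x_i` with probability `1/2 + ρ/2` and `-x_i` with probability
`1/2 - ρ/2`. -/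
def corrProb {n : ℕ} (ρ : ℝ) (x y : Fin n → ℤˣ) : ℝ :=
  ∏ i, if y i = x i then 1 / 2 + ρ / 2 else 1 / 2 - ρ / 2

/-- The expectation `E φ(x, y)` for a pair `(x, y)` of `ρ`-correlated `n`-dimensional Boolean
strings: `x` is uniform on `{-1, 1}ⁿ` and `y` is `ρ`-correlated to `x`. -/
def corrExpect {n : ℕ} (ρ : ℝ) (φ : (Fin n → ℤˣ) → (Fin n → ℤˣ) → ℝ) : ℝ :=
  ((2 : ℝ) ^ n)⁻¹ * ∑ x, ∑ y, corrProb ρ x y * φ x y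

/-- The Boolean noise stability `Stab_ρ[f] = E ⟪f(x), f(y)⟫`. -/
def boolStab {n k : ℕ} (ρ : ℝ) (f : (Fin n → ℤˣ) → EuclideanSpace ℝ (Fin k)) : ℝ :=
  corrExpect ρ fun x y => ⟪f x, f y⟫

/-- The value `E [1/4 - 1/4 ⟪f(x), f(y)⟫]` of the assignment `f` on the `ρ`-noisy hypercube, the
weighted graph on `{-1, 1}ⁿ` whose random edge `(x, y)` is a pair of `ρ`-correlated strings. -/
def hypercubeValue {n k : ℕ} (ρ : ℝ) (f : (Fin n → ℤˣ) → EuclideanSpace ℝ (Fin k)) : ℝ :=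
  corrExpect ρ fun x y => 1 / 4 - 1 / 4 * ⟪f x, f y⟫

/-! ### Checks on the definitions -/

theorem sum_chi_mul_chi {n : ℕ} (x y : Fin n → ℤˣ) :
    ∑ S : Finset (Fin n), chi S x * chi S y = if x = y then (2 : ℝ) ^ n else 0 := by
  have h : ∑ S : Finset (Fin n), chi S x * chi S y
      = ∏ i, (1 + ((x i : ℤ) : ℝ) * ((y i : ℤ) : ℝ)) := by
    rw [Finset.prod_one_add, Finset.powerset_univ]
    simp [chi, Finset.prod_mul_distrib]
  rw [h]
  split_ifs with hxy
  · subst hxy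
    have : ∀ i, (1 + ((x i : ℤ) : ℝ) * ((x i : ℤ) : ℝ)) = 2 := by
      intro i
      rcases Int.units_eq_one_or (x i) with h | h <;> simp [h] <;> norm_num
    simp [this]
  · obtain ⟨i, hi⟩ := Function.ne_iff.mp hxy
    apply Finset.prod_eq_zero (Finset.mem_univ i)
    rcases Int.units_eq_one_or (x i) with h | h <;>
      rcases Int.units_eq_one_or (y i) with h' | h' <;> simp_all

theorem sum_chi_chi {n : ℕ} (S T : Finset (Fin n)) :
    ∑ x : Fin n → ℤˣ, chi S x * chi T x = if S = T then (2 : ℝ) ^ n else 0 := by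
  have h : ∀ x : Fin n → ℤˣ, chi S x * chi T x
      = ∏ i, ((if i ∈ S then ((x i : ℤ) : ℝ) else 1) * (if i ∈ T then ((x i : ℤ) : ℝ) else 1)) := by
    intro x
    rw [Finset.prod_mul_distrib, Fintype.prod_ite_mem, Fintype.prod_ite_mem]
    rfl
  simp_rw [h]
  rw [← Fintype.piFinset_univ, Finset.sum_prod_piFinset Finset.univ
    (fun i (s : ℤˣ) => (if i ∈ S then ((s : ℤ) : ℝ) else 1) * (if i ∈ T then ((s : ℤ) : ℝ) else 1))]
  split_ifs with hST
  · subst hST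
    have : ∀ i, ∑ s : ℤˣ, ((if i ∈ S then ((s : ℤ) : ℝ) else 1) *
        (if i ∈ S then ((s : ℤ) : ℝ) else 1)) = 2 := by
      intro i
      rw [show (Finset.univ : Finset ℤˣ) = {1, -1} from rfl, Finset.sum_pair (by decide)]
      split_ifs <;> norm_num
    simp_rw [this]
    simp
  · have : ∃ i, ¬ (i ∈ S ↔ i ∈ T) := by
      by_contra hc
      push Not at hc
      exact hST (Finset.ext hc)
    obtain ⟨i, hi⟩ := this
    apply Finset.prod_eq_zero (Finset.mem_univ i)
    rw [show (Finset.univ : Finset ℤˣ) = {1, -1} from rfl, Finset.sum_pair (by decide)]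
    by_cases h1 : i ∈ S <;> by_cases h2 : i ∈ T <;> simp_all

/-- The Fourier coefficients are the coefficients of the unique multilinear expansion. -/
theorem eq_sum_chi_iff {n k : ℕ} (f : (Fin n → ℤˣ) → EuclideanSpace ℝ (Fin k))
    (c : Finset (Fin n) → EuclideanSpace ℝ (Fin k)) :
    (∀ x, f x = ∑ S, chi S x • c S) ↔ c = fourierCoeff f := by
  have h2 : ((2 : ℝ) ^ n) ≠ 0 := by positivity
  constructor
  · intro h
    ext1 S
    rw [fourierCoeff]
    simp_rw [h, Finset.smul_sum, smul_smul]
    rw [Finset.sum_comm]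
    simp_rw [← Finset.sum_smul, ← Finset.mul_sum, sum_chi_chi]
    simp [h2]
  · rintro rfl x
    simp_rw [fourierCoeff, Finset.smul_sum, smul_smul]
    rw [Finset.sum_comm]
    simp_rw [← Finset.sum_smul, mul_left_comm _ (((2 : ℝ) ^ n)⁻¹), ← Finset.mul_sum,
      sum_chi_mul_chi]
    simp [h2]

theorem row_law {n : ℕ} (u v : EuclideanSpace ℝ (Fin n)) :
    (Measure.pi fun _ : Fin n => gaussianReal 0 1).map
      (fun z => (∑ j, z j * u j, ∑ j, z j * v j)) =
    (stdGaussian (EuclideanSpace ℝ (Fin n))).map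
      (((innerSL ℝ u).prod (innerSL ℝ v) : EuclideanSpace ℝ (Fin n) →L[ℝ] ℝ × ℝ)) := by
  rw [← map_pi_eq_stdGaussian, Measure.map_map (by fun_prop) (by fun_prop)]
  congr 1

theorem row_law_congr {n n' : ℕ} {u v : EuclideanSpace ℝ (Fin n)}
    {u' v' : EuclideanSpace ℝ (Fin n')} (hu : ‖u‖ = ‖u'‖) (hv : ‖v‖ = ‖v'‖)
    (huv : ⟪u, v⟫ = ⟪u', v'⟫) :
    (stdGaussian (EuclideanSpace ℝ (Fin n))).map
      (((innerSL ℝ u).prod (innerSL ℝ v) : EuclideanSpace ℝ (Fin n) →L[ℝ] ℝ × ℝ)) =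
    (stdGaussian (EuclideanSpace ℝ (Fin n'))).map
      (((innerSL ℝ u').prod (innerSL ℝ v') : EuclideanSpace ℝ (Fin n') →L[ℝ] ℝ × ℝ)) := by
  have key : ∀ {d : ℕ} (a b : EuclideanSpace ℝ (Fin d)) (L : StrongDual ℝ (ℝ × ℝ)),
      ‖L.comp ((innerSL ℝ a).prod (innerSL ℝ b))‖ ^ 2 =
        L (1, 0) ^ 2 * ‖a‖ ^ 2 + 2 * (L (1, 0) * L (0, 1) * ⟪a, b⟫) + L (0, 1) ^ 2 * ‖b‖ ^ 2 := by
    intro d a b L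
    have : L.comp ((innerSL ℝ a).prod (innerSL ℝ b)) = innerSL ℝ (L (1, 0) • a + L (0, 1) • b) := by
      ext x
      have hx : ((⟪a, x⟫, ⟪b, x⟫) : ℝ × ℝ) = ⟪a, x⟫ • (1, 0) + ⟪b, x⟫ • (0, 1) := by simp
      simp only [ContinuousLinearMap.comp_apply, ContinuousLinearMap.prod_apply,
        innerSL_apply_apply]
      rw [hx, map_add, map_smul, map_smul, inner_add_left, real_inner_smul_left,
        real_inner_smul_left]
      simp [mul_comm]
    rw [this, innerSL_apply_norm, norm_add_sq_real, norm_smul, norm_smul, real_inner_smul_left,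
      real_inner_smul_right, mul_pow, mul_pow, Real.norm_eq_abs, Real.norm_eq_abs, sq_abs, sq_abs]
    ring
  apply Measure.ext_of_charFunDual
  ext L
  rw [charFunDual_map, charFunDual_map, charFunDual_stdGaussian, charFunDual_stdGaussian]
  have := (key u v L).trans ((by rw [hu, hv, huv]) : _ = _) |>.trans (key u' v' L).symm
  rw [← Complex.ofReal_pow, ← Complex.ofReal_pow, this]

theorem projRoundValue_congr (k : ℕ) {n n' : ℕ} {u v : EuclideanSpace ℝ (Fin n)}
    {u' v' : EuclideanSpace ℝ (Fin n')} (hu : ‖u‖ = ‖u'‖) (hv : ‖v‖ = ‖v'‖)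
    (huv : ⟪u, v⟫ = ⟪u', v'⟫) : projRoundValue k u v = projRoundValue k u' v' := by
  have key : ∀ {d : ℕ} (a b : EuclideanSpace ℝ (Fin d)), projRoundValue k a b =
      ∫ w : Fin k → ℝ × ℝ,
        ⟪‖(WithLp.toLp 2 fun i => (w i).1 : EuclideanSpace ℝ (Fin k))‖⁻¹ •
            (WithLp.toLp 2 fun i => (w i).1 : EuclideanSpace ℝ (Fin k)),
          ‖(WithLp.toLp 2 fun i => (w i).2 : EuclideanSpace ℝ (Fin k))‖⁻¹ •
            (WithLp.toLp 2 fun i => (w i).2 : EuclideanSpace ℝ (Fin k))⟫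
        ∂(Measure.pi fun _ : Fin k => (stdGaussian (EuclideanSpace ℝ (Fin d))).map
          (((innerSL ℝ a).prod (innerSL ℝ b) : EuclideanSpace ℝ (Fin d) →L[ℝ] ℝ × ℝ))) := by
    intro d a b
    simp_rw [← row_law]
    rw [← Measure.pi_map_pi (fun _ => by fun_prop), integral_map]
    · rfl
    · fun_prop
    · apply Measurable.aestronglyMeasurable
      fun_prop
  rw [key, key, row_law_congr hu hv huv]

/-- `F*(k, ρ)` does not depend on the choice of the two unit vectors. -/
theorem projRoundValue_eq_FStar (k : ℕ) {n : ℕ} {u v : EuclideanSpace ℝ (Fin n)}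
    (hu : ‖u‖ = 1) (hv : ‖v‖ = 1) : projRoundValue k u v = FStar k ⟪u, v⟫ := by
  have h1 : |⟪u, v⟫| ≤ 1 := by simpa [hu, hv] using abs_real_inner_le_norm u v
  have h2 : 0 ≤ 1 - ⟪u, v⟫ ^ 2 := by
    have := sq_le_one_iff_abs_le_one (⟪u, v⟫) |>.mpr h1
    linarith
  apply projRoundValue_congr
  · rw [hu, EuclideanSpace.norm_eq]; simp
  · rw [hv, EuclideanSpace.norm_eq]; simp [Real.sq_sqrt h2]
  · simp [PiLp.inner_apply]

/-- For `-1 ≤ ρ ≤ 1`, the law `correlatedGaussian n ρ` is the centred Gaussian law on `ℝⁿ × ℝⁿ` with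
covariance matrix `[[I, ρ I], [ρ I, I]]`. -/
theorem correlatedGaussian_eq_multivariateGaussian (n : ℕ) {ρ : ℝ} (h₁ : -1 ≤ ρ) (h₂ : ρ ≤ 1) :
    correlatedGaussian n ρ =
      (multivariateGaussian 0 (Matrix.fromBlocks (1 : Matrix (Fin n) (Fin n) ℝ)
        (ρ • (1 : Matrix (Fin n) (Fin n) ℝ)) (ρ • (1 : Matrix (Fin n) (Fin n) ℝ)) 1)).map
        (fun z : EuclideanSpace ℝ (Fin n ⊕ Fin n) =>
          ((WithLp.toLp 2 fun i => z (Sum.inl i) : EuclideanSpace ℝ (Fin n)),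
            (WithLp.toLp 2 fun i => z (Sum.inr i) : EuclideanSpace ℝ (Fin n)))) := by
  have hρ : 0 ≤ 1 - ρ ^ 2 := by nlinarith
  set S : Matrix (Fin n ⊕ Fin n) (Fin n ⊕ Fin n) ℝ :=
    Matrix.fromBlocks 1 (ρ • (1 : Matrix (Fin n) (Fin n) ℝ)) (ρ • (1 : Matrix (Fin n) (Fin n) ℝ)) 1
    with hS
  have hpos : S.PosSemidef := by
    have : Invertible (1 : Matrix (Fin n) (Fin n) ℝ) := invertibleOne
    have := (Matrix.PosDef.one (n := Fin n) (R := ℝ)).fromBlocks₁₁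
      (ρ • (1 : Matrix (Fin n) (Fin n) ℝ)) 1
    simp only [Matrix.conjTranspose_smul, Matrix.conjTranspose_one, star_trivial] at this
    rw [hS, this]
    have h : (1 : Matrix (Fin n) (Fin n) ℝ) - ρ • 1 * 1⁻¹ * ρ • 1 = (1 - ρ ^ 2) • 1 := by
      simp [sub_smul, smul_smul, pow_two]
    rw [h]
    exact Matrix.PosSemidef.one.smul hρ
  have e : ∀ x y : EuclideanSpace ℝ (Fin n), ⟪x, y⟫ = x.ofLp ⬝ᵥ y.ofLp := by
    intro x y
    simp [PiLp.inner_apply, dotProduct, mul_comm]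
  let E := EuclideanSpace ℝ (Fin n)
  let A : E × E →L[ℝ] E × E := (ContinuousLinearMap.fst ℝ E E).prod
    (ρ • ContinuousLinearMap.fst ℝ E E + √(1 - ρ ^ 2) • ContinuousLinearMap.snd ℝ E E)
  let B : EuclideanSpace ℝ (Fin n ⊕ Fin n) →L[ℝ] E × E := LinearMap.toContinuousLinearMap
    { toFun := fun z => (WithLp.toLp 2 fun i => z (Sum.inl i), WithLp.toLp 2 fun i => z (Sum.inr i))
      map_add' := fun _ _ => rfl
      map_smul' := fun _ _ => rfl }
  change ((stdGaussian E).prod (stdGaussian E)).map A = (multivariateGaussian 0 S).map B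
  apply Measure.ext_of_charFunDual
  ext L
  obtain ⟨a, ha⟩ := (InnerProductSpace.toDual ℝ E).surjective
    (L.comp (ContinuousLinearMap.inl ℝ E E))
  obtain ⟨b, hb⟩ := (InnerProductSpace.toDual ℝ E).surjective
    (L.comp (ContinuousLinearMap.inr ℝ E E))
  have hL : ∀ x y : E, L (x, y) = ⟪a, x⟫ + ⟪b, y⟫ := by
    intro x y
    have h1 := DFunLike.congr_fun ha x
    have h2 := DFunLike.congr_fun hb y
    simp only [InnerProductSpace.toDual_apply_apply, ContinuousLinearMap.comp_apply,
      ContinuousLinearMap.inl_apply, ContinuousLinearMap.inr_apply] at h1 h2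
    rw [h1, h2, ← map_add]
    simp
  rw [charFunDual_map, charFunDual_map, charFunDual_prod, charFunDual_stdGaussian,
    charFunDual_stdGaussian]
  have hl : (L.comp A).comp (ContinuousLinearMap.inl ℝ E E) = innerSL ℝ (a + ρ • b) := by
    ext x
    simp [A, hL, inner_add_left, real_inner_smul_left, real_inner_smul_right]
  have hr : (L.comp A).comp (ContinuousLinearMap.inr ℝ E E) = innerSL ℝ (√(1 - ρ ^ 2) • b) := by
    ext x
    simp [A, hL, real_inner_smul_right]
  let t : EuclideanSpace ℝ (Fin n ⊕ Fin n) := WithLp.toLp 2 (Sum.elim a.ofLp b.ofLp)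
  have ht : L.comp B = InnerProductSpace.toDualMap ℝ _ t := by
    ext x
    change L (WithLp.toLp 2 fun i => x (Sum.inl i), WithLp.toLp 2 fun i => x (Sum.inr i)) = ⟪t, x⟫
    rw [hL, e, e]
    simp [t, PiLp.inner_apply, dotProduct, mul_comm]
  have hq : t.ofLp ⬝ᵥ S.mulVec t.ofLp = ‖a‖ ^ 2 + 2 * ρ * ⟪a, b⟫ + ‖b‖ ^ 2 := by
    rw [← real_inner_self_eq_norm_sq, ← real_inner_self_eq_norm_sq, e, e, e, hS,
      Matrix.fromBlocks_mulVec]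
    simp only [t, Sum.elim_comp_inl, Sum.elim_comp_inr, Matrix.one_mulVec, Matrix.smul_mulVec,
      sumElim_dotProduct_sumElim, dotProduct_add, dotProduct_smul, smul_eq_mul]
    rw [dotProduct_comm b.ofLp a.ofLp]
    ring
  have hn : ‖a + ρ • b‖ ^ 2 + ‖√(1 - ρ ^ 2) • b‖ ^ 2 = ‖a‖ ^ 2 + 2 * ρ * ⟪a, b⟫ + ‖b‖ ^ 2 := by
    rw [norm_add_sq_real, norm_smul, norm_smul, real_inner_smul_right, mul_pow, mul_pow,
      Real.norm_eq_abs, Real.norm_eq_abs, sq_abs, sq_abs, Real.sq_sqrt hρ]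
    ring
  rw [hl, hr, ht, ← charFun_eq_charFunDual_toDualMap, charFun_multivariateGaussian hpos, hq, ← hn,
    innerSL_apply_norm, innerSL_apply_norm, ← Complex.exp_add]
  congr 1
  push_cast
  simp
  ring

end VectorBorell

end

/-! Fix the target dimension `k`. The conjecture lives in Gaussian space, so a function `f` on the
cube with small influences has to be carried there. Apply a little noise to `f` and cut the
multilinear expansion at degree `m`; call the resulting polynomial `P`. Evaluated at Gaussian
variables, `P` has noise stability `∑ ρ^|S| ‖P̂(S)‖²`, the same diagonal form as on the cube, and
this exceeds `Stab_ρ[f]` by little (`stabPi_vpoly`, `sum_noisyTruncation_le_boolStab`).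

The obstacle is that `P` need not take values in the ball at Gaussian points. On the cube it nearly
does: noise replaces `f` by averages of vectors of the ball, and the discarded tail is small in
`L²`. This is a statement about the functions `⟪u, P⟫` for finitely many directions `u`, tested
against a smooth substitute for `((⟪u, P⟫ - 1)⁺)²`. The invariance principle
(`abs_integral_smoothSq_gaussian_sub_rademacher_le`: replace one coordinate after another, with
third moments controlled by the hypercontractive bound `integral_mpoly_pow_four_le`) transfers it to
Gaussian space. Hence the radial retraction of `P` to the ball is close to `P` in `L²`, and its
stability is close to that of `P`.

The retraction is ball-valued, whereas the conjecture concerns sphere-valued functions.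
`exists_sphere_valued` bridges this: a vector of the ball is a midpoint `v ± d` with `v + d` on the
sphere, and the sign is taken from a rapidly alternating function of a fresh Gaussian coordinate.
For `ρ² < 1` that sign is almost uncorrelated with its noisy copy, so stability hardly changes;
after enough rounds almost every value lies on the sphere.

All of this depends on `k`. For large `k` no invariance is needed: `F*(k, ρ)` is at most `ρ` plus a
small error, because `‖x‖` concentrates at `√k` (`FStar_le_add`), while every ball-valued `f`
satisfies `Stab_ρ[f] ≥ ρ` (`le_boolStab`). Only finitely many `k` remain. -/

noncomputable section

namespace VectorBorell

/-! ### Laws on `ℝ` with mean `0`, variance `1`, third moment `0` and bounded fourth moment -/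

/-- Probability laws on `ℝ` whose first three moments are those of a standard Gaussian law and whose
fourth moment is at most `100`. -/
class HasStandardMoments (ν : Measure ℝ) : Prop extends IsProbabilityMeasure ν where
  integrable_pow_four : Integrable (fun t : ℝ => t ^ 4) ν
  integral_id : ∫ t, t ∂ν = 0
  integral_sq : ∫ t, t ^ 2 ∂ν = 1
  integral_cube : ∫ t, t ^ 3 ∂ν = 0
  integral_pow_four_le : ∫ t, t ^ 4 ∂ν ≤ 100

theorem abs_pow_le_one_add_pow_four (t : ℝ) {j : ℕ} (hj : j ≤ 4) : |t| ^ j ≤ 1 + t ^ 4 := by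
  have h4 : t ^ 4 = |t| ^ 4 := by rw [← abs_pow, abs_of_nonneg (by positivity)]
  rw [h4]
  rcases le_total |t| 1 with h | h
  · have := pow_le_one₀ (n := j) (abs_nonneg t) h
    have : 0 ≤ |t| ^ 4 := by positivity
    linarith
  · have := pow_le_pow_right₀ h hj
    linarith

theorem Integrable.pow_of_pow_four {Ω : Type*} [MeasurableSpace Ω] {μ : Measure Ω}
    [IsFiniteMeasure μ] {f : Ω → ℝ} (hf : AEStronglyMeasurable f μ)
    (h4 : Integrable (fun x => f x ^ 4) μ) {j : ℕ} (hj : j ≤ 4) :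
    Integrable (fun x => f x ^ j) μ := by
  refine ((integrable_const (1 : ℝ)).add h4).mono' (hf.pow j) (Filter.Eventually.of_forall fun x => ?_)
  rw [Real.norm_eq_abs, abs_pow]
  exact abs_pow_le_one_add_pow_four _ hj

theorem HasStandardMoments.integrable_pow (ν : Measure ℝ) [HasStandardMoments ν] {j : ℕ}
    (hj : j ≤ 4) : Integrable (fun t : ℝ => t ^ j) ν :=
  Integrable.pow_of_pow_four (by fun_prop) integrable_pow_four hj

theorem HasStandardMoments.integrable_abs_cube (ν : Measure ℝ) [HasStandardMoments ν] :
    Integrable (fun t : ℝ => |t| ^ 3) ν := by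
  simpa [abs_pow] using (integrable_pow ν (j := 3) (by norm_num)).abs

theorem HasStandardMoments.integral_abs_cube_le (ν : Measure ℝ) [HasStandardMoments ν] :
    ∫ t, |t| ^ 3 ∂ν ≤ 101 := by
  calc ∫ t, |t| ^ 3 ∂ν ≤ ∫ t, (1 + t ^ 4) ∂ν :=
        integral_mono (integrable_abs_cube ν) ((integrable_const 1).add integrable_pow_four)
          fun t => abs_pow_le_one_add_pow_four t (by norm_num)
    _ ≤ 101 := by
        rw [integral_add (integrable_const 1) integrable_pow_four]
        have := integral_pow_four_le (ν := ν)
        simp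
        linarith

theorem integral_exp_mul_gaussianReal (s : ℝ) :
    ∫ t, Real.exp (s * t) ∂(gaussianReal 0 1) = Real.exp (s ^ 2 / 2) := by
  have := congrFun (mgf_id_gaussianReal (μ := 0) (v := 1)) s
  simpa [mgf] using this

instance hasStandardMoments_gaussianReal : HasStandardMoments (gaussianReal 0 1) where
  integrable_pow_four := by
    have := (memLp_id_gaussianReal (μ := 0) (v := 1) 4).integrable_norm_pow (p := 4) (by norm_num)
    refine this.congr (Filter.Eventually.of_forall fun x => ?_)
    simp only [id, Real.norm_eq_abs]
    rw [← abs_pow, abs_of_nonneg (by positivity)]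
  integral_id := integral_id_gaussianReal
  integral_sq := by
    have h := variance_fun_id_gaussianReal (μ := 0) (v := 1)
    rw [variance_of_integral_eq_zero (by fun_prop) integral_id_gaussianReal] at h
    simpa using h
  integral_cube := by
    have h : ∫ t, t ^ 3 ∂(gaussianReal 0 1) = ∫ t, (-t) ^ 3 ∂(gaussianReal 0 1) := by
      conv_lhs => rw [← neg_zero, ← gaussianReal_map_neg]
      rw [integral_map (by fun_prop) (by fun_prop)]
    have h2 : ∫ t, (-t) ^ 3 ∂(gaussianReal 0 1) = - ∫ t, t ^ 3 ∂(gaussianReal 0 1) := by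
      rw [← integral_neg]
      congr 1
      ext t
      ring
    linarith
  integral_pow_four_le := by
    -- The bound `t⁴ / 4! ≤ e^|t| ≤ e^t + e^(-t)` has Gaussian mean `2 e^(1/2)` on the right, so the
    -- fourth moment is at most `48 e^(1/2) ≤ 96`. This crude value is where the constant 100 comes
    -- from.
    have hb : ∀ t : ℝ, t ^ 4 ≤ 24 * (Real.exp (1 * t) + Real.exp ((-1) * t)) := by
      intro t
      have h := Real.pow_div_factorial_le_exp |t| (abs_nonneg t) 4
      have h4 : |t| ^ 4 = t ^ 4 := by rw [← abs_pow, abs_of_nonneg (by positivity)]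
      have he : Real.exp |t| ≤ Real.exp (1 * t) + Real.exp ((-1) * t) := by
        rcases abs_choice t with h' | h' <;> rw [h'] <;> simp [Real.exp_nonneg]
      rw [h4, show ((Nat.factorial 4 : ℕ) : ℝ) = 24 by norm_num [Nat.factorial]] at h
      linarith
    have hi : ∀ s : ℝ, Integrable (fun t => Real.exp (s * t)) (gaussianReal 0 1) :=
      fun s => integrable_exp_mul_gaussianReal s
    have hint : Integrable (fun t : ℝ => 24 * (Real.exp (1 * t) + Real.exp ((-1) * t)))
        (gaussianReal 0 1) := ((hi 1).add (hi (-1))).const_mul 24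
    have h := integral_mono_of_nonneg (Filter.Eventually.of_forall fun t : ℝ => by positivity)
      hint (Filter.Eventually.of_forall hb)
    refine h.trans ?_
    rw [integral_const_mul, integral_add (hi 1) (hi (-1)),
      integral_exp_mul_gaussianReal, integral_exp_mul_gaussianReal]
    have he : Real.exp (1 / 2) ≤ 2 := by
      have h1 := Real.exp_one_lt_d9
      have h2 : Real.exp (1 / 2) * Real.exp (1 / 2) = Real.exp 1 := by
        rw [← Real.exp_add]; norm_num
      nlinarith [Real.exp_pos (1 / 2)]
    norm_num at he ⊢
    linarith

/-! ### The Rademacher law, and averages over the cube as integrals. -/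

instance : MeasurableSingletonClass ℤˣ where
  measurableSet_singleton u :=
    ⟨{(u : ℤ)}, measurableSet_singleton _, by ext v; simp [Units.ext_iff]⟩

/-- The uniform law on the two signs. -/
def signLaw : Measure ℤˣ := (2 : ENNReal)⁻¹ • Measure.count

/-- The uniform law on `{-1, 1} ⊆ ℝ`. -/
def rademacher : Measure ℝ := signLaw.map (fun s : ℤˣ => ((s : ℤ) : ℝ))

instance : IsProbabilityMeasure signLaw where
  measure_univ := by
    simp [signLaw, Measure.count_apply, ENNReal.inv_mul_cancel]

theorem measurableEmbedding_signCoe : MeasurableEmbedding (fun s : ℤˣ => ((s : ℤ) : ℝ)) where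
  injective := fun _ _ h => Units.ext (Int.cast_injective (α := ℝ) h)
  measurable := measurable_of_finite _
  measurableSet_image' := fun _ _ => ((Set.toFinite _).image _).measurableSet

instance : IsProbabilityMeasure rademacher :=
  Measure.isProbabilityMeasure_map (measurable_of_finite _).aemeasurable

theorem integral_rademacher (g : ℝ → ℝ) : ∫ t, g t ∂rademacher = (g 1 + g (-1)) / 2 := by
  rw [rademacher, measurableEmbedding_signCoe.integral_map, signLaw, integral_smul_measure,
    integral_fintype (Integrable.of_finite),
    show (Finset.univ : Finset ℤˣ) = {1, -1} from rfl, Finset.sum_pair (by decide)]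
  simp [Measure.real]
  ring

instance hasStandardMoments_rademacher : HasStandardMoments rademacher where
  integrable_pow_four := by
    rw [rademacher, measurableEmbedding_signCoe.integrable_map_iff]
    exact Integrable.of_finite
  integral_id := by simp [integral_rademacher]
  integral_sq := by simp [integral_rademacher]
  integral_cube := by rw [integral_rademacher]; norm_num
  integral_pow_four_le := by rw [integral_rademacher]; norm_num

theorem integral_pi_rademacher {n : ℕ} (g : (Fin n → ℝ) → ℝ) :
    ∫ x, g x ∂(Measure.pi fun _ : Fin n => rademacher) =
      ((2 : ℝ) ^ n)⁻¹ * ∑ x : Fin n → ℤˣ, g fun i => ((x i : ℤ) : ℝ) := by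
  have hemb : MeasurableEmbedding (fun (x : Fin n → ℤˣ) i => ((x i : ℤ) : ℝ)) :=
    { injective := fun a b h => funext fun i =>
        measurableEmbedding_signCoe.injective (congrFun h i)
      measurable := measurable_of_finite _
      measurableSet_image' := fun _ _ => ((Set.toFinite _).image _).measurableSet }
  have hmap : (Measure.pi fun _ : Fin n => rademacher) =
      (Measure.pi fun _ : Fin n => signLaw).map (fun x i => ((x i : ℤ) : ℝ)) :=
    (Measure.pi_map_pi (fun _ => (measurable_of_finite _).aemeasurable)).symm
  rw [hmap, hemb.integral_map, integral_fintype (Integrable.of_finite), Finset.mul_sum]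
  refine Finset.sum_congr rfl fun x _ => ?_
  rw [smul_eq_mul, Measure.real, Measure.pi_singleton]
  congr 1
  simp [signLaw, ENNReal.toReal_inv]

/-! ### Multilinear polynomials of independent variables -/

section Multilinear

variable {ι : Type*} [Fintype ι] [DecidableEq ι]

/-- Resampling one coordinate of a product measure. -/
theorem measurePreserving_update (ν : ι → Measure ℝ) [∀ i, IsProbabilityMeasure (ν i)] (i : ι)
    (τ : Measure ℝ) [IsProbabilityMeasure τ] :
    MeasurePreserving (fun p : (ι → ℝ) × ℝ => Function.update p.1 i p.2)
      ((Measure.pi ν).prod τ) (Measure.pi (Function.update ν i τ)) := by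
  have hm : Measurable (fun p : (ι → ℝ) × ℝ => Function.update p.1 i p.2) := by
    refine measurable_pi_lambda _ fun j => ?_
    by_cases h : j = i
    · subst h; simpa using measurable_snd
    · simp only [Function.update_of_ne h]; fun_prop
  have : ∀ j, IsProbabilityMeasure (Function.update ν i τ j) := by
    intro j
    by_cases h : j = i
    · subst h; simpa
    · simp only [Function.update_of_ne h]; infer_instance
  refine ⟨hm, (Measure.pi_eq fun s hs => ?_).symm⟩
  rw [Measure.map_apply hm (MeasurableSet.univ_pi hs)]
  have hpre : (fun p : (ι → ℝ) × ℝ => Function.update p.1 i p.2) ⁻¹' (Set.univ.pi s) =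
      (Set.univ.pi (Function.update s i Set.univ)) ×ˢ (s i) := by
    ext p
    simp only [Set.mem_preimage, Set.mem_pi, Set.mem_univ, true_implies, Set.mem_prod]
    constructor
    · intro h
      refine ⟨fun j => ?_, by simpa using h i⟩
      by_cases hj : j = i
      · subst hj; simp
      · simpa [hj] using h j
    · rintro ⟨h1, h2⟩ j
      by_cases hj : j = i
      · subst hj; simpa using h2
      · simpa [hj] using h1 j
  rw [hpre, Measure.prod_prod, Measure.pi_pi, ← Finset.prod_erase_mul _ _ (Finset.mem_univ i),
    ← Finset.prod_erase_mul _ (fun j => Function.update ν i τ j (s j)) (Finset.mem_univ i)]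
  simp only [Function.update_self, measure_univ, mul_one]
  congr 1
  refine Finset.prod_congr rfl fun j hj => ?_
  rw [Function.update_of_ne (Finset.ne_of_mem_erase hj),
    Function.update_of_ne (Finset.ne_of_mem_erase hj)]

/-- The multilinear polynomial `∑_S c_S ∏_{i ∈ S} x_i`. -/
def mpoly (c : Finset ι → ℝ) (x : ι → ℝ) : ℝ := ∑ S, c S * ∏ i ∈ S, x i

/-- The coefficients of the part of a multilinear polynomial which does not involve `x_i`. -/
def coeffWithout (i : ι) (c : Finset ι → ℝ) (S : Finset ι) : ℝ := if i ∈ S then 0 else c S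

/-- The coefficients of the derivative of a multilinear polynomial in `x_i`. -/
def coeffDeriv (i : ι) (c : Finset ι → ℝ) (S : Finset ι) : ℝ := if i ∈ S then 0 else c (insert i S)

theorem sum_finset_eq_sum_insert {M : Type*} [AddCommMonoid M] (i : ι) (g : Finset ι → M) :
    ∑ S, g S = ∑ S with i ∉ S, g S + ∑ S with i ∉ S, g (insert i S) := by
  rw [← Finset.sum_filter_add_sum_filter_not Finset.univ (fun S => i ∉ S) g]
  congr 1
  refine Finset.sum_bij' (fun S _ => S.erase i) (fun S _ => insert i S) ?_ ?_ ?_ ?_ ?_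
  · simp
  · simp
  · intro S hS
    simp only [not_not, Finset.mem_filter, Finset.mem_univ, true_and] at hS
    exact Finset.insert_erase hS
  · intro S hS
    simp only [Finset.mem_filter, Finset.mem_univ, true_and] at hS
    exact Finset.erase_insert hS
  · intro S hS
    simp only [not_not, Finset.mem_filter, Finset.mem_univ, true_and] at hS
    rw [Finset.insert_erase hS]

theorem mpoly_eq_add (i : ι) (c : Finset ι → ℝ) (x : ι → ℝ) :
    mpoly c x = mpoly (coeffWithout i c) x + x i * mpoly (coeffDeriv i c) x := by
  simp only [mpoly, coeffWithout, coeffDeriv, ite_mul, zero_mul]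
  rw [sum_finset_eq_sum_insert i, Finset.mul_sum, Finset.sum_filter, Finset.sum_filter]
  congr 1 <;> refine Finset.sum_congr rfl fun S _ => ?_
  · by_cases h : i ∈ S <;> simp [h]
  · by_cases h : i ∈ S
    · simp [h]
    · simp [h, Finset.prod_insert h]; ring

theorem mpoly_update {i : ι} {c : Finset ι → ℝ} (hc : ∀ S, i ∈ S → c S = 0) (x : ι → ℝ) (t : ℝ) :
    mpoly c (Function.update x i t) = mpoly c x := by
  refine Finset.sum_congr rfl fun S _ => ?_
  by_cases h : i ∈ S
  · simp [hc S h]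
  · rw [Finset.prod_update_of_notMem h]

theorem mpoly_update_eq_add (i : ι) (c : Finset ι → ℝ) (x : ι → ℝ) (t : ℝ) :
    mpoly c (Function.update x i t) = mpoly (coeffWithout i c) x + t * mpoly (coeffDeriv i c) x := by
  rw [mpoly_eq_add i, mpoly_update, mpoly_update, Function.update_self] <;>
  · intro S hS
    simp [coeffWithout, coeffDeriv, hS]

theorem sum_sq_coeff_eq_add (i : ι) (c : Finset ι → ℝ) :
    ∑ S, c S ^ 2 = ∑ S, coeffWithout i c S ^ 2 + ∑ S, coeffDeriv i c S ^ 2 := by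
  rw [sum_finset_eq_sum_insert i, Finset.sum_filter, Finset.sum_filter]
  congr 1 <;> refine Finset.sum_congr rfl fun S _ => ?_ <;>
  by_cases h : i ∈ S <;> simp [h, coeffWithout, coeffDeriv]

theorem sum_sq_coeffDeriv (i : ι) (c : Finset ι → ℝ) :
    ∑ S, coeffDeriv i c S ^ 2 = ∑ S with i ∈ S, c S ^ 2 := by
  rw [Finset.sum_filter, sum_finset_eq_sum_insert i (fun S => if i ∈ S then c S ^ 2 else 0),
    Finset.sum_filter, Finset.sum_filter, ← Finset.sum_add_distrib]
  refine Finset.sum_congr rfl fun S _ => ?_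
  by_cases h : i ∈ S <;> simp [h, coeffDeriv]

set_option linter.unusedSectionVars false in
@[fun_prop]
theorem measurable_mpoly (c : Finset ι → ℝ) : Measurable (mpoly c) := by
  unfold mpoly
  fun_prop

variable (ν : ι → Measure ℝ) [∀ i, HasStandardMoments (ν i)]

theorem integrable_prod_pow_four (S : Finset ι) :
    Integrable (fun x : ι → ℝ => (∏ i ∈ S, x i) ^ 4) (Measure.pi ν) := by
  have h : ∀ x : ι → ℝ, (∏ i ∈ S, x i) ^ 4 = ∏ i, (if i ∈ S then (x i) ^ 4 else 1) := by
    intro x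
    rw [Fintype.prod_ite_mem, Finset.prod_pow]
  simp_rw [h]
  refine Integrable.fintype_prod (f := fun i (t : ℝ) => if i ∈ S then t ^ 4 else 1) fun i => ?_
  split_ifs
  · exact HasStandardMoments.integrable_pow_four
  · exact integrable_const 1

theorem integrable_mpoly_pow_four (c : Finset ι → ℝ) :
    Integrable (fun x => mpoly c x ^ 4) (Measure.pi ν) := by
  have h : ∀ S : Finset ι, MemLp (fun x : ι → ℝ => c S * ∏ i ∈ S, x i) (4 : ℕ) (Measure.pi ν) := by
    intro S
    refine MemLp.const_mul ?_ _
    rw [← integrable_norm_rpow_iff (by fun_prop) (by norm_num) (by norm_num)]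
    refine (integrable_prod_pow_four ν S).congr (Filter.Eventually.of_forall fun x => ?_)
    simp only [ENNReal.toReal_natCast, Real.rpow_natCast, Real.norm_eq_abs]
    rw [← abs_pow, abs_of_nonneg (by positivity)]
  have h2 : MemLp (mpoly c) (4 : ℕ) (Measure.pi ν) :=
    memLp_finsetSum Finset.univ fun S _ => h S
  refine (h2.integrable_norm_pow (by norm_num)).congr (Filter.Eventually.of_forall fun x => ?_)
  simp only [Real.norm_eq_abs]
  rw [← abs_pow, abs_of_nonneg (by positivity)]

theorem integrable_mpoly_pow (c : Finset ι → ℝ) {j : ℕ} (hj : j ≤ 4) :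
    Integrable (fun x => mpoly c x ^ j) (Measure.pi ν) :=
  Integrable.pow_of_pow_four (by fun_prop) (integrable_mpoly_pow_four ν c) hj

theorem integral_prod_mul_prod (S T : Finset ι) :
    ∫ x, (∏ i ∈ S, x i) * (∏ i ∈ T, x i) ∂(Measure.pi ν) = if S = T then 1 else 0 := by
  have h : ∀ x : ι → ℝ, (∏ i ∈ S, x i) * (∏ i ∈ T, x i) =
      ∏ i, ((if i ∈ S then x i else 1) * (if i ∈ T then x i else 1)) := by
    intro x
    rw [Finset.prod_mul_distrib, Fintype.prod_ite_mem, Fintype.prod_ite_mem]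
  simp_rw [h]
  rw [integral_fintype_prod_eq_prod
    (fun i (t : ℝ) => (if i ∈ S then t else 1) * (if i ∈ T then t else 1))]
  split_ifs with hST
  · subst hST
    refine Finset.prod_eq_one fun i _ => ?_
    by_cases h : i ∈ S
    · simp [h, ← pow_two, HasStandardMoments.integral_sq]
    · simp [h]
  · have : ∃ i, ¬ (i ∈ S ↔ i ∈ T) := by
      by_contra hc
      push Not at hc
      exact hST (Finset.ext hc)
    obtain ⟨i, hi⟩ := this
    apply Finset.prod_eq_zero (Finset.mem_univ i)
    by_cases h1 : i ∈ S <;> by_cases h2 : i ∈ T <;>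
      simp_all [HasStandardMoments.integral_id]

theorem integrable_mul_of_sq {Ω : Type*} [MeasurableSpace Ω] {μ : Measure Ω} {f g : Ω → ℝ}
    (hf : AEStronglyMeasurable f μ) (hg : AEStronglyMeasurable g μ)
    (hf2 : Integrable (fun x => f x ^ 2) μ) (hg2 : Integrable (fun x => g x ^ 2) μ) :
    Integrable (fun x => f x * g x) μ := by
  refine (hf2.add hg2).mono' (hf.mul hg) (Filter.Eventually.of_forall fun x => ?_)
  rw [Real.norm_eq_abs, abs_mul, Pi.add_apply, ← sq_abs (f x), ← sq_abs (g x)]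
  nlinarith [sq_nonneg (|f x| - |g x|), abs_nonneg (f x), abs_nonneg (g x)]

theorem integrable_prod_mul_prod (S T : Finset ι) :
    Integrable (fun x : ι → ℝ => (∏ i ∈ S, x i) * (∏ i ∈ T, x i)) (Measure.pi ν) :=
  integrable_mul_of_sq (by fun_prop) (by fun_prop)
    (Integrable.pow_of_pow_four (by fun_prop) (integrable_prod_pow_four ν S) (by norm_num))
    (Integrable.pow_of_pow_four (by fun_prop) (integrable_prod_pow_four ν T) (by norm_num))

/-- Parseval: the monomials are orthonormal as soon as the coordinates are independent with mean 0
and variance 1. It therefore holds alike for Gaussian, Rademacher and mixed products. -/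
theorem integral_mpoly_sq (c : Finset ι → ℝ) :
    ∫ x, mpoly c x ^ 2 ∂(Measure.pi ν) = ∑ S, c S ^ 2 := by
  have h : ∀ x, mpoly c x ^ 2 =
      ∑ S, ∑ T, (c S * c T) * ((∏ i ∈ S, x i) * (∏ i ∈ T, x i)) := by
    intro x
    rw [pow_two, mpoly, Finset.sum_mul_sum]
    refine Finset.sum_congr rfl fun S _ => Finset.sum_congr rfl fun T _ => ?_
    ring
  simp_rw [h]
  rw [integral_finsetSum _ fun S _ => integrable_finsetSum _ fun T _ =>
    (integrable_prod_mul_prod ν S T).const_mul _]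
  refine Finset.sum_congr rfl fun S _ => ?_
  rw [integral_finsetSum _ fun T _ => (integrable_prod_mul_prod ν S T).const_mul _]
  simp_rw [integral_const_mul, integral_prod_mul_prod]
  simp [pow_two]

end Multilinear

/-! ### Hypercontractivity: fourth moments of polynomials of low degree. -/

section Hypercontractivity

variable {ι : Type*} [Fintype ι] [DecidableEq ι]

/-- Cauchy–Schwarz, read off from the discriminant of the nonnegative quadratic `s ↦ ∫ (s f + g)²`.
-/
theorem sq_integral_mul_le {Ω : Type*} [MeasurableSpace Ω] {μ : Measure Ω} {f g : Ω → ℝ}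
    (hf : AEStronglyMeasurable f μ) (hg : AEStronglyMeasurable g μ)
    (hf2 : Integrable (fun x => f x ^ 2) μ) (hg2 : Integrable (fun x => g x ^ 2) μ) :
    (∫ x, f x * g x ∂μ) ^ 2 ≤ (∫ x, f x ^ 2 ∂μ) * ∫ x, g x ^ 2 ∂μ := by
  have hfg := integrable_mul_of_sq hf hg hf2 hg2
  have h : ∀ s : ℝ, 0 ≤ (∫ x, f x ^ 2 ∂μ) * (s * s) + (2 * ∫ x, f x * g x ∂μ) * s +
      ∫ x, g x ^ 2 ∂μ := by
    intro s
    have h0 : 0 ≤ ∫ x, (s ^ 2 * f x ^ 2 + 2 * s * (f x * g x) + g x ^ 2) ∂μ :=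
      integral_nonneg fun x => by
        have : s ^ 2 * f x ^ 2 + 2 * s * (f x * g x) + g x ^ 2 = (s * f x + g x) ^ 2 := by ring
        rw [Pi.zero_apply, this]
        positivity
    rw [integral_add ((hf2.const_mul _).fun_add (hfg.const_mul _)) hg2,
      integral_add (hf2.const_mul _) (hfg.const_mul _), integral_const_mul,
      integral_const_mul] at h0
    linarith
  have := discrim_le_zero h
  rw [discrim] at this
  linarith

variable (ν : ι → Measure ℝ) [∀ i, HasStandardMoments (ν i)]

instance hasStandardMoments_update (i : ι) (τ : Measure ℝ) [HasStandardMoments τ] (j : ι) :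
    HasStandardMoments (Function.update ν i τ j) := by
  by_cases h : j = i
  · subst h; simpa
  · simp only [Function.update_of_ne h]; infer_instance

/-- Fubini with coordinate `i` isolated. The outer integral still runs over the old product, so two
choices of `τ` can be compared under one and the same outer measure. -/
theorem integral_update_eq (i : ι) (τ : Measure ℝ) [HasStandardMoments τ] {g : (ι → ℝ) → ℝ}
    (hg : Measurable g) (hgi : Integrable g (Measure.pi (Function.update ν i τ))) :
    Integrable (fun p : (ι → ℝ) × ℝ => g (Function.update p.1 i p.2)) ((Measure.pi ν).prod τ) ∧
    ∫ x, g x ∂(Measure.pi (Function.update ν i τ)) =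
      ∫ x, ∫ t, g (Function.update x i t) ∂τ ∂(Measure.pi ν) := by
  have hp := measurePreserving_update ν i τ
  have hint : Integrable (fun p : (ι → ℝ) × ℝ => g (Function.update p.1 i p.2))
      ((Measure.pi ν).prod τ) := hp.integrable_comp_of_integrable hgi
  refine ⟨hint, ?_⟩
  rw [← hp.map_eq, integral_map hp.measurable.aemeasurable hg.aestronglyMeasurable,
    integral_prod _ hint]

theorem integral_add_mul_pow_four (τ : Measure ℝ) [HasStandardMoments τ] (a b : ℝ) :
    ∫ t, (a + t * b) ^ 4 ∂τ = a ^ 4 + 6 * (a ^ 2 * b ^ 2) + (∫ t, t ^ 4 ∂τ) * b ^ 4 := by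
  have h : ∀ t : ℝ, (a + t * b) ^ 4 = a ^ 4 + (4 * a ^ 3 * b) * t ^ 1 +
      (6 * (a ^ 2 * b ^ 2)) * t ^ 2 + (4 * a * b ^ 3) * t ^ 3 + b ^ 4 * t ^ 4 := by
    intro t; ring
  have hi : ∀ j : ℕ, j ≤ 4 → ∀ r : ℝ, Integrable (fun t : ℝ => r * t ^ j) τ :=
    fun j hj r => (HasStandardMoments.integrable_pow τ hj).const_mul r
  have h1 := hi 1 (by norm_num) (4 * a ^ 3 * b)
  have h2 := hi 2 (by norm_num) (6 * (a ^ 2 * b ^ 2))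
  have h3 := hi 3 (by norm_num) (4 * a * b ^ 3)
  have h4 := hi 4 (by norm_num) (b ^ 4)
  have h0 : Integrable (fun _ : ℝ => a ^ 4) τ := integrable_const _
  simp_rw [h]
  rw [integral_add (((h0.fun_add h1).fun_add h2).fun_add h3) h4,
    integral_add ((h0.fun_add h1).fun_add h2) h3, integral_add (h0.fun_add h1) h2,
    integral_add h0 h1]
  have e1 : ∫ t, t ^ 1 ∂τ = 0 := by simpa using HasStandardMoments.integral_id (ν := τ)
  simp only [integral_const_mul, e1,
    HasStandardMoments.integral_sq, HasStandardMoments.integral_cube, integral_const]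
  simp
  ring

theorem integral_mpoly_pow_four_eq (i : ι) (c : Finset ι → ℝ) :
    ∫ x, mpoly c x ^ 4 ∂(Measure.pi ν) = ∫ x, mpoly (coeffWithout i c) x ^ 4 ∂(Measure.pi ν) +
      6 * ∫ x, mpoly (coeffWithout i c) x ^ 2 * mpoly (coeffDeriv i c) x ^ 2 ∂(Measure.pi ν) +
      (∫ t, t ^ 4 ∂(ν i)) * ∫ x, mpoly (coeffDeriv i c) x ^ 4 ∂(Measure.pi ν) := by
  have h := (integral_update_eq ν i (ν i) (g := fun x => mpoly c x ^ 4) (by fun_prop)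
    (integrable_mpoly_pow_four _ c)).2
  rw [Function.update_eq_self] at h
  rw [h]
  simp_rw [mpoly_update_eq_add, integral_add_mul_pow_four]
  have hA := integrable_mpoly_pow_four ν (coeffWithout i c)
  have hB := integrable_mpoly_pow_four ν (coeffDeriv i c)
  have hAB : Integrable
      (fun x => mpoly (coeffWithout i c) x ^ 2 * mpoly (coeffDeriv i c) x ^ 2) (Measure.pi ν) :=
    integrable_mul_of_sq (by fun_prop) (by fun_prop)
      (by simpa [← pow_mul] using hA) (by simpa [← pow_mul] using hB)
  rw [integral_add (hA.fun_add (hAB.const_mul 6)) (hB.const_mul _), integral_add hA (hAB.const_mul 6),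
    integral_const_mul, integral_const_mul]

/-- Hypercontractivity (Bonami's lemma): the fourth moment of a multilinear polynomial of degree
`≤ d` is bounded by the square of its second moment. -/
theorem integral_mpoly_pow_four_le (s : Finset ι) : ∀ (d : ℕ) (c : Finset ι → ℝ),
    (∀ S, ¬ (S ⊆ s ∧ S.card ≤ d) → c S = 0) →
    ∫ x, mpoly c x ^ 4 ∂(Measure.pi ν) ≤ 100 ^ d * (∑ S, c S ^ 2) ^ 2 := by
  induction s using Finset.induction_on with
  | empty =>
    intro d c hc
    have hc' : ∀ S : Finset ι, S ≠ ∅ → c S = 0 := fun S hS => hc S fun h => hS (by simpa using h.1)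
    have h1 : ∀ x, mpoly c x = c ∅ := by
      intro x
      rw [mpoly, Finset.sum_eq_single ∅]
      · simp
      · intro S _ hS; simp [hc' S hS]
      · simp
    have h2 : ∑ S, c S ^ 2 = c ∅ ^ 2 := by
      rw [Finset.sum_eq_single ∅]
      · intro S _ hS; simp [hc' S hS]
      · simp
    simp_rw [h1, h2]
    have : (1 : ℝ) ≤ 100 ^ d := one_le_pow₀ (by norm_num)
    simp only [integral_const, probReal_univ, one_smul]
    nlinarith [mul_nonneg (sub_nonneg.2 this) (sq_nonneg (c ∅ ^ 2))]
  | insert i s his ih =>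
    intro d c hc
    set A := coeffWithout i c with hAdef
    set B := coeffDeriv i c with hBdef
    have hA : ∀ S, ¬ (S ⊆ s ∧ S.card ≤ d) → A S = 0 := by
      intro S hS
      by_cases hi : i ∈ S
      · simp [hAdef, coeffWithout, hi]
      · simp only [hAdef, coeffWithout, hi, if_false]
        exact hc S fun h => hS ⟨(Finset.subset_insert_iff_of_notMem hi).1 h.1, h.2⟩
    have hB : ∀ S, ¬ (S ⊆ s ∧ S.card + 1 ≤ d) → B S = 0 := by
      intro S hS
      by_cases hi : i ∈ S
      · simp [hBdef, coeffDeriv, hi]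
      · simp only [hBdef, coeffDeriv, hi, if_false]
        refine hc _ fun h => hS ⟨?_, ?_⟩
        · exact (Finset.insert_subset_insert_iff hi).1 h.1
        · simpa [Finset.card_insert_of_notMem hi] using h.2
    have hA4 := ih d A hA
    rw [integral_mpoly_pow_four_eq ν i c, sum_sq_coeff_eq_add i c, ← hAdef, ← hBdef]
    -- In degree 0 the derivative part vanishes. In degree `d + 1` it has degree `d`, which saves
    -- the factor 100 that pays for the fourth moment of `x_i`.
    rcases d with _ | d
    · have hB0 : ∀ S, B S = 0 := fun S => hB S (by simp)
      have hBx : ∀ x, mpoly B x = 0 := fun x => by simp [mpoly, hB0]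
      simpa [hBx, hB0] using hA4
    · have hB4 := ih d B fun S hS => hB S fun h => hS ⟨h.1, by omega⟩
      set α := ∑ S, A S ^ 2
      set β := ∑ S, B S ^ 2
      have hα : 0 ≤ α := Finset.sum_nonneg fun _ _ => sq_nonneg _
      have hβ : 0 ≤ β := Finset.sum_nonneg fun _ _ => sq_nonneg _
      have hA4' : Integrable (fun x => (mpoly A x ^ 2) ^ 2) (Measure.pi ν) := by
        simpa [← pow_mul] using integrable_mpoly_pow_four ν A
      have hB4' : Integrable (fun x => (mpoly B x ^ 2) ^ 2) (Measure.pi ν) := by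
        simpa [← pow_mul] using integrable_mpoly_pow_four ν B
      have hcs := sq_integral_mul_le (μ := Measure.pi ν) (f := fun x => mpoly A x ^ 2)
        (g := fun x => mpoly B x ^ 2) (by fun_prop) (by fun_prop) hA4' hB4'
      simp only [← pow_mul] at hcs
      set MA := ∫ x, mpoly A x ^ 4 ∂(Measure.pi ν)
      set MB := ∫ x, mpoly B x ^ 4 ∂(Measure.pi ν)
      set M := ∫ x, mpoly A x ^ 2 * mpoly B x ^ 2 ∂(Measure.pi ν)
      have hMB : 0 ≤ MB := integral_nonneg fun x => by simp only [Pi.zero_apply]; positivity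
      have h100 : (0 : ℝ) < 100 ^ d := by positivity
      -- Cauchy–Schwarz and the two inductive bounds: the factor is `√(100^(d+1) · 100^d) = 10 ·
      -- 100^d`.
      have hM : M ≤ 10 * 100 ^ d * (α * β) := by
        refine abs_le_of_sq_le_sq' ?_ (by positivity) |>.2
        calc M ^ 2 ≤ MA * MB := hcs
          _ ≤ (100 ^ (d + 1) * α ^ 2) * (100 ^ d * β ^ 2) :=
            mul_le_mul hA4 hB4 hMB (by positivity)
          _ = (10 * 100 ^ d * (α * β)) ^ 2 := by ring
      have hm4 := HasStandardMoments.integral_pow_four_le (ν := ν i)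
      calc MA + 6 * M + (∫ t, t ^ 4 ∂(ν i)) * MB
          ≤ 100 ^ (d + 1) * α ^ 2 + 6 * (10 * 100 ^ d * (α * β)) + 100 * (100 ^ d * β ^ 2) := by
            gcongr
        -- The cross term has coefficient 60 on the left, against 200 available on the right.
        _ ≤ 100 ^ (d + 1) * (α + β) ^ 2 := by
            have : 0 ≤ 100 ^ d * (α * β) := by positivity
            have h1 : (100 : ℝ) ^ (d + 1) * (α + β) ^ 2 = 100 ^ (d + 1) * α ^ 2 +
              200 * (100 ^ d * (α * β)) + 100 * (100 ^ d * β ^ 2) := by ring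
            rw [h1]
            linarith

/-! ### A test function with Lipschitz second derivative -/

/-- The third-order Taylor remainder of `s ↦ (s⁺)³`. -/
theorem abs_cube_posPart_taylor (a h : ℝ) :
    |(max (a + h) 0) ^ 3 - (max a 0) ^ 3 - 3 * (max a 0) ^ 2 * h - 3 * max a 0 * h ^ 2| ≤ |h| ^ 3 := by
  rcases le_total 0 a with ha | ha <;> rcases le_total 0 (a + h) with hb | hb
  · rw [max_eq_left ha, max_eq_left hb, ← abs_pow]
    apply le_of_eq
    congr 1
    ring
  · rw [max_eq_left ha, max_eq_right hb, abs_of_nonpos (show h ≤ 0 by linarith), abs_le]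
    constructor <;> nlinarith [pow_nonneg ha 3, pow_nonneg (neg_nonneg.2 hb) 3,
      mul_nonneg ha (sq_nonneg (a + h)), mul_nonneg (neg_nonneg.2 hb) (sq_nonneg a),
      mul_nonneg (neg_nonneg.2 hb) (sq_nonneg h), mul_nonneg ha (sq_nonneg h)]
  · rw [max_eq_right ha, max_eq_left hb, abs_of_nonneg (show 0 ≤ h by linarith)]
    have : (a + h) ^ 3 ≤ h ^ 3 := pow_le_pow_left₀ hb (by linarith) 3
    rw [show (a + h) ^ 3 - 0 ^ 3 - 3 * 0 ^ 2 * h - 3 * 0 * h ^ 2 = (a + h) ^ 3 by ring,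
      abs_of_nonneg (pow_nonneg hb 3)]
    exact this
  · rw [max_eq_right ha, max_eq_right hb]
    simp

/-- A function which vanishes on `(-∞, 0]`, is close to `s ↦ s²` on `[0, ∞)` for small `l`, and has
a Lipschitz second derivative. -/
def smoothSq (l s : ℝ) : ℝ := ((max s 0) ^ 3 - (max (s - l) 0) ^ 3) / (3 * l)

theorem continuous_smoothSq (l : ℝ) : Continuous (smoothSq l) := by
  unfold smoothSq
  fun_prop

theorem smoothSq_nonneg {l : ℝ} (hl : 0 < l) (s : ℝ) : 0 ≤ smoothSq l s := by
  refine div_nonneg (sub_nonneg.2 ?_) (by positivity)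
  exact pow_le_pow_left₀ (le_max_right _ _) (max_le_max (by linarith) le_rfl) 3

/-- `smoothSq l s` is the average of `(t⁺)²` over `t ∈ [s - l, s]`, and `(t⁺)²` is increasing in
`t`. -/
theorem smoothSq_le {l : ℝ} (hl : 0 < l) (s : ℝ) : smoothSq l s ≤ (max s 0) ^ 2 := by
  rw [smoothSq, div_le_iff₀ (by positivity)]
  rcases le_total s 0 with hs | hs
  · rw [max_eq_right hs, max_eq_right (by linarith)]; simp
  · rw [max_eq_left hs]
    rcases le_total (s - l) 0 with h | h
    · rw [max_eq_right h]
      nlinarith [mul_nonneg (sq_nonneg s) (show 0 ≤ l - s by linarith), mul_nonneg (sq_nonneg s) hl.le]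
    · rw [max_eq_left h]
      nlinarith [mul_nonneg (sq_nonneg l) hs, mul_nonneg (sq_nonneg l) h, mul_nonneg (sq_nonneg l) hl.le]

/-- Average `(s⁺)² - (t⁺)² ≤ 2 s⁺ (s - t)` over `t ∈ [s - l, s]`. -/
theorem sq_posPart_le {l : ℝ} (hl : 0 < l) (s : ℝ) :
    (max s 0) ^ 2 ≤ smoothSq l s + l * max s 0 := by
  rw [← sub_le_iff_le_add, smoothSq, le_div_iff₀ (by positivity)]
  rcases le_total s 0 with hs | hs
  · rw [max_eq_right hs, max_eq_right (by linarith)]; simp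
  · rw [max_eq_left hs]
    rcases le_total (s - l) 0 with h | h
    · rw [max_eq_right h]
      nlinarith [mul_nonneg hs (show 0 ≤ l - s by linarith), pow_nonneg hs 3,
        mul_nonneg (mul_nonneg hs hl.le) (show 0 ≤ l - s by linarith)]
    · rw [max_eq_left h]
      nlinarith [pow_pos hl 3]

/-- Two cubic remainders, each at most `|h|³`, are divided by `3 l`. The coefficients `p`, `q` do
not depend on `h`, which is all that the moment matching needs. -/
theorem exists_smoothSq_taylor {l : ℝ} (hl : 0 < l) (a : ℝ) :
    ∃ p q : ℝ, ∀ h : ℝ,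
      |smoothSq l (a + h) - (smoothSq l a + p * h + q * h ^ 2)| ≤ |h| ^ 3 / l := by
  refine ⟨(3 * (max a 0) ^ 2 - 3 * (max (a - l) 0) ^ 2) / (3 * l),
    (3 * max a 0 - 3 * max (a - l) 0) / (3 * l), fun h => ?_⟩
  have h1 := abs_cube_posPart_taylor a h
  have h2 := abs_cube_posPart_taylor (a - l) h
  rw [show a - l + h = a + h - l by ring] at h2
  have e : smoothSq l (a + h) - (smoothSq l a +
      (3 * (max a 0) ^ 2 - 3 * (max (a - l) 0) ^ 2) / (3 * l) * h +
      (3 * max a 0 - 3 * max (a - l) 0) / (3 * l) * h ^ 2) =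
      (((max (a + h) 0) ^ 3 - (max a 0) ^ 3 - 3 * (max a 0) ^ 2 * h - 3 * max a 0 * h ^ 2) -
      ((max (a + h - l) 0) ^ 3 - (max (a - l) 0) ^ 3 - 3 * (max (a - l) 0) ^ 2 * h -
        3 * max (a - l) 0 * h ^ 2)) / (3 * l) := by
    unfold smoothSq
    field_simp
    ring
  rw [e, abs_div, abs_of_pos (show 0 < 3 * l by positivity), div_le_div_iff₀ (by positivity) hl]
  have h3 := (abs_sub _ _).trans (add_le_add h1 h2)
  have h4 : 0 ≤ |h| ^ 3 := by positivity
  nlinarith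

end Hypercontractivity

section Invariance

variable {ι : Type*} [Fintype ι] [DecidableEq ι]

/-! ### The invariance principle -/

theorem smoothSq_le_sq {l : ℝ} (hl : 0 < l) (s : ℝ) : smoothSq l (s - 1) ≤ s ^ 2 := by
  refine (smoothSq_le hl _).trans ?_
  rcases le_total (s - 1) 0 with h | h
  · rw [max_eq_right h]; simpa using sq_nonneg s
  · rw [max_eq_left h]; nlinarith

theorem integrable_smoothSq_sub_one {Ω : Type*} [MeasurableSpace Ω] {μ : Measure Ω} {l : ℝ}
    (hl : 0 < l) {f : Ω → ℝ} (hf : AEStronglyMeasurable f μ)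
    (hf2 : Integrable (fun x => f x ^ 2) μ) : Integrable (fun x => smoothSq l (f x - 1)) μ := by
  refine hf2.mono' ?_ (Filter.Eventually.of_forall fun x => ?_)
  · exact (continuous_smoothSq l).comp_aestronglyMeasurable (hf.sub aestronglyMeasurable_const)
  · rw [Real.norm_eq_abs, abs_of_nonneg (smoothSq_nonneg hl _)]
    exact smoothSq_le_sq hl _

/-- Both laws have mean 0 and variance 1, so the quadratic Taylor polynomial at `a - 1` has the same
integral under both. What remains is two cubic remainders, each at most `101 |b|³ / l` on average.
-/
theorem abs_integral_smoothSq_sub_le {l : ℝ} (hl : 0 < l) (τ τ' : Measure ℝ)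
    [HasStandardMoments τ] [HasStandardMoments τ'] (a b : ℝ) :
    |∫ t, smoothSq l (a + t * b - 1) ∂τ - ∫ t, smoothSq l (a + t * b - 1) ∂τ'| ≤
      202 / l * |b| ^ 3 := by
  obtain ⟨p, q, hpq⟩ := exists_smoothSq_taylor hl (a - 1)
  have key : ∀ (σ : Measure ℝ) [HasStandardMoments σ],
      |∫ t, smoothSq l (a + t * b - 1) ∂σ - (smoothSq l (a - 1) + q * b ^ 2)| ≤
        101 / l * |b| ^ 3 := by
    intro σ _
    have i1 := (HasStandardMoments.integrable_pow σ (j := 1) (by norm_num)).const_mul (p * b)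
    have i2 := (HasStandardMoments.integrable_pow σ (j := 2) (by norm_num)).const_mul (q * b ^ 2)
    have i0 : Integrable (fun _ : ℝ => smoothSq l (a - 1)) σ := integrable_const _
    have i3 := (HasStandardMoments.integrable_abs_cube σ).const_mul (|b| ^ 3 / l)
    have e1 : ∫ t, t ^ 1 ∂σ = 0 := by simpa using HasStandardMoments.integral_id (ν := σ)
    have he : ∫ t, (smoothSq l (a - 1) + p * b * t ^ 1 + q * b ^ 2 * t ^ 2) ∂σ =
        smoothSq l (a - 1) + q * b ^ 2 := by
      rw [integral_add (i0.fun_add i1) i2, integral_add i0 i1]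
      simp only [integral_const_mul, e1, HasStandardMoments.integral_sq, integral_const]
      simp
    have iψ : Integrable (fun t => smoothSq l (a + t * b - 1)) σ := by
      refine integrable_smoothSq_sub_one hl (by fun_prop) ?_
      have : ∀ t : ℝ, (a + t * b) ^ 2 = a ^ 2 + (2 * a * b) * t ^ 1 + b ^ 2 * t ^ 2 := by
        intro t; ring
      simp_rw [this]
      exact ((integrable_const _).add
        ((HasStandardMoments.integrable_pow σ (by norm_num)).const_mul _)).add
        ((HasStandardMoments.integrable_pow σ (by norm_num)).const_mul _)
    rw [← he, ← integral_sub iψ ((i0.fun_add i1).fun_add i2)]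
    calc |∫ t, (smoothSq l (a + t * b - 1) -
          (smoothSq l (a - 1) + p * b * t ^ 1 + q * b ^ 2 * t ^ 2)) ∂σ|
        ≤ ∫ t, |b| ^ 3 / l * |t| ^ 3 ∂σ := by
          rw [← Real.norm_eq_abs]
          refine norm_integral_le_of_norm_le i3 (Filter.Eventually.of_forall fun t => ?_)
          have := hpq (t * b)
          rw [Real.norm_eq_abs]
          convert this using 1
          · congr 1
            rw [show a - 1 + t * b = a + t * b - 1 by ring]
            ring
          · rw [abs_mul]; ring
      _ ≤ 101 / l * |b| ^ 3 := by
          rw [integral_const_mul]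
          have := HasStandardMoments.integral_abs_cube_le σ
          calc |b| ^ 3 / l * ∫ t, |t| ^ 3 ∂σ ≤ |b| ^ 3 / l * 101 := by gcongr
            _ = _ := by ring
  calc _ ≤ |∫ t, smoothSq l (a + t * b - 1) ∂τ - (smoothSq l (a - 1) + q * b ^ 2)| +
        |∫ t, smoothSq l (a + t * b - 1) ∂τ' - (smoothSq l (a - 1) + q * b ^ 2)| := by
          rw [abs_sub_comm (∫ t, smoothSq l (a + t * b - 1) ∂τ')]
          exact abs_sub_le _ _ _
    _ ≤ 101 / l * |b| ^ 3 + 101 / l * |b| ^ 3 := add_le_add (key τ) (key τ')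
    _ = _ := by ring

/-- The influence of `i` on the multilinear polynomial with coefficients `c`. -/
def coeffInfluence (c : Finset ι → ℝ) (i : ι) : ℝ := ∑ S with i ∈ S, c S ^ 2

theorem coeffInfluence_nonneg (c : Finset ι → ℝ) (i : ι) : 0 ≤ coeffInfluence c i :=
  Finset.sum_nonneg fun _ _ => sq_nonneg _

/-- Summed over `i`, the influences count each `c S ^ 2` exactly `|S|` times. -/
theorem sum_coeffInfluence_le {d : ℕ} {c : Finset ι → ℝ} (hc : ∀ S, d < S.card → c S = 0) :
    ∑ i, coeffInfluence c i ≤ d * ∑ S, c S ^ 2 := by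
  simp only [coeffInfluence, Finset.sum_filter]
  rw [Finset.sum_comm, Finset.mul_sum]
  refine Finset.sum_le_sum fun S _ => ?_
  rw [← Finset.sum_filter]
  simp only [Finset.sum_const, Finset.filter_mem_eq_inter, Finset.univ_inter, nsmul_eq_mul]
  rcases le_or_gt S.card d with h | h
  · gcongr
  · simp [hc S h]

/-- The second moment of the derivative is the influence `I`, and hypercontractivity bounds its
fourth moment by `100^d I² ≤ 100^d θ² I`. Interpolating gives a third moment of order `θ I`: the
additional `θ` is what makes the sum over all coordinates small. -/
theorem integral_abs_cube_coeffDeriv_le (ν : ι → Measure ℝ) [∀ i, HasStandardMoments (ν i)] {d : ℕ}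
    {c : Finset ι → ℝ} (hc : ∀ S, d < S.card → c S = 0) (i : ι) {θ : ℝ} (hθ : 0 < θ)
    (hi : coeffInfluence c i ≤ θ ^ 2) :
    Integrable (fun x => |mpoly (coeffDeriv i c) x| ^ 3) (Measure.pi ν) ∧
    ∫ x, |mpoly (coeffDeriv i c) x| ^ 3 ∂(Measure.pi ν) ≤ θ * 100 ^ d * coeffInfluence c i := by
  set B := coeffDeriv i c with hB
  have h3 : Integrable (fun x => |mpoly B x| ^ 3) (Measure.pi ν) := by
    simpa [abs_pow] using (integrable_mpoly_pow ν B (j := 3) (by norm_num)).abs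
  refine ⟨h3, ?_⟩
  have h2 := integrable_mpoly_pow ν B (j := 2) (by norm_num)
  have h4 := integrable_mpoly_pow_four ν B
  have hcB : ∀ S, ¬ (S ⊆ Finset.univ ∧ S.card ≤ d) → B S = 0 := by
    intro S hS
    simp only [Finset.subset_univ, true_and, not_le] at hS
    by_cases hiS : i ∈ S
    · simp [hB, coeffDeriv, hiS]
    · simp only [hB, coeffDeriv, hiS, if_false]
      exact hc _ (by rw [Finset.card_insert_of_notMem hiS]; omega)
  have hbon := integral_mpoly_pow_four_le ν Finset.univ d B hcB
  have hpar := integral_mpoly_sq ν B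
  have hI : ∑ S, B S ^ 2 = coeffInfluence c i := sum_sq_coeffDeriv i c
  have hI0 := coeffInfluence_nonneg c i
  rw [hI] at hbon hpar
  set I := coeffInfluence c i
  -- The arithmetic–geometric mean inequality, weighted so that both terms are of order `θ I` after
  -- integration.
  have hpt : ∀ u : ℝ, |u| ^ 3 ≤ θ / 2 * u ^ 2 + 1 / (2 * θ) * u ^ 4 := by
    intro u
    have e : θ / 2 * u ^ 2 + 1 / (2 * θ) * u ^ 4 - |u| ^ 3 =
        |u| ^ 2 * (θ - |u|) ^ 2 / (2 * θ) := by
      rw [← sq_abs u, show u ^ 4 = (u ^ 2) ^ 2 by ring, ← sq_abs u]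
      field_simp
      ring
    have : 0 ≤ |u| ^ 2 * (θ - |u|) ^ 2 / (2 * θ) := by positivity
    linarith
  have h100 : (1 : ℝ) ≤ 100 ^ d := one_le_pow₀ (by norm_num)
  calc ∫ x, |mpoly B x| ^ 3 ∂(Measure.pi ν)
      ≤ ∫ x, (θ / 2 * mpoly B x ^ 2 + 1 / (2 * θ) * mpoly B x ^ 4) ∂(Measure.pi ν) :=
        integral_mono h3 ((h2.const_mul _).add (h4.const_mul _)) fun x => hpt _
    _ = θ / 2 * I + 1 / (2 * θ) * ∫ x, mpoly B x ^ 4 ∂(Measure.pi ν) := by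
        rw [integral_add (h2.const_mul _) (h4.const_mul _), integral_const_mul,
          integral_const_mul, hpar]
    _ ≤ θ / 2 * I + 1 / (2 * θ) * (100 ^ d * (I * θ ^ 2)) := by
        have : I ^ 2 ≤ I * θ ^ 2 := by rw [pow_two]; gcongr
        gcongr
        exact hbon.trans (by gcongr)
    _ = θ / 2 * I + θ / 2 * (100 ^ d * I) := by field_simp
    _ ≤ θ / 2 * (100 ^ d * I) + θ / 2 * (100 ^ d * I) := by
        have : I ≤ 100 ^ d * I := le_mul_of_one_le_left hI0 h100
        gcongr
    _ = _ := by ring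

/-- One replacement step: conditionally on the other coordinates the polynomial is `a + t b` with
`b` its derivative in `x_i`, and the error `|b|³` is then averaged. -/
theorem abs_integral_update_sub_le {l : ℝ} (hl : 0 < l)
    (ν : ι → Measure ℝ) [∀ i, HasStandardMoments (ν i)] {d : ℕ}
    {c : Finset ι → ℝ} (hc : ∀ S, d < S.card → c S = 0) (i : ι) {θ : ℝ} (hθ : 0 < θ)
    (hi : coeffInfluence c i ≤ θ ^ 2) (τ τ' : Measure ℝ)
    [HasStandardMoments τ] [HasStandardMoments τ'] :
    |∫ x, smoothSq l (mpoly c x - 1) ∂(Measure.pi (Function.update ν i τ)) -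
      ∫ x, smoothSq l (mpoly c x - 1) ∂(Measure.pi (Function.update ν i τ'))| ≤
      202 / l * (θ * 100 ^ d * coeffInfluence c i) := by
  have hm : Measurable fun x => smoothSq l (mpoly c x - 1) :=
    (continuous_smoothSq l).measurable.comp (by fun_prop)
  have key : ∀ (σ : Measure ℝ) [HasStandardMoments σ],
      Integrable (fun x => ∫ t, smoothSq l (mpoly (coeffWithout i c) x +
        t * mpoly (coeffDeriv i c) x - 1) ∂σ) (Measure.pi ν) ∧
      ∫ x, smoothSq l (mpoly c x - 1) ∂(Measure.pi (Function.update ν i σ)) =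
      ∫ x, ∫ t, smoothSq l (mpoly (coeffWithout i c) x +
        t * mpoly (coeffDeriv i c) x - 1) ∂σ ∂(Measure.pi ν) := by
    intro σ _
    have := integral_update_eq ν i σ hm (integrable_smoothSq_sub_one hl (by fun_prop)
      (integrable_mpoly_pow _ c (by norm_num)))
    simp_rw [mpoly_update_eq_add] at this
    exact ⟨this.1.integral_prod_left, this.2⟩
  obtain ⟨h3, h3'⟩ := integral_abs_cube_coeffDeriv_le ν hc i hθ hi
  rw [(key τ).2, (key τ').2, ← integral_sub (key τ).1 (key τ').1]
  rw [← Real.norm_eq_abs]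
  calc _ ≤ ∫ x, 202 / l * |mpoly (coeffDeriv i c) x| ^ 3 ∂(Measure.pi ν) :=
        norm_integral_le_of_norm_le (h3.const_mul _) (Filter.Eventually.of_forall fun x =>
          abs_integral_smoothSq_sub_le hl τ τ' _ _)
    _ ≤ _ := by
        rw [integral_const_mul]
        gcongr

/-- The invariance principle for the test function `s ↦ smoothSq l (s - 1)`. -/
theorem abs_integral_smoothSq_gaussian_sub_rademacher_le {l : ℝ} (hl : 0 < l) {d : ℕ}
    {c : Finset ι → ℝ} (hc : ∀ S, d < S.card → c S = 0) {θ : ℝ} (hθ : 0 < θ)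
    (hi : ∀ i, coeffInfluence c i ≤ θ ^ 2) :
    |∫ x, smoothSq l (mpoly c x - 1) ∂(Measure.pi fun _ : ι => gaussianReal 0 1) -
      ∫ x, smoothSq l (mpoly c x - 1) ∂(Measure.pi fun _ : ι => rademacher)| ≤
      202 / l * (θ * 100 ^ d * (d * ∑ S, c S ^ 2)) := by
  -- Lindeberg's hybrids: coordinates in `s` are Gaussian, the others Rademacher. Enlarging `s` by
  -- one element at a time leads from one product to the other.
  let ν : Finset ι → ι → Measure ℝ := fun s i => if i ∈ s then gaussianReal 0 1 else rademacher
  have hν : ∀ s i, HasStandardMoments (ν s i) := by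
    intro s i
    by_cases h : i ∈ s
    · simp only [ν, h, if_true]; infer_instance
    · simp only [ν, h, if_false]; infer_instance
  have key : ∀ s : Finset ι,
      |∫ x, smoothSq l (mpoly c x - 1) ∂(Measure.pi (ν s)) -
        ∫ x, smoothSq l (mpoly c x - 1) ∂(Measure.pi (ν ∅))| ≤
        ∑ i ∈ s, 202 / l * (θ * 100 ^ d * coeffInfluence c i) := by
    intro s
    induction s using Finset.induction_on with
    | empty => simp
    | insert i s his ih =>
      have h1 : ν (insert i s) = Function.update (ν s) i (gaussianReal 0 1) := by
        ext1 j
        by_cases hj : j = i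
        · subst hj; simp [ν]
        · simp [ν, hj]
      have h2 : ν s = Function.update (ν s) i rademacher := by
        rw [eq_comm, Function.update_eq_self_iff]
        simp [ν, his]
      have hstep := abs_integral_update_sub_le hl (ν s) hc i hθ (hi i) (gaussianReal 0 1) rademacher
      rw [← h1, ← h2] at hstep
      rw [Finset.sum_insert his]
      exact (abs_sub_le _ _ _).trans (add_le_add hstep ih)
  have h := key Finset.univ
  have e1 : ν Finset.univ = fun _ => gaussianReal 0 1 := by simp [ν]
  have e2 : ν ∅ = fun _ => rademacher := by simp [ν]
  rw [e1, e2, ← Finset.mul_sum, ← Finset.mul_sum] at h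
  refine h.trans ?_
  have := sum_coeffInfluence_le hc
  gcongr

end Invariance

/-! ### Gaussian noise stability in coordinates -/

/-- The standard Gaussian law on `ℝⁿ`, as a product measure. -/
abbrev gaussianPi (n : ℕ) : Measure (Fin n → ℝ) := Measure.pi fun _ => gaussianReal 0 1

/-- The noisy copy `ρ x + √(1 - ρ²) z` of `x`. -/
def mix {n : ℕ} (ρ : ℝ) (p : (Fin n → ℝ) × (Fin n → ℝ)) : Fin n → ℝ :=
  fun i => ρ * p.1 i + √(1 - ρ ^ 2) * p.2 i

/-- The Gaussian noise stability of `h : ℝⁿ → ℝᵏ`, in coordinates. -/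
def stabPi {n k : ℕ} (ρ : ℝ) (h : (Fin n → ℝ) → EuclideanSpace ℝ (Fin k)) : ℝ :=
  ∫ p, ⟪h p.1, h (mix ρ p)⟫ ∂((gaussianPi n).prod (gaussianPi n))

@[fun_prop]
theorem measurable_mix {n : ℕ} (ρ : ℝ) : Measurable (mix (n := n) ρ) := by
  unfold mix
  fun_prop

theorem integral_comp_measurePreserving {α β G : Type*} [MeasurableSpace α] [MeasurableSpace β]
    [NormedAddCommGroup G] [NormedSpace ℝ G] {μ : Measure α} {ν : Measure β} {f : α → β}
    (hf : MeasurePreserving f μ ν) {g : β → G} (hg : AEStronglyMeasurable g ν) :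
    ∫ x, g (f x) ∂μ = ∫ y, g y ∂ν := by
  rw [← hf.map_eq] at hg ⊢
  rw [integral_map hf.measurable.aemeasurable hg]

theorem gaussianStab_comp_ofLp {n k : ℕ} (ρ : ℝ) {h : (Fin n → ℝ) → EuclideanSpace ℝ (Fin k)}
    (hh : Measurable h) : gaussianStab ρ (fun x => h x.ofLp) = stabPi ρ h := by
  have hm : MeasurePreserving (WithLp.toLp 2 : (Fin n → ℝ) → EuclideanSpace ℝ (Fin n))
      (gaussianPi n) (stdGaussian (EuclideanSpace ℝ (Fin n))) :=
    ⟨by fun_prop, map_pi_eq_stdGaussian⟩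
  have hinner : Measurable fun p : EuclideanSpace ℝ (Fin n) × EuclideanSpace ℝ (Fin n) =>
      (⟪h p.1.ofLp, h p.2.ofLp⟫ : ℝ) := by fun_prop
  rw [gaussianStab, correlatedGaussian, integral_map (by fun_prop) hinner.aestronglyMeasurable,
    ← integral_comp_measurePreserving (hm.prod hm)]
  · rfl
  · exact (hinner.comp (by fun_prop)).aestronglyMeasurable

theorem measurePreserving_mix_one {ρ : ℝ} (h : ρ ^ 2 ≤ 1) :
    MeasurePreserving (fun p : ℝ × ℝ => ρ * p.1 + √(1 - ρ ^ 2) * p.2)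
      ((gaussianReal 0 1).prod (gaussianReal 0 1)) (gaussianReal 0 1) := by
  refine ⟨by fun_prop, ?_⟩
  have h1 : (fun p : ℝ × ℝ => ρ * p.1 + √(1 - ρ ^ 2) * p.2) =
      (fun p : ℝ × ℝ => p.1 + p.2) ∘ (Prod.map (ρ * ·) (√(1 - ρ ^ 2) * ·)) := rfl
  rw [h1, ← Measure.map_map (by fun_prop) (by fun_prop), ← Measure.map_prod_map _ _
    (by fun_prop) (by fun_prop), gaussianReal_map_const_mul, gaussianReal_map_const_mul]
  have h2 := gaussianReal_conv_gaussianReal (m₁ := 0) (m₂ := 0)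
    (v₁ := (⟨ρ ^ 2, sq_nonneg _⟩ : NNReal)) (v₂ := (⟨√(1 - ρ ^ 2) ^ 2, sq_nonneg _⟩ : NNReal))
  rw [Measure.conv] at h2
  simp only [mul_zero, mul_one]
  refine h2.trans ?_
  have hv : (⟨ρ ^ 2, sq_nonneg _⟩ + ⟨√(1 - ρ ^ 2) ^ 2, sq_nonneg _⟩ : NNReal) = 1 := by
    apply NNReal.eq
    change ρ ^ 2 + √(1 - ρ ^ 2) ^ 2 = 1
    rw [Real.sq_sqrt (by linarith)]
    ring
  rw [hv, add_zero]

theorem measurePreserving_mix {n : ℕ} {ρ : ℝ} (h : ρ ^ 2 ≤ 1) :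
    MeasurePreserving (mix (n := n) ρ) ((gaussianPi n).prod (gaussianPi n)) (gaussianPi n) := by
  have h1 := (measurePreserving_arrowProdEquivProdArrow ℝ ℝ (Fin n)
    (fun _ => gaussianReal 0 1) (fun _ => gaussianReal 0 1)).symm
  have h2 := measurePreserving_pi (fun _ : Fin n => (gaussianReal 0 1).prod (gaussianReal 0 1))
    (fun _ : Fin n => gaussianReal 0 1) fun _ => measurePreserving_mix_one h
  exact h2.comp h1

section Stability

variable {n k : ℕ}

/-- The vector-valued multilinear polynomial `∑_S (∏_{i ∈ S} x_i) C_S`. -/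
def vpoly (C : Finset (Fin n) → EuclideanSpace ℝ (Fin k)) (x : Fin n → ℝ) :
    EuclideanSpace ℝ (Fin k) := ∑ S, (∏ i ∈ S, x i) • C S

@[fun_prop]
theorem measurable_vpoly (C : Finset (Fin n) → EuclideanSpace ℝ (Fin k)) : Measurable (vpoly C) := by
  unfold vpoly
  fun_prop

theorem inner_vpoly (C : Finset (Fin n) → EuclideanSpace ℝ (Fin k)) (u : EuclideanSpace ℝ (Fin k))
    (x : Fin n → ℝ) : ⟪u, vpoly C x⟫ = mpoly (fun S => ⟪u, C S⟫) x := by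
  simp only [vpoly, mpoly, inner_sum, real_inner_smul_right]
  exact Finset.sum_congr rfl fun S _ => mul_comm _ _

theorem norm_sq_vpoly (C : Finset (Fin n) → EuclideanSpace ℝ (Fin k)) (x : Fin n → ℝ) :
    ‖vpoly C x‖ ^ 2 = ∑ j, mpoly (fun S => C S j) x ^ 2 := by
  rw [EuclideanSpace.norm_sq_eq]
  refine Finset.sum_congr rfl fun j _ => ?_
  simp [vpoly, mpoly, mul_comm]

theorem integrable_norm_sq_vpoly (ν : Fin n → Measure ℝ) [∀ i, HasStandardMoments (ν i)]
    (C : Finset (Fin n) → EuclideanSpace ℝ (Fin k)) :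
    Integrable (fun x => ‖vpoly C x‖ ^ 2) (Measure.pi ν) := by
  simp_rw [norm_sq_vpoly]
  exact integrable_finsetSum _ fun j _ => integrable_mpoly_pow ν _ (by norm_num)

theorem integral_norm_sq_vpoly (ν : Fin n → Measure ℝ) [∀ i, HasStandardMoments (ν i)]
    (C : Finset (Fin n) → EuclideanSpace ℝ (Fin k)) :
    ∫ x, ‖vpoly C x‖ ^ 2 ∂(Measure.pi ν) = ∑ S, ‖C S‖ ^ 2 := by
  simp_rw [norm_sq_vpoly]
  rw [integral_finsetSum _ fun j _ => integrable_mpoly_pow ν _ (by norm_num)]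
  simp_rw [integral_mpoly_sq, EuclideanSpace.norm_sq_eq, Real.norm_eq_abs, sq_abs]
  exact Finset.sum_comm

variable {ρ : ℝ}

theorem integral_prod_mix (T : Finset (Fin n)) (x : Fin n → ℝ) :
    ∫ z, ∏ i ∈ T, mix ρ (x, z) i ∂(gaussianPi n) = ρ ^ T.card * ∏ i ∈ T, x i := by
  have h : ∀ z : Fin n → ℝ, ∏ i ∈ T, mix ρ (x, z) i =
      ∏ i, (if i ∈ T then ρ * x i + √(1 - ρ ^ 2) * z i else 1) := by
    intro z
    rw [Fintype.prod_ite_mem]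
    rfl
  simp_rw [h]
  rw [integral_fintype_prod_eq_prod
    (fun i (t : ℝ) => if i ∈ T then ρ * x i + √(1 - ρ ^ 2) * t else 1)]
  have h2 : ∀ i, ∫ t, (if i ∈ T then ρ * x i + √(1 - ρ ^ 2) * t else 1) ∂(gaussianReal 0 1) =
      if i ∈ T then ρ * x i else 1 := by
    intro i
    split_ifs
    · have hi : Integrable (fun t : ℝ => t) (gaussianReal 0 1) := by
        simpa using HasStandardMoments.integrable_pow (gaussianReal 0 1) (j := 1) (by norm_num)
      rw [integral_add (integrable_const _) (hi.const_mul _), integral_const_mul (√(1 - ρ ^ 2)),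
        integral_id_gaussianReal]
      simp
    · simp
  simp_rw [h2]
  rw [Fintype.prod_ite_mem, Finset.prod_mul_distrib, Finset.prod_const]

theorem integral_prod_mul_prod_mix (h : ρ ^ 2 ≤ 1) (S T : Finset (Fin n)) :
    Integrable (fun p : (Fin n → ℝ) × (Fin n → ℝ) => (∏ i ∈ S, p.1 i) * ∏ i ∈ T, mix ρ p i)
      ((gaussianPi n).prod (gaussianPi n)) ∧
    ∫ p, (∏ i ∈ S, p.1 i) * ∏ i ∈ T, mix ρ p i ∂((gaussianPi n).prod (gaussianPi n)) =
      if S = T then ρ ^ S.card else 0 := by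
  have hsq : ∀ S : Finset (Fin n), Integrable (fun x : Fin n → ℝ => (∏ i ∈ S, x i) ^ 2)
      (gaussianPi n) := fun S =>
    Integrable.pow_of_pow_four (by fun_prop) (integrable_prod_pow_four _ S) (by norm_num)
  have hmix : ∀ i : Fin n, Measurable fun p : (Fin n → ℝ) × (Fin n → ℝ) => mix ρ p i :=
    fun i => (measurable_pi_apply i).comp (measurable_mix ρ)
  have hint : Integrable (fun p : (Fin n → ℝ) × (Fin n → ℝ) =>
      (∏ i ∈ S, p.1 i) * ∏ i ∈ T, mix ρ p i) ((gaussianPi n).prod (gaussianPi n)) := by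
    refine integrable_mul_of_sq (by fun_prop) (by fun_prop) ?_ ?_
    · exact measurePreserving_fst.integrable_comp_of_integrable (hsq S)
    · exact (measurePreserving_mix h).integrable_comp_of_integrable (hsq T)
  refine ⟨hint, ?_⟩
  rw [integral_prod _ hint]
  simp_rw [integral_const_mul, integral_prod_mix]
  have : ∀ x : Fin n → ℝ, (∏ i ∈ S, x i) * (ρ ^ T.card * ∏ i ∈ T, x i) =
      ρ ^ T.card * ((∏ i ∈ S, x i) * ∏ i ∈ T, x i) := fun x => by ring
  simp_rw [this]
  rw [integral_const_mul, integral_prod_mul_prod]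
  split_ifs with hST
  · simp [hST]
  · simp

/-- The Gaussian counterpart of `boolStab_eq_sum`: the noisy copy of a monomial has conditional mean
`ρ^|S|` times the monomial, in either setting. This lets the two stabilities be compared coefficient
by coefficient. -/
theorem stabPi_vpoly (h : ρ ^ 2 ≤ 1) (C : Finset (Fin n) → EuclideanSpace ℝ (Fin k)) :
    stabPi ρ (vpoly C) = ∑ S, ρ ^ S.card * ‖C S‖ ^ 2 := by
  have he : ∀ p : (Fin n → ℝ) × (Fin n → ℝ), ⟪vpoly C p.1, vpoly C (mix ρ p)⟫ =
      ∑ S, ∑ T, ⟪C S, C T⟫ * ((∏ i ∈ S, p.1 i) * ∏ i ∈ T, mix ρ p i) := by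
    intro p
    simp only [vpoly, sum_inner, inner_sum, real_inner_smul_left, real_inner_smul_right]
    rw [Finset.sum_comm]
    refine Finset.sum_congr rfl fun S _ => Finset.sum_congr rfl fun T _ => ?_
    ring
  rw [stabPi]
  simp_rw [he]
  rw [integral_finsetSum _ fun S _ => integrable_finsetSum _ fun T _ =>
    (integral_prod_mul_prod_mix h S T).1.const_mul _]
  refine Finset.sum_congr rfl fun S _ => ?_
  rw [integral_finsetSum _ fun T _ => (integral_prod_mul_prod_mix h S T).1.const_mul _]
  simp_rw [integral_const_mul, (integral_prod_mul_prod_mix h S _).2]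
  simp [mul_comm]

/-! ### Continuity of the noise stability in `L¹` and in `L²`. -/

variable {f h : (Fin n → ℝ) → EuclideanSpace ℝ (Fin k)}

theorem integrable_inner_of_norm_le_one {Ω : Type*} [MeasurableSpace Ω] {μ : Measure Ω}
    [IsFiniteMeasure μ] {F G : Ω → EuclideanSpace ℝ (Fin k)} (hF : Measurable F)
    (hG : Measurable G) (hF1 : ∀ x, ‖F x‖ ≤ 1) (hG1 : ∀ x, ‖G x‖ ≤ 1) :
    Integrable (fun x => ⟪F x, G x⟫) μ := by
  refine (integrable_const (1 : ℝ)).mono' (by fun_prop) (Filter.Eventually.of_forall fun x => ?_)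
  exact (norm_inner_le_norm _ _).trans (mul_le_one₀ (hF1 x) (norm_nonneg _) (hG1 x))

theorem abs_stabPi_sub_le_of_norm_le_one (hρ : ρ ^ 2 ≤ 1) (hf : Measurable f) (hh : Measurable h)
    (hf1 : ∀ x, ‖f x‖ ≤ 1) (hh1 : ∀ x, ‖h x‖ ≤ 1) :
    |stabPi ρ f - stabPi ρ h| ≤ 2 * ∫ x, ‖f x - h x‖ ∂(gaussianPi n) := by
  have hi : Integrable (fun x => ‖f x - h x‖) (gaussianPi n) := by
    refine (integrable_const (2 : ℝ)).mono' (by fun_prop) (Filter.Eventually.of_forall fun x => ?_)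
    rw [norm_norm]
    exact (norm_sub_le _ _).trans (by linarith [hf1 x, hh1 x])
  have hmf : Measurable fun p : (Fin n → ℝ) × (Fin n → ℝ) => f (mix ρ p) :=
    hf.comp (measurable_mix ρ)
  have hmh : Measurable fun p : (Fin n → ℝ) × (Fin n → ℝ) => h (mix ρ p) :=
    hh.comp (measurable_mix ρ)
  have hi1 := (measurePreserving_fst (μ := gaussianPi n)
    (ν := gaussianPi n)).integrable_comp_of_integrable hi
  have hi2 := (measurePreserving_mix (n := n) hρ).integrable_comp_of_integrable hi
  have e1 := integral_comp_measurePreserving (measurePreserving_fst (μ := gaussianPi n)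
    (ν := gaussianPi n)) hi.aestronglyMeasurable
  have e2 := integral_comp_measurePreserving (measurePreserving_mix (n := n) hρ)
    hi.aestronglyMeasurable
  simp only [Function.comp_def] at hi1 hi2
  rw [stabPi, stabPi, ← integral_sub, ← Real.norm_eq_abs]
  · calc _ ≤ ∫ p, (‖f p.1 - h p.1‖ + ‖f (mix ρ p) - h (mix ρ p)‖)
          ∂((gaussianPi n).prod (gaussianPi n)) := by
          refine norm_integral_le_of_norm_le (hi1.add hi2) (Filter.Eventually.of_forall fun p => ?_)
          have e : ⟪f p.1, f (mix ρ p)⟫ - ⟪h p.1, h (mix ρ p)⟫ =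
              ⟪f p.1 - h p.1, f (mix ρ p)⟫ + ⟪h p.1, f (mix ρ p) - h (mix ρ p)⟫ := by
            rw [inner_sub_left, inner_sub_right]; ring
          rw [e]
          refine (norm_add_le _ _).trans (add_le_add ?_ ?_)
          · exact (norm_inner_le_norm _ _).trans
              (mul_le_of_le_one_right (norm_nonneg _) (hf1 _))
          · exact (norm_inner_le_norm _ _).trans
              (mul_le_of_le_one_left (norm_nonneg _) (hh1 _))
      _ = _ := by
          rw [integral_add hi1 hi2]
          rw [e1, e2]
          ring
  · exact integrable_inner_of_norm_le_one (by fun_prop) (by fun_prop) (fun _ => hf1 _)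
      (fun _ => hf1 _)
  · exact integrable_inner_of_norm_le_one (by fun_prop) (by fun_prop) (fun _ => hh1 _)
      (fun _ => hh1 _)

/-- Polynomials are unbounded, so only the second moment of `f` is available. Each of the two terms
of the telescoped difference is split by `ab ≤ a² / (2θ) + θ b² / 2` and contributes at most `θ`;
the marginals of the correlated pair are both standard Gaussian. -/
theorem abs_stabPi_sub_le_of_norm_sq (hρ : ρ ^ 2 ≤ 1) (hf : Measurable f) (hh : Measurable h)
    (hh1 : ∀ x, ‖h x‖ ≤ 1) (hf2 : Integrable (fun x => ‖f x‖ ^ 2) (gaussianPi n))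
    (hf2' : ∫ x, ‖f x‖ ^ 2 ∂(gaussianPi n) ≤ 1) {θ : ℝ} (hθ : 0 < θ)
    (hfh : ∫ x, ‖f x - h x‖ ^ 2 ∂(gaussianPi n) ≤ θ ^ 2) :
    |stabPi ρ f - stabPi ρ h| ≤ 2 * θ := by
  have hi : Integrable (fun x => ‖f x - h x‖ ^ 2) (gaussianPi n) := by
    refine ((hf2.const_mul 2).add (integrable_const (2 : ℝ))).mono' (by fun_prop)
      (Filter.Eventually.of_forall fun x => ?_)
    rw [Real.norm_eq_abs, abs_of_nonneg (by positivity), Pi.add_apply]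
    have h1 := norm_sub_le (f x) (h x)
    have h2 := hh1 x
    nlinarith [norm_nonneg (f x - h x), norm_nonneg (f x), norm_nonneg (h x),
      sq_nonneg (‖f x‖ - ‖h x‖)]
  have hmf : Measurable fun p : (Fin n → ℝ) × (Fin n → ℝ) => f (mix ρ p) :=
    hf.comp (measurable_mix ρ)
  have hmh : Measurable fun p : (Fin n → ℝ) × (Fin n → ℝ) => h (mix ρ p) :=
    hh.comp (measurable_mix ρ)
  have hfst := measurePreserving_fst (μ := gaussianPi n) (ν := gaussianPi n)
  have hmix := measurePreserving_mix (n := n) hρ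
  have hi1 := hfst.integrable_comp_of_integrable hi
  have hi2 := hmix.integrable_comp_of_integrable hi
  have hj1 := hfst.integrable_comp_of_integrable hf2
  have hj2 := hmix.integrable_comp_of_integrable hf2
  have e1 := integral_comp_measurePreserving hfst hi.aestronglyMeasurable
  have e2 := integral_comp_measurePreserving hmix hi.aestronglyMeasurable
  have e3 := integral_comp_measurePreserving hmix hf2.aestronglyMeasurable
  simp only [Function.comp_def] at hi1 hi2 hj1 hj2
  have hff : Integrable (fun p : (Fin n → ℝ) × (Fin n → ℝ) => ⟪f p.1, f (mix ρ p)⟫)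
      ((gaussianPi n).prod (gaussianPi n)) := by
    refine (hj1.add hj2).mono' (by fun_prop) (Filter.Eventually.of_forall fun p => ?_)
    refine (norm_inner_le_norm _ _).trans ?_
    rw [Pi.add_apply]
    nlinarith [norm_nonneg (f p.1), norm_nonneg (f (mix ρ p)),
      sq_nonneg (‖f p.1‖ - ‖f (mix ρ p)‖)]
  have hamgm : ∀ a b : ℝ, a * b ≤ 1 / (2 * θ) * a ^ 2 + θ / 2 * b ^ 2 := by
    intro a b
    have e : 1 / (2 * θ) * a ^ 2 + θ / 2 * b ^ 2 - a * b = (a - θ * b) ^ 2 / (2 * θ) := by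
      field_simp
      ring
    have : 0 ≤ (a - θ * b) ^ 2 / (2 * θ) := by positivity
    linarith
  rw [stabPi, stabPi, ← integral_sub hff, ← Real.norm_eq_abs]
  · have k1 := hi1.const_mul (1 / (2 * θ))
    have k2 := hj2.const_mul (θ / 2)
    have k3 := hi2.const_mul (1 / (2 * θ))
    have k4 : Integrable (fun _ => θ / 2) ((gaussianPi n).prod (gaussianPi n)) :=
      integrable_const _
    calc _ ≤ ∫ p, ((1 / (2 * θ) * ‖f p.1 - h p.1‖ ^ 2 + θ / 2 * ‖f (mix ρ p)‖ ^ 2) +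
          (1 / (2 * θ) * ‖f (mix ρ p) - h (mix ρ p)‖ ^ 2 + θ / 2))
          ∂((gaussianPi n).prod (gaussianPi n)) := by
          refine norm_integral_le_of_norm_le ((k1.add k2).add (k3.add k4))
            (Filter.Eventually.of_forall fun p => ?_)
          have e : ⟪f p.1, f (mix ρ p)⟫ - ⟪h p.1, h (mix ρ p)⟫ =
              ⟪f p.1 - h p.1, f (mix ρ p)⟫ + ⟪h p.1, f (mix ρ p) - h (mix ρ p)⟫ := by
            rw [inner_sub_left, inner_sub_right]; ring
          rw [e]
          refine (norm_add_le _ _).trans (add_le_add ?_ ?_)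
          · exact (norm_inner_le_norm _ _).trans (hamgm _ _)
          · refine (norm_inner_le_norm _ _).trans
              ((mul_le_of_le_one_left (norm_nonneg _) (hh1 _)).trans ?_)
            simpa using hamgm ‖f (mix ρ p) - h (mix ρ p)‖ 1
      _ = 1 / (2 * θ) * ∫ x, ‖f x - h x‖ ^ 2 ∂(gaussianPi n) +
          θ / 2 * ∫ x, ‖f x‖ ^ 2 ∂(gaussianPi n) +
          (1 / (2 * θ) * ∫ x, ‖f x - h x‖ ^ 2 ∂(gaussianPi n) + θ / 2) := by
          rw [integral_add (k1.fun_add k2) (k3.fun_add k4), integral_add k1 k2, integral_add k3 k4]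
          simp only [integral_const_mul, e1, e2, e3, integral_const]
          simp
      _ ≤ 1 / (2 * θ) * θ ^ 2 + θ / 2 * 1 + (1 / (2 * θ) * θ ^ 2 + θ / 2) := by gcongr
      _ = 2 * θ := by field_simp; ring
  · exact integrable_inner_of_norm_le_one (by fun_prop) (by fun_prop) (fun _ => hh1 _)
      (fun _ => hh1 _)

end Stability

/-! ### A rapidly alternating sign -/

/-- The sign `(-1)^⌊u / c⌋`. -/
def altSign (c u : ℝ) : ℝ := (-1) ^ ⌊u / c⌋

@[fun_prop]
theorem measurable_altSign (c : ℝ) : Measurable (altSign c) := by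
  have : Measurable fun j : ℤ => (-1 : ℝ) ^ j := measurable_from_top
  exact this.comp (Int.measurable_floor.comp (by fun_prop))

theorem altSign_eq (c u : ℝ) : altSign c u = 1 ∨ altSign c u = -1 := by
  rcases Int.even_or_odd ⌊u / c⌋ with h | h
  · left; exact h.neg_one_zpow
  · right; exact h.neg_one_zpow

theorem abs_altSign (c u : ℝ) : |altSign c u| = 1 := by
  rcases altSign_eq c u with h | h <;> simp [h]

theorem altSign_add {c : ℝ} (hc : c ≠ 0) (u : ℝ) : altSign c (u + c) = -altSign c u := by
  rw [altSign, altSign, add_div, div_self hc, Int.floor_add_one, zpow_add_one₀ (by norm_num)]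
  ring

/-- The Cameron–Martin formula in dimension one. -/
theorem integral_gaussianReal_add (F : ℝ → ℝ) (c : ℝ) :
    ∫ z, F (z + c) ∂(gaussianReal 0 1) =
      ∫ z, F z * Real.exp (z * c - c ^ 2 / 2) ∂(gaussianReal 0 1) := by
  rw [integral_gaussianReal_eq_integral_smul one_ne_zero,
    integral_gaussianReal_eq_integral_smul one_ne_zero,
    ← integral_sub_right_eq_self (fun z => gaussianPDFReal 0 1 z • F (z + c)) c]
  congr 1
  ext z
  simp only [gaussianPDFReal, smul_eq_mul, sub_add_cancel]
  rw [mul_comm (F z), ← mul_assoc, mul_assoc _ (Real.exp _) (Real.exp _), ← Real.exp_add]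
  congr 3
  push_cast
  ring

/-- Shifting `z` by `r = c / σ` flips the sign but only multiplies the Gaussian density by `w`.
Hence `2 E s = E [s (1 - w)]`, and `E (1 - w)² = e^(r²) - 1` is small when the period is small
compared with `σ`, whatever the centre `a`. -/
theorem abs_integral_altSign_le {c σ τ : ℝ} (hc : 0 < c) (hσ : 0 < σ) (hτ : 0 < τ)
    (h : Real.exp ((c / σ) ^ 2) - 1 ≤ τ ^ 2) (a : ℝ) :
    |∫ z, altSign c (a + σ * z) ∂(gaussianReal 0 1)| ≤ τ := by
  set r := c / σ with hr
  set w : ℝ → ℝ := fun z => Real.exp (z * r - r ^ 2 / 2) with hw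
  have hw1 : ∀ z, w z = Real.exp (-(r ^ 2 / 2)) * Real.exp (r * z) := by
    intro z
    change Real.exp _ = _
    rw [← Real.exp_add]
    congr 1
    ring
  have hw2 : ∀ z, w z ^ 2 = Real.exp (-r ^ 2) * Real.exp ((2 * r) * z) := by
    intro z
    rw [hw, ← Real.exp_add, ← Real.exp_nat_mul]
    congr 1
    push_cast
    ring
  have iw : Integrable w (gaussianReal 0 1) := by
    rw [funext hw1]
    exact (integrable_exp_mul_gaussianReal r).const_mul _
  have iw2 : Integrable (fun z => w z ^ 2) (gaussianReal 0 1) := by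
    simp_rw [hw2]
    exact (integrable_exp_mul_gaussianReal (2 * r)).const_mul _
  have ew : ∫ z, w z ∂(gaussianReal 0 1) = 1 := by
    simp_rw [hw1]
    rw [integral_const_mul, integral_exp_mul_gaussianReal, ← Real.exp_add]
    simp
  have ew2 : ∫ z, w z ^ 2 ∂(gaussianReal 0 1) = Real.exp (r ^ 2) := by
    simp_rw [hw2]
    rw [integral_const_mul, integral_exp_mul_gaussianReal, ← Real.exp_add]
    congr 1
    ring
  have hm : Measurable fun z => altSign c (a + σ * z) := by fun_prop
  have iS : Integrable (fun z => altSign c (a + σ * z)) (gaussianReal 0 1) :=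
    (integrable_const (1 : ℝ)).mono' hm.aestronglyMeasurable
      (Filter.Eventually.of_forall fun z => by rw [Real.norm_eq_abs, abs_altSign])
  have iSw : Integrable (fun z => altSign c (a + σ * z) * w z) (gaussianReal 0 1) := by
    refine iw.mono' (hm.aestronglyMeasurable.mul iw.aestronglyMeasurable)
      (Filter.Eventually.of_forall fun z => ?_)
    rw [norm_mul, Real.norm_eq_abs, abs_altSign, one_mul, Real.norm_eq_abs,
      abs_of_pos (Real.exp_pos _)]
  have hshift := integral_gaussianReal_add (fun z => altSign c (a + σ * z)) r
  have hneg : ∀ z, altSign c (a + σ * (z + r)) = -altSign c (a + σ * z) := by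
    intro z
    rw [← altSign_add hc.ne']
    congr 1
    rw [hr]
    field_simp
    ring
  simp_rw [hneg] at hshift
  rw [integral_neg] at hshift
  have h2 : 2 * ∫ z, altSign c (a + σ * z) ∂(gaussianReal 0 1) =
      ∫ z, altSign c (a + σ * z) * (1 - w z) ∂(gaussianReal 0 1) := by
    have : ∀ z, altSign c (a + σ * z) * (1 - w z) =
      altSign c (a + σ * z) - altSign c (a + σ * z) * w z := fun z => by ring
    simp_rw [this]
    rw [integral_sub iS iSw]
    linarith
  have hb : ∀ u : ℝ, |1 - u| ≤ τ / 2 + 1 / (2 * τ) * (1 + u ^ 2 - 2 * u) := by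
    intro u
    have e : τ / 2 + 1 / (2 * τ) * (1 + u ^ 2 - 2 * u) - |1 - u| =
        (τ - |1 - u|) ^ 2 / (2 * τ) := by
      rw [show 1 + u ^ 2 - 2 * u = |1 - u| ^ 2 by rw [sq_abs]; ring]
      field_simp
      ring
    have : 0 ≤ (τ - |1 - u|) ^ 2 / (2 * τ) := by positivity
    linarith
  have i1 : Integrable (fun z => 1 + w z ^ 2 - 2 * w z) (gaussianReal 0 1) :=
    ((integrable_const _).add iw2).sub (iw.const_mul 2)
  have e1 : ∫ z, (1 + w z ^ 2 - 2 * w z) ∂(gaussianReal 0 1) = Real.exp (r ^ 2) - 1 := by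
    rw [integral_sub ((integrable_const _).fun_add iw2) (iw.const_mul 2),
      integral_add (integrable_const _) iw2, integral_const_mul, ew, ew2]
    simp
    ring
  have h3 : |2 * ∫ z, altSign c (a + σ * z) ∂(gaussianReal 0 1)| ≤ τ := by
    rw [h2, ← Real.norm_eq_abs]
    calc _ ≤ ∫ z, (τ / 2 + 1 / (2 * τ) * (1 + w z ^ 2 - 2 * w z)) ∂(gaussianReal 0 1) := by
          refine norm_integral_le_of_norm_le ((integrable_const _).add (i1.const_mul _))
            (Filter.Eventually.of_forall fun z => ?_)
          rw [norm_mul, Real.norm_eq_abs, abs_altSign, one_mul]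
          exact hb _
      _ = τ / 2 + 1 / (2 * τ) * (Real.exp (r ^ 2) - 1) := by
          rw [integral_add (integrable_const _) (i1.const_mul _), integral_const_mul, e1]
          simp
      _ ≤ τ / 2 + 1 / (2 * τ) * τ ^ 2 := by gcongr
      _ = τ := by field_simp; ring
  rw [abs_mul, abs_of_pos (by norm_num : (0 : ℝ) < 2)] at h3
  linarith [abs_nonneg (∫ z, altSign c (a + σ * z) ∂(gaussianReal 0 1))]

/-- A measurable sign which is nearly balanced under `N(a, σ²)` for all `a`, and under `N(0, 1)`. -/
theorem exists_balanced_sign {σ τ : ℝ} (hσ : 0 < σ) (hσ1 : σ ≤ 1) (hτ : 0 < τ) :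
    ∃ s : ℝ → ℝ, Measurable s ∧ (∀ u, s u = 1 ∨ s u = -1) ∧
      (∀ a, |∫ z, s (a + σ * z) ∂(gaussianReal 0 1)| ≤ τ) ∧
      |∫ z, s z ∂(gaussianReal 0 1)| ≤ τ := by
  have hlim : Filter.Tendsto (fun c : ℝ => Real.exp ((c / σ) ^ 2) - 1) (nhds 0) (nhds 0) := by
    have : Continuous fun c : ℝ => Real.exp ((c / σ) ^ 2) - 1 := by fun_prop
    simpa using this.tendsto 0
  have hev : ∀ᶠ c in nhdsWithin (0 : ℝ) (Set.Ioi 0), Real.exp ((c / σ) ^ 2) - 1 < τ ^ 2 :=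
    (hlim.mono_left nhdsWithin_le_nhds).eventually_lt_const (by positivity)
  obtain ⟨c, hc, hc0⟩ := (hev.and self_mem_nhdsWithin).exists
  have hc0 : 0 < c := hc0
  refine ⟨altSign c, measurable_altSign c, altSign_eq c,
    fun a => abs_integral_altSign_le hc0 hσ hτ hc.le a, ?_⟩
  -- Since `σ ≤ 1`, the period chosen for standard deviation `σ` serves for standard deviation 1 as
  -- well.
  have h1 : Real.exp ((c / 1) ^ 2) - 1 ≤ τ ^ 2 := by
    refine le_trans ?_ hc.le
    gcongr
  simpa using abs_integral_altSign_le hc0 one_pos hτ h1 0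

/-! ### Adding a Gaussian coordinate -/

theorem measurePreserving_finTail (n : ℕ) :
    MeasurePreserving (fun y : Fin (n + 1) → ℝ => (y 0, Fin.tail y)) (gaussianPi (n + 1))
      ((gaussianReal 0 1).prod (gaussianPi n)) := by
  have h := measurePreserving_piFinSuccAbove (fun _ : Fin (n + 1) => gaussianReal 0 1) 0
  have e : (fun y : Fin (n + 1) → ℝ => (y 0, Fin.tail y)) =
      MeasurableEquiv.piFinSuccAbove (fun _ : Fin (n + 1) => ℝ) 0 := by
    ext1 y
    rfl
  rw [e]
  exact h

theorem measurePreserving_finTail_pair (n : ℕ) :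
    MeasurePreserving (fun p : (Fin (n + 1) → ℝ) × (Fin (n + 1) → ℝ) =>
        ((p.1 0, p.2 0), (Fin.tail p.1, Fin.tail p.2)))
      ((gaussianPi (n + 1)).prod (gaussianPi (n + 1)))
      (((gaussianReal 0 1).prod (gaussianReal 0 1)).prod ((gaussianPi n).prod (gaussianPi n))) := by
  have h1 := (measurePreserving_arrowProdEquivProdArrow ℝ ℝ (Fin (n + 1))
    (fun _ => gaussianReal 0 1) (fun _ => gaussianReal 0 1)).symm
  have h2 := measurePreserving_piFinSuccAbove
    (fun _ : Fin (n + 1) => (gaussianReal 0 1).prod (gaussianReal 0 1)) 0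
  have h3 := (MeasurePreserving.id ((gaussianReal 0 1).prod (gaussianReal 0 1))).prod
    (measurePreserving_arrowProdEquivProdArrow ℝ ℝ (Fin n)
      (fun _ => gaussianReal 0 1) (fun _ => gaussianReal 0 1))
  exact h3.comp (h2.comp h1)

theorem tail_mix {n : ℕ} (ρ : ℝ) (p : (Fin (n + 1) → ℝ) × (Fin (n + 1) → ℝ)) :
    Fin.tail (mix ρ p) = mix ρ (Fin.tail p.1, Fin.tail p.2) := rfl

section Extension

variable {n k : ℕ} {ρ : ℝ}

@[fun_prop]
theorem measurable_finTail : Measurable (fun y : Fin (n + 1) → ℝ => (Fin.tail y : Fin n → ℝ)) :=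
  measurable_pi_lambda _ fun i => measurable_pi_apply i.succ

theorem abs_integral_inner_le_one {Ω : Type*} [MeasurableSpace Ω] {μ : Measure Ω}
    [IsProbabilityMeasure μ] {F G : Ω → EuclideanSpace ℝ (Fin k)} (hF1 : ∀ x, ‖F x‖ ≤ 1)
    (hG1 : ∀ x, ‖G x‖ ≤ 1) : |∫ x, ⟪F x, G x⟫ ∂μ| ≤ 1 := by
  have := norm_integral_le_of_norm_le_const (μ := μ) (f := fun x => (⟪F x, G x⟫ : ℝ)) (C := 1)
    (Filter.Eventually.of_forall fun x =>
      (norm_inner_le_norm _ _).trans (mul_le_one₀ (hF1 x) (norm_nonneg _) (hG1 x)))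
  simpa using this

/-- Splitting a ball-valued function along an additional random sign. -/
theorem stabPi_add_sign_le {τ : ℝ} {s : ℝ → ℝ} (hs : Measurable s)
    (hs1 : ∀ u, s u = 1 ∨ s u = -1)
    (hsσ : ∀ a, |∫ z, s (a + √(1 - ρ ^ 2) * z) ∂(gaussianReal 0 1)| ≤ τ)
    (hs0 : |∫ z, s z ∂(gaussianReal 0 1)| ≤ τ)
    {h d : (Fin n → ℝ) → EuclideanSpace ℝ (Fin k)} (hh : Measurable h) (hd : Measurable d)
    (hh1 : ∀ x, ‖h x‖ ≤ 1) (hd1 : ∀ x, ‖d x‖ ≤ 1) :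
    stabPi ρ (fun y : Fin (n + 1) → ℝ => h (Fin.tail y) + s (y 0) • d (Fin.tail y)) ≤
      stabPi ρ h + 3 * τ := by
  set γ := (gaussianReal 0 1).prod (gaussianReal 0 1) with hγ
  set Γ := (gaussianPi n).prod (gaussianPi n) with hΓ
  let m1 : ℝ × ℝ → ℝ := fun q => ρ * q.1 + √(1 - ρ ^ 2) * q.2
  have hm1 : Measurable m1 := by fun_prop
  have hsa : ∀ u, |s u| = 1 := fun u => by rcases hs1 u with h | h <;> simp [h]
  have hhm : Measurable fun p => h (mix ρ p) := hh.comp (measurable_mix ρ)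
  have hdm : Measurable fun p => d (mix ρ p) := hd.comp (measurable_mix ρ)
  have hsm : Measurable fun p => s (m1 p) := hs.comp hm1
  have is : ∀ {f : ℝ × ℝ → ℝ}, Measurable f → (∀ q, |f q| = 1) → Integrable f γ := by
    intro f hf hf1
    exact (integrable_const (1 : ℝ)).mono' hf.aestronglyMeasurable
      (Filter.Eventually.of_forall fun z => by rw [Real.norm_eq_abs, hf1])
  have I1 : Integrable (fun p => ⟪h p.1, h (mix ρ p)⟫) Γ :=
    integrable_inner_of_norm_le_one (by fun_prop) hhm (fun _ => hh1 _) (fun _ => hh1 _)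
  have I2 : Integrable (fun p => ⟪h p.1, d (mix ρ p)⟫) Γ :=
    integrable_inner_of_norm_le_one (by fun_prop) hdm (fun _ => hh1 _) (fun _ => hd1 _)
  have I3 : Integrable (fun p => ⟪d p.1, h (mix ρ p)⟫) Γ :=
    integrable_inner_of_norm_le_one (by fun_prop) hhm (fun _ => hd1 _) (fun _ => hh1 _)
  have I4 : Integrable (fun p => ⟪d p.1, d (mix ρ p)⟫) Γ :=
    integrable_inner_of_norm_le_one (by fun_prop) hdm (fun _ => hd1 _) (fun _ => hd1 _)
  have J1 : Integrable (fun _ : ℝ × ℝ => (1 : ℝ)) γ := integrable_const _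
  have J2 : Integrable (fun q => s (m1 q)) γ := is hsm fun _ => hsa _
  have J3 : Integrable (fun q => s q.1) γ := is (by fun_prop) fun _ => hsa _
  have J4 : Integrable (fun q => s q.1 * s (m1 q)) γ :=
    is (by fun_prop) fun _ => by rw [abs_mul, hsa, hsa, one_mul]
  have K1 := J1.mul_prod I1
  have K2 := J2.mul_prod I2
  have K3 := J3.mul_prod I3
  have K4 := J4.mul_prod I4
  have bound : ∀ {A B : ℝ}, |A| ≤ τ → |B| ≤ 1 → A * B ≤ τ := by
    intro A B hA hB
    calc A * B ≤ |A| * |B| := by rw [← abs_mul]; exact le_abs_self _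
      _ ≤ τ * 1 := mul_le_mul hA hB (abs_nonneg _) ((abs_nonneg _).trans hA)
      _ = τ := mul_one _
  -- Given the first coordinate `t`, the noisy one is `ρ t + √(1 - ρ²) z`. Balance around every
  -- centre thus makes its sign nearly balanced even conditionally, which bounds both its mean and
  -- its correlation with `s t`.
  have hinner : ∀ t : ℝ, ‖∫ z, s (m1 (t, z)) ∂(gaussianReal 0 1)‖ ≤ τ := fun t => hsσ (ρ * t)
  have E2 : |∫ q, s (m1 q) ∂γ| ≤ τ := by
    rw [hγ, integral_prod _ J2]
    have := norm_integral_le_of_norm_le_const (μ := gaussianReal 0 1)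
      (Filter.Eventually.of_forall hinner)
    simpa using this
  have E3 : |∫ q, s q.1 ∂γ| ≤ τ := by
    have : ∫ q, s q.1 ∂γ = ∫ z, s z ∂(gaussianReal 0 1) := by
      rw [hγ, integral_fun_fst]
      simp
    rw [this]
    exact hs0
  have E4 : |∫ q, s q.1 * s (m1 q) ∂γ| ≤ τ := by
    rw [hγ, integral_prod _ J4]
    have : ∀ t : ℝ, ‖∫ z, s t * s (m1 (t, z)) ∂(gaussianReal 0 1)‖ ≤ τ := by
      intro t
      rw [integral_const_mul, norm_mul, Real.norm_eq_abs, hsa, one_mul]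
      exact hinner t
    have := norm_integral_le_of_norm_le_const (μ := gaussianReal 0 1)
      (Filter.Eventually.of_forall this)
    simpa using this
  have hsplit : stabPi ρ (fun y : Fin (n + 1) → ℝ => h (Fin.tail y) + s (y 0) • d (Fin.tail y)) =
      ∫ q : (ℝ × ℝ) × ((Fin n → ℝ) × (Fin n → ℝ)), ((1 * ⟪h q.2.1, h (mix ρ q.2)⟫ +
        s (m1 q.1) * ⟪h q.2.1, d (mix ρ q.2)⟫) + (s q.1.1 * ⟪d q.2.1, h (mix ρ q.2)⟫ +
        (s q.1.1 * s (m1 q.1)) * ⟪d q.2.1, d (mix ρ q.2)⟫)) ∂(γ.prod Γ) := by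
    rw [stabPi, ← integral_comp_measurePreserving (measurePreserving_finTail_pair n)
      ((K1.fun_add K2).fun_add (K3.fun_add K4)).aestronglyMeasurable]
    congr 1
    ext p
    simp only [tail_mix, inner_add_left, inner_add_right, real_inner_smul_left,
      real_inner_smul_right, m1]
    have : mix ρ p 0 = ρ * p.1 0 + √(1 - ρ ^ 2) * p.2 0 := rfl
    rw [this]
    ring
  rw [hsplit, integral_add (K1.fun_add K2) (K3.fun_add K4), integral_add K1 K2, integral_add K3 K4,
    integral_prod_mul (fun _ => (1 : ℝ)) (fun p => (⟪h p.1, h (mix ρ p)⟫ : ℝ)),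
    integral_prod_mul (fun q => s (m1 q)) (fun p => (⟪h p.1, d (mix ρ p)⟫ : ℝ)),
    integral_prod_mul (fun q : ℝ × ℝ => s q.1) (fun p => (⟪d p.1, h (mix ρ p)⟫ : ℝ)),
    integral_prod_mul (fun q => s q.1 * s (m1 q)) (fun p => (⟪d p.1, d (mix ρ p)⟫ : ℝ))]
  have b2 := bound E2 (abs_integral_inner_le_one (μ := Γ) (F := fun p => h p.1)
    (G := fun p => d (mix ρ p)) (fun _ => hh1 _) (fun _ => hd1 _))
  have b3 := bound E3 (abs_integral_inner_le_one (μ := Γ) (F := fun p => d p.1)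
    (G := fun p => h (mix ρ p)) (fun _ => hd1 _) (fun _ => hh1 _))
  have b4 := bound E4 (abs_integral_inner_le_one (μ := Γ) (F := fun p => d p.1)
    (G := fun p => d (mix ρ p)) (fun _ => hd1 _) (fun _ => hd1 _))
  have e1 : ∫ _, (1 : ℝ) ∂γ = 1 := by simp
  rw [e1, one_mul, stabPi]
  linarith

end Extension

/-! ### From sphere-valued to ball-valued functions -/

section Rounding

variable {n k : ℕ} {ρ : ℝ}

/-- A vector `v` of the ball is the midpoint of a unit vector `v + d` and a vector `v - d` of the
ball, with `d = 0` if `v` is a unit vector. -/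
def roundingStep (e v : EuclideanSpace ℝ (Fin k)) : EuclideanSpace ℝ (Fin k) :=
  if v = 0 then e else NormedSpace.normalize v - v

theorem measurable_normalize : Measurable
    (NormedSpace.normalize : EuclideanSpace ℝ (Fin k) → EuclideanSpace ℝ (Fin k)) := by
  unfold NormedSpace.normalize
  fun_prop

theorem measurable_roundingStep (e : EuclideanSpace ℝ (Fin k)) : Measurable (roundingStep e) :=
  Measurable.ite (measurableSet_singleton 0) measurable_const (measurable_normalize.sub measurable_id)

theorem norm_add_roundingStep {e : EuclideanSpace ℝ (Fin k)} (he : ‖e‖ = 1)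
    (v : EuclideanSpace ℝ (Fin k)) : ‖v + roundingStep e v‖ = 1 := by
  by_cases h : v = 0
  · simp [roundingStep, h, he]
  · simp [roundingStep, h, NormedSpace.norm_normalize_eq_one_iff]

theorem norm_sub_roundingStep {e : EuclideanSpace ℝ (Fin k)} (he : ‖e‖ = 1)
    {v : EuclideanSpace ℝ (Fin k)} (hv : ‖v‖ ≤ 1) : ‖v - roundingStep e v‖ ≤ 1 := by
  by_cases h : v = 0
  · simp [roundingStep, h, he]
  · have h1 : ‖NormedSpace.normalize v‖ = 1 := NormedSpace.norm_normalize_eq_one_iff.2 h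
    have e : v - roundingStep e v = (2 * ‖v‖ - 1) • NormedSpace.normalize v := by
      have := NormedSpace.norm_smul_normalize v
      rw [roundingStep, if_neg h, sub_smul, mul_smul, this, one_smul, two_smul]
      abel
    rw [e, norm_smul, h1, mul_one, Real.norm_eq_abs, abs_le]
    constructor <;> linarith [norm_nonneg v]

theorem roundingStep_of_norm_eq_one {e v : EuclideanSpace ℝ (Fin k)} (hv : ‖v‖ = 1) :
    roundingStep e v = 0 := by
  have h : v ≠ 0 := by rintro rfl; simp at hv
  rw [roundingStep, if_neg h, NormedSpace.normalize_eq_self_of_norm_eq_one hv, sub_self]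

theorem norm_roundingStep_le {e : EuclideanSpace ℝ (Fin k)} (he : ‖e‖ = 1)
    {v : EuclideanSpace ℝ (Fin k)} (hv : ‖v‖ ≤ 1) : ‖roundingStep e v‖ ≤ 1 := by
  by_cases h : v = 0
  · simp [roundingStep, h, he]
  · have e : roundingStep e v = (1 - ‖v‖) • NormedSpace.normalize v := by
      have := NormedSpace.norm_smul_normalize v
      rw [roundingStep, if_neg h, sub_smul, this, one_smul]
    rw [e, norm_smul, NormedSpace.norm_normalize_eq_one_iff.2 h, mul_one, Real.norm_eq_abs, abs_le]
    constructor <;> linarith [norm_nonneg v]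

/-- Move along `v ± d` according to the alternating sign of a new coordinate. Points already on the
sphere have `d = 0` and stay; the others reach it whenever the sign is `+1`, independently of the
old coordinates. -/
theorem exists_rounding_step (hk : 1 ≤ k) (hρ : ρ ^ 2 < 1)
    {h : (Fin n → ℝ) → EuclideanSpace ℝ (Fin k)} (hh : Measurable h) (hh1 : ∀ x, ‖h x‖ ≤ 1)
    {η : ℝ} (hη : 0 < η) :
    ∃ h' : (Fin (n + 1) → ℝ) → EuclideanSpace ℝ (Fin k), Measurable h' ∧ (∀ x, ‖h' x‖ ≤ 1) ∧
      stabPi ρ h' ≤ stabPi ρ h + η ∧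
      (gaussianPi (n + 1)).real {x | ‖h' x‖ ≠ 1} ≤ 3 / 4 * (gaussianPi n).real {x | ‖h x‖ ≠ 1} := by
  set e : EuclideanSpace ℝ (Fin k) := EuclideanSpace.single ⟨0, hk⟩ 1
  have he : ‖e‖ = 1 := by simp [e]
  -- `η / 3` because three error terms arise; `1 / 2` because the sign is then `-1` with probability
  -- `(1 - E s) / 2 ≤ 3 / 4`.
  have hτ : 0 < min (η / 3) (1 / 2) := by positivity
  obtain ⟨s, hs, hs1, hsσ, hs0⟩ := exists_balanced_sign (σ := √(1 - ρ ^ 2))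
    (Real.sqrt_pos.2 (by linarith)) (Real.sqrt_le_one.2 (by nlinarith [sq_nonneg ρ])) hτ
  set d := fun x => roundingStep e (h x)
  have hd : Measurable d := (measurable_roundingStep e).comp hh
  have hy0 : Measurable fun y : Fin (n + 1) → ℝ => s (y 0) := by fun_prop
  have hm : Measurable fun y : Fin (n + 1) → ℝ => h (Fin.tail y) + s (y 0) • d (Fin.tail y) :=
    (hh.comp measurable_finTail).add (hy0.smul (hd.comp measurable_finTail))
  refine ⟨fun y => h (Fin.tail y) + s (y 0) • d (Fin.tail y), hm, ?_, ?_, ?_⟩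
  · intro y
    rcases hs1 (y 0) with h' | h'
    · simp only [h', one_smul]
      exact (norm_add_roundingStep he _).le
    · simp only [h', neg_smul, one_smul, ← sub_eq_add_neg]
      exact norm_sub_roundingStep he (hh1 _)
  · have := stabPi_add_sign_le (ρ := ρ) hs hs1 hsσ hs0 hh hd hh1
      fun x => norm_roundingStep_le he (hh1 x)
    have h3 := min_le_left (η / 3) (1 / 2)
    linarith
  · have hsub : {y : Fin (n + 1) → ℝ | ‖h (Fin.tail y) + s (y 0) • d (Fin.tail y)‖ ≠ 1} ⊆
        (fun y : Fin (n + 1) → ℝ => (y 0, Fin.tail y)) ⁻¹' ({t | s t = -1} ×ˢ {x | ‖h x‖ ≠ 1}) := by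
      intro y hy
      simp only [Set.mem_ofPred_eq, Set.mem_preimage, Set.mem_prod] at hy ⊢
      constructor
      · rcases hs1 (y 0) with h' | h'
        · exact absurd (by rw [h', one_smul]; exact norm_add_roundingStep he _) hy
        · exact h'
      · intro h'
        apply hy
        have : d (Fin.tail y) = 0 := roundingStep_of_norm_eq_one h'
        rw [this, smul_zero, add_zero, h']
    have hms : MeasurableSet {t | s t = -1} := hs (measurableSet_singleton (-1))
    have hmh : MeasurableSet {x | ‖h x‖ ≠ 1} := (hh.norm (measurableSet_singleton 1)).compl
    have hprob : (gaussianReal 0 1).real {t | s t = -1} ≤ 3 / 4 := by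
      have h1 : ∀ t, s t = 1 - 2 * Set.indicator {t | s t = -1} (fun _ => (1 : ℝ)) t := by
        intro t
        rcases hs1 t with h' | h'
        · rw [Set.indicator_of_notMem (by simp only [Set.mem_ofPred_eq, h']; norm_num), h']; ring
        · rw [Set.indicator_of_mem (by exact h'), h']; ring
      have hi : Integrable (Set.indicator {t | s t = -1} (fun _ => (1 : ℝ))) (gaussianReal 0 1) :=
        (integrable_const _).indicator hms
      have h2 : ∫ z, s z ∂(gaussianReal 0 1) = 1 - 2 * (gaussianReal 0 1).real {t | s t = -1} := by
        rw [integral_congr_ae (Filter.Eventually.of_forall h1),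
          integral_sub (integrable_const _) (hi.const_mul 2), integral_const_mul,
          integral_indicator hms]
        simp
      have h3 := (abs_le.1 hs0).1
      have h4 := min_le_right (η / 3) (1 / 2)
      linarith
    calc (gaussianPi (n + 1)).real {y | ‖h (Fin.tail y) + s (y 0) • d (Fin.tail y)‖ ≠ 1}
        ≤ (gaussianPi (n + 1)).real ((fun y : Fin (n + 1) → ℝ => (y 0, Fin.tail y)) ⁻¹'
          ({t | s t = -1} ×ˢ {x | ‖h x‖ ≠ 1})) := measureReal_mono hsub
      _ = (gaussianReal 0 1).real {t | s t = -1} * (gaussianPi n).real {x | ‖h x‖ ≠ 1} := by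
          rw [Measure.real, (measurePreserving_finTail n).measure_preimage
            (hms.prod hmh).nullMeasurableSet, Measure.prod_prod, ENNReal.toReal_mul]
          rfl
      _ ≤ _ := by gcongr

theorem exists_rounding (hk : 1 ≤ k) (hρ : ρ ^ 2 < 1)
    {h : (Fin n → ℝ) → EuclideanSpace ℝ (Fin k)} (hh : Measurable h) (hh1 : ∀ x, ‖h x‖ ≤ 1)
    (J : ℕ) : ∀ {η : ℝ}, 0 < η →
    ∃ h' : (Fin (n + J) → ℝ) → EuclideanSpace ℝ (Fin k), Measurable h' ∧ (∀ x, ‖h' x‖ ≤ 1) ∧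
      stabPi ρ h' ≤ stabPi ρ h + η ∧
      (gaussianPi (n + J)).real {x | ‖h' x‖ ≠ 1} ≤ (3 / 4) ^ J := by
  induction J with
  | zero => exact fun {η} hη => ⟨h, hh, hh1, by linarith, by simp⟩
  | succ J ih =>
    intro η hη
    obtain ⟨h1, hm1, hb1, hs1, hq1⟩ := ih (half_pos hη)
    obtain ⟨h2, hm2, hb2, hs2, hq2⟩ := exists_rounding_step hk hρ hm1 hb1 (half_pos hη)
    refine ⟨h2, hm2, hb2, by linarith, hq2.trans ?_⟩
    rw [pow_succ']
    gcongr

/-- The noise stability of a ball-valued function is approached from below by that of sphere-valued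
functions of more variables. -/
theorem exists_sphere_valued (hk : 1 ≤ k) (hρ : ρ ^ 2 < 1)
    {h : (Fin n → ℝ) → EuclideanSpace ℝ (Fin k)} (hh : Measurable h) (hh1 : ∀ x, ‖h x‖ ≤ 1)
    {η : ℝ} (hη : 0 < η) :
    ∃ N, k ≤ N ∧ ∃ f : (Fin N → ℝ) → EuclideanSpace ℝ (Fin k), Measurable f ∧ (∀ x, ‖f x‖ = 1) ∧
      stabPi ρ f ≤ stabPi ρ h + η := by
  obtain ⟨J0, hJ0⟩ := exists_pow_lt_of_lt_one (show 0 < η / 8 by positivity)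
    (show (3 / 4 : ℝ) < 1 by norm_num)
  -- At least `k` rounds are made so that the final number of variables is at least `k`, as the
  -- conjecture requires.
  set J := max J0 k
  -- Overwriting the bad set moves values by at most 2, and `L¹` continuity doubles this: `4 · η / 8
  -- = η / 2`, the half left over from the rounding.
  have hJ : (3 / 4 : ℝ) ^ J ≤ η / 8 :=
    (pow_le_pow_of_le_one (by norm_num) (by norm_num) (le_max_left _ _)).trans hJ0.le
  obtain ⟨g, hg, hg1, hgs, hgq⟩ := exists_rounding hk hρ hh hh1 J (half_pos hη)
  set e : EuclideanSpace ℝ (Fin k) := EuclideanSpace.single ⟨0, hk⟩ 1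
  have he : ‖e‖ = 1 := by simp [e]
  have hms : MeasurableSet {x | ‖g x‖ = 1} := hg.norm (measurableSet_singleton 1)
  have hms' : MeasurableSet {x | ‖g x‖ ≠ 1} := hms.compl
  classical
  let f : (Fin (n + J) → ℝ) → EuclideanSpace ℝ (Fin k) := fun x => if ‖g x‖ = 1 then g x else e
  have hf : Measurable f := Measurable.ite hms hg measurable_const
  have hf1 : ∀ x, ‖f x‖ = 1 := by
    intro x
    by_cases hx : ‖g x‖ = 1
    · simp only [f, hx, if_true]
    · simp only [f, hx, if_false, he]
  refine ⟨n + J, (le_max_right _ _).trans (Nat.le_add_left _ _), f, hf, hf1, ?_⟩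
  have hcmp := abs_stabPi_sub_le_of_norm_le_one hρ.le hf hg (fun x => (hf1 x).le) hg1
  have hint : ∫ x, ‖f x - g x‖ ∂(gaussianPi (n + J)) ≤ 2 * (3 / 4) ^ J := by
    have hle : ∀ x, ‖f x - g x‖ ≤ Set.indicator {x | ‖g x‖ ≠ 1} (fun _ => (2 : ℝ)) x := by
      intro x
      by_cases hx : ‖g x‖ = 1
      · rw [Set.indicator_of_notMem (by simpa using hx)]
        simp [f, hx]
      · rw [Set.indicator_of_mem (by exact hx)]
        exact (norm_sub_le _ _).trans (by linarith [hf1 x, hg1 x])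
    calc _ ≤ ∫ x, Set.indicator {x | ‖g x‖ ≠ 1} (fun _ => (2 : ℝ)) x ∂(gaussianPi (n + J)) :=
          integral_mono_of_nonneg (Filter.Eventually.of_forall fun x => norm_nonneg _)
            ((integrable_const _).indicator hms') (Filter.Eventually.of_forall hle)
      _ = (gaussianPi (n + J)).real {x | ‖g x‖ ≠ 1} * 2 := by
          rw [integral_indicator hms']
          simp
      _ ≤ _ := by linarith
  have := (abs_le.1 hcmp).2
  linarith

/-! ### The value of `f_opt` -/

theorem measurePreserving_castLE {k n : ℕ} (hkn : k ≤ n) :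
    MeasurePreserving (fun (x : Fin n → ℝ) (i : Fin k) => x (Fin.castLE hkn i))
      (gaussianPi n) (gaussianPi k) := by
  obtain ⟨m, rfl⟩ := Nat.exists_eq_add_of_le hkn
  have hm : Measurable (fun (x : Fin (k + m) → ℝ) (i : Fin k) => x (Fin.castLE hkn i)) :=
    measurable_pi_lambda _ fun i => measurable_pi_apply _
  refine ⟨hm, (Measure.pi_eq fun s hs => ?_).symm⟩
  rw [Measure.map_apply hm (MeasurableSet.univ_pi hs)]
  have hpre : (fun (x : Fin (k + m) → ℝ) (i : Fin k) => x (Fin.castLE hkn i)) ⁻¹' (Set.univ.pi s) =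
      Set.univ.pi (Fin.append s fun _ => Set.univ) := by
    ext x
    simp only [Set.mem_preimage, Set.mem_pi, Set.mem_univ, true_implies, Fin.forall_fin_add,
      Fin.append_left, Fin.append_right, implies_true, and_true]
    rfl
  rw [hpre, Measure.pi_pi, Fin.prod_univ_add]
  simp

theorem measurePreserving_matrix_columns (k : ℕ) :
    MeasurePreserving (fun Z : Fin k → Fin 2 → ℝ => ((fun i => Z i 0), (fun i => Z i 1)))
      (gaussianMatrix k 2) ((gaussianPi k).prod (gaussianPi k)) := by
  have h1 := measurePreserving_pi (fun _ : Fin k => Measure.pi fun _ : Fin 2 => gaussianReal 0 1)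
    (fun _ : Fin k => (gaussianReal 0 1).prod (gaussianReal 0 1))
    fun _ => measurePreserving_finTwoArrow (gaussianReal 0 1)
  have h2 := measurePreserving_arrowProdEquivProdArrow ℝ ℝ (Fin k)
    (fun _ => gaussianReal 0 1) (fun _ => gaussianReal 0 1)
  exact h2.comp h1

/-- The radial projection `x ↦ x / ‖x‖`. -/
def radial (k : ℕ) (x : Fin k → ℝ) : EuclideanSpace ℝ (Fin k) :=
  NormedSpace.normalize (WithLp.toLp 2 x)

@[fun_prop]
theorem measurable_radial (k : ℕ) : Measurable (radial k) :=
  measurable_normalize.comp (by fun_prop)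

/-- The columns of `Z` are independent Gaussian vectors `x`, `z`; applied to the two chosen vectors,
`Z` yields `x` and `ρ x + √(1 - ρ²) z`. -/
theorem FStar_eq_stabPi (k : ℕ) (ρ : ℝ) : FStar k ρ = stabPi ρ (radial k) := by
  have hm : Measurable fun p => radial k (mix ρ p) := by fun_prop
  have hmi : Measurable fun p : (Fin k → ℝ) × (Fin k → ℝ) =>
      (⟪radial k p.1, radial k (mix ρ p)⟫ : ℝ) := by fun_prop
  rw [FStar, projRoundValue, stabPi, ← integral_comp_measurePreserving
    (measurePreserving_matrix_columns k) hmi.aestronglyMeasurable]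
  congr 1
  ext Z
  have h1 : Matrix.mulVec (Matrix.of Z) (!₂[1, 0] : EuclideanSpace ℝ (Fin 2)).ofLp =
      fun i => Z i 0 := by
    ext i
    simp [Matrix.mulVec, dotProduct, Fin.sum_univ_two]
  have h2 : Matrix.mulVec (Matrix.of Z)
      (!₂[ρ, √(1 - ρ ^ 2)] : EuclideanSpace ℝ (Fin 2)).ofLp =
      mix ρ ((fun i => Z i 0), (fun i => Z i 1)) := by
    ext i
    simp [Matrix.mulVec, dotProduct, Fin.sum_univ_two, mix]
    ring
  rw [projRound, projRound, h1, h2]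
  rfl

theorem gaussianStab_fOpt {k n : ℕ} (hkn : k ≤ n) (ρ : ℝ) :
    gaussianStab ρ (fOpt hkn) = FStar k ρ := by
  let r : (Fin n → ℝ) → (Fin k → ℝ) := fun x i => x (Fin.castLE hkn i)
  have hr : MeasurePreserving r (gaussianPi n) (gaussianPi k) := measurePreserving_castLE hkn
  have hm : Measurable fun p => radial k (mix ρ p) := by fun_prop
  have hmi : Measurable fun p : (Fin k → ℝ) × (Fin k → ℝ) =>
      (⟪radial k p.1, radial k (mix ρ p)⟫ : ℝ) := by fun_prop
  have h1 : fOpt hkn = fun x => (radial k ∘ r) x.ofLp := rfl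
  rw [h1, gaussianStab_comp_ofLp ρ ((measurable_radial k).comp hr.measurable), FStar_eq_stabPi,
    stabPi, stabPi, ← integral_comp_measurePreserving (hr.prod hr) hmi.aestronglyMeasurable]
  rfl

/-- The conjecture for ball-valued functions. -/
theorem VectorBorellConjecture.FStar_le_stabPi (hB : VectorBorellConjecture) (hk : 1 ≤ k)
    (hρ₁ : -1 < ρ) (hρ₀ : ρ ≤ 0) {h : (Fin n → ℝ) → EuclideanSpace ℝ (Fin k)} (hh : Measurable h)
    (hh1 : ∀ x, ‖h x‖ ≤ 1) : FStar k ρ ≤ stabPi ρ h := by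
  refine le_of_forall_pos_le_add fun η hη => ?_
  obtain ⟨N, hkN, f, hf, hf1, hfs⟩ := exists_sphere_valued hk (ρ := ρ) (by nlinarith) hh hh1 hη
  have hf' : Measurable fun x : EuclideanSpace ℝ (Fin N) => f x.ofLp := hf.comp (by fun_prop)
  have := hB k N hk hkN ρ hρ₁.le hρ₀ (fun x => f x.ofLp) hf' (fun x => hf1 _)
  rw [gaussianStab_fOpt, gaussianStab_comp_ofLp ρ hf] at this
  linarith

end Rounding

/-! ### The hypercube -/

section Cube

variable {n k : ℕ}

theorem corrProb_nonneg {ρ : ℝ} (h₁ : -1 ≤ ρ) (h₂ : ρ ≤ 1) (x y : Fin n → ℤˣ) :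
    0 ≤ corrProb ρ x y :=
  Finset.prod_nonneg fun i _ => by split_ifs <;> linarith

theorem sum_corrProb_mul_chi (ρ : ℝ) (x : Fin n → ℤˣ) (T : Finset (Fin n)) :
    ∑ y, corrProb ρ x y * chi T y = ρ ^ T.card * chi T x := by
  have h : ∀ y : Fin n → ℤˣ, corrProb ρ x y * chi T y =
      ∏ i, ((if y i = x i then 1 / 2 + ρ / 2 else 1 / 2 - ρ / 2) *
        (if i ∈ T then ((y i : ℤ) : ℝ) else 1)) := by
    intro y
    rw [Finset.prod_mul_distrib, Fintype.prod_ite_mem]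
    rfl
  simp_rw [h]
  rw [← Fintype.piFinset_univ, Finset.sum_prod_piFinset Finset.univ
    (fun i (s : ℤˣ) => (if s = x i then 1 / 2 + ρ / 2 else 1 / 2 - ρ / 2) *
      (if i ∈ T then ((s : ℤ) : ℝ) else 1))]
  have h2 : ∀ i, ∑ s : ℤˣ, ((if s = x i then 1 / 2 + ρ / 2 else 1 / 2 - ρ / 2) *
      (if i ∈ T then ((s : ℤ) : ℝ) else 1)) = if i ∈ T then ρ * ((x i : ℤ) : ℝ) else 1 := by
    intro i
    have h11 : ¬ ((-1 : ℤˣ) = 1) := by decide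
    have h12 : ¬ ((1 : ℤˣ) = -1) := by decide
    rw [show (Finset.univ : Finset ℤˣ) = {1, -1} from rfl, Finset.sum_pair (by decide)]
    rcases Int.units_eq_one_or (x i) with hx | hx <;> by_cases hi : i ∈ T <;>
      simp [hx, hi, h11, h12] <;> ring
  simp_rw [h2]
  rw [Fintype.prod_ite_mem, Finset.prod_mul_distrib, Finset.prod_const]
  rfl

theorem sum_corrProb (ρ : ℝ) (x : Fin n → ℤˣ) : ∑ y, corrProb ρ x y = 1 := by
  simpa [chi] using sum_corrProb_mul_chi ρ x ∅

theorem eq_sum_chi_smul_fourierCoeff (f : (Fin n → ℤˣ) → EuclideanSpace ℝ (Fin k))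
    (x : Fin n → ℤˣ) : f x = ∑ S, chi S x • fourierCoeff f S :=
  (eq_sum_chi_iff f _).2 rfl x

theorem sum_corrProb_smul (ρ : ℝ) (f : (Fin n → ℤˣ) → EuclideanSpace ℝ (Fin k)) (x : Fin n → ℤˣ) :
    ∑ y, corrProb ρ x y • f y = ∑ S, chi S x • (ρ ^ S.card • fourierCoeff f S) := by
  simp_rw [eq_sum_chi_smul_fourierCoeff f, Finset.smul_sum, smul_smul]
  rw [Finset.sum_comm]
  refine Finset.sum_congr rfl fun S _ => ?_
  rw [← Finset.sum_smul, sum_corrProb_mul_chi, mul_comm]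

theorem vpoly_coe (C : Finset (Fin n) → EuclideanSpace ℝ (Fin k)) (x : Fin n → ℤˣ) :
    vpoly C (fun i => ((x i : ℤ) : ℝ)) = ∑ S, chi S x • C S := rfl

theorem boolStab_eq_sum (ρ : ℝ) (f : (Fin n → ℤˣ) → EuclideanSpace ℝ (Fin k)) :
    boolStab ρ f = ∑ S, ρ ^ S.card * ‖fourierCoeff f S‖ ^ 2 := by
  have h1 : ∀ x, ∑ y, corrProb ρ x y * ⟪f x, f y⟫ =
      ∑ S, ρ ^ S.card * ⟪chi S x • f x, fourierCoeff f S⟫ := by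
    intro x
    have : ∑ y, corrProb ρ x y * ⟪f x, f y⟫ = ⟪f x, ∑ y, corrProb ρ x y • f y⟫ := by
      simp only [inner_sum, real_inner_smul_right]
    rw [this, sum_corrProb_smul, inner_sum]
    refine Finset.sum_congr rfl fun S _ => ?_
    rw [real_inner_smul_right, real_inner_smul_right, real_inner_smul_left]
    ring
  rw [boolStab, corrExpect]
  simp_rw [h1]
  rw [Finset.sum_comm, Finset.mul_sum]
  refine Finset.sum_congr rfl fun S _ => ?_
  rw [← Finset.mul_sum, ← sum_inner, mul_left_comm, ← real_inner_smul_left,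
    ← real_inner_self_eq_norm_sq]
  rfl

theorem hypercubeValue_eq (ρ : ℝ) (f : (Fin n → ℤˣ) → EuclideanSpace ℝ (Fin k)) :
    hypercubeValue ρ f = 1 / 4 - 1 / 4 * boolStab ρ f := by
  simp only [hypercubeValue, boolStab, corrExpect, mul_sub, Finset.sum_sub_distrib]
  simp_rw [← Finset.sum_mul, sum_corrProb, mul_left_comm _ (1 / 4 : ℝ), ← Finset.mul_sum]
  simp [mul_left_comm]

variable {f : (Fin n → ℤˣ) → EuclideanSpace ℝ (Fin k)}

theorem sum_norm_sq_fourierCoeff_le (hf : ∀ x, ‖f x‖ ≤ 1) : ∑ S, ‖fourierCoeff f S‖ ^ 2 ≤ 1 := by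
  rw [← integral_norm_sq_vpoly (fun _ => rademacher), integral_pi_rademacher]
  simp_rw [vpoly_coe, ← eq_sum_chi_smul_fourierCoeff]
  calc ((2 : ℝ) ^ n)⁻¹ * ∑ x, ‖f x‖ ^ 2 ≤ ((2 : ℝ) ^ n)⁻¹ * ∑ _x : Fin n → ℤˣ, (1 : ℝ) := by
        gcongr with x
        exact pow_le_one₀ (norm_nonneg _) (hf x)
    _ = 1 := by simp

/-- For `-1 ≤ ρ ≤ 0` one has `ρ ≤ ρ^j` for every `j`. The total Fourier weight is at most 1, and as
`ρ ≤ 0` a smaller weight only helps. -/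
theorem le_boolStab {ρ : ℝ} (hρ₁ : -1 ≤ ρ) (hρ₀ : ρ ≤ 0) (hf : ∀ x, ‖f x‖ ≤ 1) :
    ρ ≤ boolStab ρ f := by
  have hpow : ∀ j : ℕ, ρ ≤ ρ ^ j := by
    intro j
    rcases j with _ | j
    · simpa using hρ₀.trans zero_le_one
    · have : ρ ^ j ≤ 1 := (le_abs_self _).trans (by
        rw [abs_pow]; exact pow_le_one₀ (abs_nonneg _) (abs_le.2 ⟨hρ₁, by linarith⟩))
      rw [pow_succ]
      nlinarith
  rw [boolStab_eq_sum]
  calc ρ ≤ ρ * ∑ S, ‖fourierCoeff f S‖ ^ 2 := by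
        nlinarith [sum_norm_sq_fourierCoeff_le hf]
    _ ≤ _ := by
        rw [Finset.mul_sum]
        gcongr
        exact hpow _

/-- The coefficients of the truncation at degree `m` of the noisy version of `f`. -/
def noisyTruncation (r : ℝ) (m : ℕ) (f : (Fin n → ℤˣ) → EuclideanSpace ℝ (Fin k))
    (S : Finset (Fin n)) : EuclideanSpace ℝ (Fin k) :=
  if S.card ≤ m then r ^ S.card • fourierCoeff f S else 0

theorem norm_noisyTruncation_le {r : ℝ} (hr₀ : 0 ≤ r) (hr₁ : r ≤ 1) (m : ℕ) (S : Finset (Fin n)) :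
    ‖noisyTruncation r m f S‖ ≤ ‖fourierCoeff f S‖ := by
  rw [noisyTruncation]
  split_ifs
  · rw [norm_smul, Real.norm_eq_abs, abs_of_nonneg (by positivity)]
    exact mul_le_of_le_one_left (norm_nonneg _) (pow_le_one₀ hr₀ hr₁)
  · simp

theorem sum_norm_sq_noisyTruncation_le {r : ℝ} (hr₀ : 0 ≤ r) (hr₁ : r ≤ 1) (m : ℕ)
    (hf : ∀ x, ‖f x‖ ≤ 1) : ∑ S, ‖noisyTruncation r m f S‖ ^ 2 ≤ 1 := by
  refine (Finset.sum_le_sum fun S _ => ?_).trans (sum_norm_sq_fourierCoeff_le hf)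
  have := norm_noisyTruncation_le (f := f) hr₀ hr₁ m S
  gcongr

/-- Noise and projection to `u` shrink every coefficient, and truncation removes those of degree
above `m`; hence the hypothesis on low-degree influences is enough. -/
theorem coeffInfluence_noisyTruncation_le {r : ℝ} (hr₀ : 0 ≤ r) (hr₁ : r ≤ 1) (m : ℕ)
    {u : EuclideanSpace ℝ (Fin k)} (hu : ‖u‖ ≤ 1) (i : Fin n) :
    coeffInfluence (fun S => ⟪u, noisyTruncation r m f S⟫) i ≤ lowDegInfluence m i f := by
  rw [coeffInfluence, lowDegInfluence, Finset.sum_filter, Finset.sum_filter]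
  refine Finset.sum_le_sum fun S _ => ?_
  by_cases hi : i ∈ S <;> by_cases hS : S.card ≤ m
  · simp only [hi, hS, and_self, if_true]
    rw [← sq_abs]
    have h1 : |⟪u, noisyTruncation r m f S⟫| ≤ ‖u‖ * ‖noisyTruncation r m f S‖ :=
      abs_real_inner_le_norm _ _
    have h2 := norm_noisyTruncation_le (f := f) hr₀ hr₁ m S
    have h3 : |⟪u, noisyTruncation r m f S⟫| ≤ ‖fourierCoeff f S‖ :=
      h1.trans ((mul_le_of_le_one_left (norm_nonneg _) hu).trans h2)
    gcongr
  · simp [hS, noisyTruncation]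
  · simp [hi]
  · simp [hi]

/-- On the cube, the noisy truncation of a ball-valued function is close to the ball. -/
theorem integral_rademacher_smoothSq_noisyTruncation_le {l r : ℝ} (hl : 0 < l) (hr₀ : 0 ≤ r)
    (hr₁ : r ≤ 1) (m : ℕ) (hf : ∀ x, ‖f x‖ ≤ 1) {u : EuclideanSpace ℝ (Fin k)} (hu : ‖u‖ ≤ 1) :
    ∫ x, smoothSq l (mpoly (fun S => ⟪u, noisyTruncation r m f S⟫) x - 1)
      ∂(Measure.pi fun _ : Fin n => rademacher) ≤ (r ^ 2) ^ m := by
  set c : Finset (Fin n) → ℝ := fun S => ⟪u, noisyTruncation r m f S⟫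
  -- The discarded high-degree part of the noisy function in direction `u`.
  set b : Finset (Fin n) → ℝ := fun S => if S.card ≤ m then 0 else r ^ S.card * ⟪u, fourierCoeff f S⟫
    with hb
  have hsum : ∀ x : Fin n → ℤˣ, mpoly c (fun i => ((x i : ℤ) : ℝ)) +
      mpoly b (fun i => ((x i : ℤ) : ℝ)) = ⟪u, ∑ y, corrProb r x y • f y⟫ := by
    intro x
    rw [sum_corrProb_smul, inner_sum, mpoly, mpoly, ← Finset.sum_add_distrib]
    refine Finset.sum_congr rfl fun S _ => ?_
    have : ∏ i ∈ S, ((x i : ℤ) : ℝ) = chi S x := rfl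
    rw [this, real_inner_smul_right, real_inner_smul_right]
    by_cases hS : S.card ≤ m
    · simp [c, b, noisyTruncation, hS, real_inner_smul_right]; ring
    · simp [c, b, noisyTruncation, hS]; ring
  -- Before truncation, the noisy function is an average of vectors of the ball. So `c - 1 ≤ -b`
  -- pointwise on the cube, and the positive part of the excess is at most `|b|`.
  have hball : ∀ x : Fin n → ℤˣ, ⟪u, ∑ y, corrProb r x y • f y⟫ ≤ 1 := by
    intro x
    have h1 : ‖∑ y, corrProb r x y • f y‖ ≤ 1 := by
      calc _ ≤ ∑ y, ‖corrProb r x y • f y‖ := norm_sum_le _ _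
        _ ≤ ∑ y, corrProb r x y := by
          refine Finset.sum_le_sum fun y _ => ?_
          have h0 := corrProb_nonneg (ρ := r) (by linarith) hr₁ x y
          rw [norm_smul, Real.norm_eq_abs, abs_of_nonneg h0]
          exact mul_le_of_le_one_right h0 (hf y)
        _ = 1 := sum_corrProb r x
    exact (real_inner_le_norm _ _).trans (mul_le_one₀ hu (norm_nonneg _) h1)
  have hpt : ∀ x : Fin n → ℤˣ, smoothSq l (mpoly c (fun i => ((x i : ℤ) : ℝ)) - 1) ≤
      mpoly b (fun i => ((x i : ℤ) : ℝ)) ^ 2 := by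
    intro x
    refine (smoothSq_le hl _).trans ?_
    rw [← sq_abs (mpoly b _)]
    have := hsum x ▸ hball x
    gcongr
    refine max_le ?_ (abs_nonneg _)
    linarith [neg_abs_le (mpoly b (fun i => ((x i : ℤ) : ℝ)))]
  calc _ ≤ ∫ x, mpoly b x ^ 2 ∂(Measure.pi fun _ : Fin n => rademacher) := by
        rw [integral_pi_rademacher, integral_pi_rademacher]
        gcongr with x
        exact hpt x
    _ = ∑ S, b S ^ 2 := integral_mpoly_sq _ b
    _ ≤ ∑ S, (r ^ 2) ^ m * ‖fourierCoeff f S‖ ^ 2 := by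
        refine Finset.sum_le_sum fun S _ => ?_
        by_cases hS : S.card ≤ m
        · simp only [hb, hS, if_true, ne_eq, OfNat.ofNat_ne_zero, not_false_eq_true, zero_pow]
          positivity
        · simp only [hb, hS, if_false]
          rw [mul_pow, ← pow_mul, mul_comm S.card 2, pow_mul]
          have h1 : (r ^ 2) ^ S.card ≤ (r ^ 2) ^ m :=
            pow_le_pow_of_le_one (by positivity) (pow_le_one₀ hr₀ hr₁) (by omega)
          have h2 : |⟪u, fourierCoeff f S⟫| ≤ ‖fourierCoeff f S‖ :=
            (abs_real_inner_le_norm _ _).trans (mul_le_of_le_one_left (norm_nonneg _) hu)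
          rw [← sq_abs ⟪u, fourierCoeff f S⟫]
          gcongr
    _ ≤ (r ^ 2) ^ m := by
        rw [← Finset.mul_sum]
        exact mul_le_of_le_one_right (by positivity) (sum_norm_sq_fourierCoeff_le hf)

theorem lowDegInfluence_mono {m m' : ℕ} (h : m ≤ m') (i : Fin n) :
    lowDegInfluence m i f ≤ lowDegInfluence m' i f := by
  refine Finset.sum_le_sum_of_subset_of_nonneg (fun S hS => ?_) fun _ _ _ => sq_nonneg _
  simp only [Finset.mem_filter, Finset.mem_univ, true_and] at hS ⊢
  exact ⟨hS.1.trans h, hS.2⟩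

end Cube

/-! ### `F*(k, ρ)` for large `k` -/

/-- The coefficients of the linear map `x ↦ x / √k`. -/
def scaledIdCoeff (k : ℕ) (S : Finset (Fin k)) : EuclideanSpace ℝ (Fin k) :=
  (√k)⁻¹ • WithLp.toLp 2 fun i => if S = {i} then 1 else 0

theorem vpoly_scaledIdCoeff (k : ℕ) (x : Fin k → ℝ) :
    vpoly (scaledIdCoeff k) x = (√k)⁻¹ • WithLp.toLp 2 x := by
  ext j
  simp [vpoly, scaledIdCoeff, mul_comm]

theorem sum_mul_norm_sq_scaledIdCoeff {k : ℕ} (hk : 1 ≤ k) (ρ : ℝ) :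
    ∑ S, ρ ^ S.card * ‖scaledIdCoeff k S‖ ^ 2 = ρ := by
  have hk' : (0 : ℝ) < k := by exact_mod_cast hk
  have h : ∀ S : Finset (Fin k), ρ ^ S.card * ‖scaledIdCoeff k S‖ ^ 2 =
      ∑ i : Fin k, if S = {i} then ρ / k else 0 := by
    intro S
    rw [EuclideanSpace.norm_sq_eq, Finset.mul_sum]
    refine Finset.sum_congr rfl fun i _ => ?_
    split_ifs with hS
    · simp [scaledIdCoeff, hS, Real.sq_sqrt, div_eq_mul_inv]
    · simp [scaledIdCoeff, hS]
  simp_rw [h]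
  rw [Finset.sum_comm]
  simp
  field_simp

theorem integral_sq_sum_sq_sub_one_le (k : ℕ) :
    Integrable (fun x : Fin k → ℝ => (∑ i, (x i ^ 2 - 1)) ^ 2) (gaussianPi k) ∧
    ∫ x, (∑ i, (x i ^ 2 - 1)) ^ 2 ∂(gaussianPi k) ≤ 100 * (k : ℝ) := by
  set γ := gaussianReal 0 1
  have h2 := HasStandardMoments.integrable_pow γ (j := 2) (by norm_num)
  have h4 := HasStandardMoments.integrable_pow γ (j := 4) le_rfl
  have hX : MemLp (fun t : ℝ => t ^ 2 - 1) 2 γ := by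
    rw [memLp_two_iff_integrable_sq (by fun_prop)]
    have : ∀ t : ℝ, (t ^ 2 - 1) ^ 2 = t ^ 4 - 2 * t ^ 2 + 1 := fun t => by ring
    simp_rw [this]
    exact (h4.sub (h2.const_mul 2)).add (integrable_const _)
  have hmean : ∫ t, (t ^ 2 - 1) ∂γ = 0 := by
    rw [integral_sub h2 (integrable_const _), HasStandardMoments.integral_sq]
    simp
  have hvar : Var[fun t : ℝ => t ^ 2 - 1; γ] ≤ 100 := by
    rw [variance_of_integral_eq_zero (by fun_prop) hmean]
    have : ∀ t : ℝ, (t ^ 2 - 1) ^ 2 = t ^ 4 + (-2) * t ^ 2 + 1 := fun t => by ring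
    simp_rw [this]
    rw [integral_add (h4.fun_add (h2.const_mul (-2))) (integrable_const _),
      integral_add h4 (h2.const_mul (-2)), integral_const_mul, HasStandardMoments.integral_sq]
    have := HasStandardMoments.integral_pow_four_le (ν := γ)
    simp
    linarith
  have hcoord : ∀ i : Fin k, MemLp (fun x : Fin k → ℝ => x i ^ 2 - 1) 2 (gaussianPi k) :=
    fun i => hX.comp_measurePreserving (measurePreserving_eval _ i)
  have hsum : MemLp (fun x : Fin k → ℝ => ∑ i, (x i ^ 2 - 1)) 2 (gaussianPi k) :=
    memLp_finsetSum _ fun i _ => hcoord i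
  refine ⟨hsum.integrable_sq, ?_⟩
  have hmean' : ∫ x, ∑ i, (x i ^ 2 - 1) ∂(gaussianPi k) = 0 := by
    rw [integral_finsetSum _ fun i _ => (hcoord i).integrable (by norm_num)]
    refine Finset.sum_eq_zero fun i _ => ?_
    rw [← hmean]
    exact integral_comp_measurePreserving (measurePreserving_eval (fun _ : Fin k => γ) i)
      (g := fun t => t ^ 2 - 1) (by fun_prop)
  have hv := variance_sum_pi (μ := fun _ : Fin k => γ) (X := fun _ t => t ^ 2 - 1) fun _ => hX
  have hfun : (∑ i : Fin k, fun ω : Fin k → ℝ => ω i ^ 2 - 1) = fun x => ∑ i, (x i ^ 2 - 1) := by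
    ext x
    simp
  rw [hfun, variance_of_integral_eq_zero hsum.aemeasurable hmean'] at hv
  rw [hv, Finset.sum_const, Finset.card_univ, Fintype.card_fin, nsmul_eq_mul, mul_comm]
  gcongr

/-- The linear map `x / √k` has stability exactly `ρ`, and `x / ‖x‖` is within `θ` of it in `L²`,
because `‖x‖² / k - 1` has variance at most `100 / k`. -/
theorem FStar_le_add {k : ℕ} (hk : 1 ≤ k) {ρ θ : ℝ} (hρ : ρ ^ 2 ≤ 1) (hθ : 0 < θ)
    (hkθ : 100 / k ≤ θ ^ 2) : FStar k ρ ≤ ρ + 2 * θ := by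
  have hk' : (0 : ℝ) < k := by exact_mod_cast hk
  obtain ⟨hi, hle⟩ := integral_sq_sum_sq_sub_one_le k
  have hrad : ∀ x, ‖radial k x‖ ≤ 1 := by
    intro x
    by_cases h : WithLp.toLp 2 x = (0 : EuclideanSpace ℝ (Fin k))
    · simp [radial, h]
    · exact (NormedSpace.norm_normalize_eq_one_iff.2 h).le
  have hdist : ∀ x, ‖vpoly (scaledIdCoeff k) x - radial k x‖ ^ 2 ≤
      1 / k ^ 2 * (∑ i, (x i ^ 2 - 1)) ^ 2 := by
    intro x
    set v : EuclideanSpace ℝ (Fin k) := WithLp.toLp 2 x with hv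
    set s := (√k)⁻¹ * ‖v‖ with hs
    have hs0 : 0 ≤ s := by positivity
    have e1 : vpoly (scaledIdCoeff k) x - radial k x = (s - 1) • NormedSpace.normalize v := by
      rw [vpoly_scaledIdCoeff, radial, sub_smul, one_smul, hs, mul_smul,
        NormedSpace.norm_smul_normalize]
    have e2 : ∑ i, (x i ^ 2 - 1) = k * (s ^ 2 - 1) := by
      have : ‖v‖ ^ 2 = ∑ i, x i ^ 2 := by
        rw [EuclideanSpace.norm_sq_eq]
        simp [hv]
      rw [Finset.sum_sub_distrib, ← this, hs, mul_pow, inv_pow, Real.sq_sqrt hk'.le]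
      simp
      field_simp
    rw [e1, e2, norm_smul, mul_pow, Real.norm_eq_abs, sq_abs]
    calc (s - 1) ^ 2 * ‖NormedSpace.normalize v‖ ^ 2 ≤ (s - 1) ^ 2 * 1 := by
          gcongr
          exact pow_le_one₀ (norm_nonneg _) (hrad x)
      _ ≤ (s ^ 2 - 1) ^ 2 := by
          have : (s ^ 2 - 1) ^ 2 = (s - 1) ^ 2 * (s + 1) ^ 2 := by ring
          rw [this]
          gcongr
          nlinarith
      _ = 1 / k ^ 2 * (k * (s ^ 2 - 1)) ^ 2 := by field_simp
  have hW : ∫ x, ‖vpoly (scaledIdCoeff k) x - radial k x‖ ^ 2 ∂(gaussianPi k) ≤ θ ^ 2 := by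
    calc _ ≤ ∫ x, 1 / (k : ℝ) ^ 2 * (∑ i, (x i ^ 2 - 1)) ^ 2 ∂(gaussianPi k) :=
          integral_mono_of_nonneg (Filter.Eventually.of_forall fun x => sq_nonneg _)
            (hi.const_mul _) (Filter.Eventually.of_forall hdist)
      _ ≤ 1 / (k : ℝ) ^ 2 * (100 * k) := by
          rw [integral_const_mul]
          gcongr
      _ = 100 / k := by field_simp
      _ ≤ θ ^ 2 := hkθ
  have h1 := abs_stabPi_sub_le_of_norm_sq hρ (measurable_vpoly (scaledIdCoeff k))
    (measurable_radial k) hrad (integrable_norm_sq_vpoly _ _)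
    (by
      rw [integral_norm_sq_vpoly]
      simpa using (sum_mul_norm_sq_scaledIdCoeff hk 1).le) hθ hW
  rw [stabPi_vpoly hρ, sum_mul_norm_sq_scaledIdCoeff hk, ← FStar_eq_stabPi] at h1
  have := (abs_le.1 h1).1
  linarith

/-! ### Rounding the Gaussian polynomial to the ball -/

section FixedDimension

variable {n k : ℕ}

/-- The radial retraction onto the unit ball. -/
def ballRetraction (v : EuclideanSpace ℝ (Fin k)) : EuclideanSpace ℝ (Fin k) :=
  if ‖v‖ ≤ 1 then v else NormedSpace.normalize v

theorem measurable_ballRetraction : Measurable (ballRetraction (k := k)) :=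
  Measurable.ite (measurable_norm measurableSet_Iic) measurable_id measurable_normalize

theorem norm_ballRetraction_le (v : EuclideanSpace ℝ (Fin k)) : ‖ballRetraction v‖ ≤ 1 := by
  rw [ballRetraction]
  split_ifs with h
  · exact h
  · have hv : v ≠ 0 := by rintro rfl; simp at h
    exact (NormedSpace.norm_normalize_eq_one_iff.2 hv).le

theorem norm_sub_ballRetraction (v : EuclideanSpace ℝ (Fin k)) :
    ‖v - ballRetraction v‖ = max (‖v‖ - 1) 0 := by
  rw [ballRetraction]
  split_ifs with h
  · rw [sub_self, norm_zero, max_eq_right (by linarith)]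
  · have hv : v ≠ 0 := by rintro rfl; simp at h
    have e : v - NormedSpace.normalize v = (‖v‖ - 1) • NormedSpace.normalize v := by
      rw [sub_smul, NormedSpace.norm_smul_normalize, one_smul]
    rw [e, norm_smul, NormedSpace.norm_normalize_eq_one_iff.2 hv, mul_one, Real.norm_eq_abs,
      abs_of_nonneg (by linarith), max_eq_left (by linarith)]

/-- A finite set of directions which almost attains the norm of every vector. -/
theorem exists_finite_norming_set (k : ℕ) {τ : ℝ} (hτ : 0 < τ) :
    ∃ U : Finset (EuclideanSpace ℝ (Fin k)), (∀ u ∈ U, ‖u‖ ≤ 1) ∧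
      ∀ v : EuclideanSpace ℝ (Fin k), ∃ u ∈ U, ‖v‖ - τ * ‖v‖ ≤ ⟪u, v⟫ := by
  -- A finite `τ`-net of the unit ball; the element near `v / ‖v‖` loses at most `τ ‖v‖`.
  obtain ⟨t, hts, htf, hcov⟩ := (isCompact_closedBall (0 : EuclideanSpace ℝ (Fin k)) 1).finite_cover_balls hτ
  refine ⟨htf.toFinset, fun u hu => ?_, fun v => ?_⟩
  · simpa using hts (htf.mem_toFinset.1 hu)
  · have hmem : NormedSpace.normalize v ∈ Metric.closedBall (0 : EuclideanSpace ℝ (Fin k)) 1 := by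
      rw [mem_closedBall_zero_iff]
      by_cases h : v = 0
      · simp [h]
      · exact (NormedSpace.norm_normalize_eq_one_iff.2 h).le
    obtain ⟨u, hu, hd⟩ := Set.mem_iUnion₂.1 (hcov hmem)
    refine ⟨u, htf.mem_toFinset.2 hu, ?_⟩
    rw [Metric.mem_ball, dist_eq_norm] at hd
    have h1 : ⟪NormedSpace.normalize v, v⟫ = ‖v‖ := by
      by_cases h : v = 0
      · simp [h]
      · rw [NormedSpace.normalize, real_inner_smul_left, real_inner_self_eq_norm_sq, pow_two,
          inv_mul_cancel_left₀ (norm_ne_zero_iff.2 h)]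
    have h2 : ⟪NormedSpace.normalize v - u, v⟫ ≤ τ * ‖v‖ :=
      (real_inner_le_norm _ _).trans (by gcongr)
    rw [inner_sub_left, h1] at h2
    linarith

/-- The distance to the ball is the excess of the norm over 1, and a well-chosen direction sees all
of it except `τ ‖v‖`. Replacing the square of the positive part by its smooth version costs a
further `l a ≤ l (1 + ‖v‖²)`. -/
theorem sq_norm_sub_ballRetraction_le {U : Finset (EuclideanSpace ℝ (Fin k))} {τ l : ℝ}
    (hτ : 0 < τ) (hl : 0 < l) (hU1 : ∀ u ∈ U, ‖u‖ ≤ 1)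
    (hU : ∀ v : EuclideanSpace ℝ (Fin k), ∃ u ∈ U, ‖v‖ - τ * ‖v‖ ≤ ⟪u, v⟫)
    (v : EuclideanSpace ℝ (Fin k)) :
    ‖v - ballRetraction v‖ ^ 2 ≤
      2 * ∑ u ∈ U, smoothSq l (⟪u, v⟫ - 1) + (2 * l + (2 * l + 2 * τ ^ 2) * ‖v‖ ^ 2) := by
  obtain ⟨u, hu, huv⟩ := hU v
  set a := max (⟪u, v⟫ - 1) 0
  have ha0 : 0 ≤ a := le_max_right _ _
  have hal : a ≤ ‖v‖ := by
    refine max_le ?_ (norm_nonneg v)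
    have := (real_inner_le_norm u v).trans (mul_le_of_le_one_left (norm_nonneg v) (hU1 u hu))
    linarith
  have h1 : max (‖v‖ - 1) 0 ≤ a + τ * ‖v‖ := by
    have h := le_max_left (⟪u, v⟫ - 1) 0
    refine max_le (by linarith) (by positivity)
  have h2 : a ^ 2 ≤ smoothSq l (⟪u, v⟫ - 1) + l * a := sq_posPart_le hl _
  have h3 : smoothSq l (⟪u, v⟫ - 1) ≤ ∑ u ∈ U, smoothSq l (⟪u, v⟫ - 1) :=
    Finset.single_le_sum (f := fun u => smoothSq l (⟪u, v⟫ - 1))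
      (fun u _ => smoothSq_nonneg hl _) hu
  have h4 : l * a ≤ l * (1 + ‖v‖ ^ 2) := by
    gcongr
    nlinarith [sq_nonneg (‖v‖ - 1)]
  rw [norm_sub_ballRetraction]
  calc (max (‖v‖ - 1) 0) ^ 2 ≤ (a + τ * ‖v‖) ^ 2 := by
        gcongr
    _ ≤ 2 * a ^ 2 + 2 * (τ * ‖v‖) ^ 2 := by nlinarith [sq_nonneg (a - τ * ‖v‖)]
    _ ≤ _ := by rw [mul_pow]; linarith

/-- The distance to the ball of the Gaussian noisy truncation of a ball-valued function with small
influences. -/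
theorem integral_sq_norm_sub_ballRetraction_le {U : Finset (EuclideanSpace ℝ (Fin k))} {τ l : ℝ}
    (hτ : 0 < τ) (hl : 0 < l) (hU1 : ∀ u ∈ U, ‖u‖ ≤ 1)
    (hU : ∀ v : EuclideanSpace ℝ (Fin k), ∃ u ∈ U, ‖v‖ - τ * ‖v‖ ≤ ⟪u, v⟫)
    {r θ : ℝ} (hr₀ : 0 ≤ r) (hr₁ : r ≤ 1) (hθ : 0 < θ) {m : ℕ}
    {f : (Fin n → ℤˣ) → EuclideanSpace ℝ (Fin k)} (hf : ∀ x, ‖f x‖ ≤ 1)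
    (hi : ∀ i, lowDegInfluence m i f ≤ θ ^ 2) :
    ∫ x, ‖vpoly (noisyTruncation r m f) x - ballRetraction (vpoly (noisyTruncation r m f) x)‖ ^ 2
        ∂(gaussianPi n) ≤
      2 * (U.card * ((r ^ 2) ^ m + 202 / l * (θ * 100 ^ m * m))) + (4 * l + 2 * τ ^ 2) := by
  set C := noisyTruncation r m f with hC
  have hsum := sum_norm_sq_noisyTruncation_le (m := m) hr₀ hr₁ hf
  have hone : ∀ u ∈ U, Integrable (fun x => smoothSq l (⟪u, vpoly C x⟫ - 1)) (gaussianPi n) ∧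
      ∫ x, smoothSq l (⟪u, vpoly C x⟫ - 1) ∂(gaussianPi n) ≤
        (r ^ 2) ^ m + 202 / l * (θ * 100 ^ m * m) := by
    intro u hu
    simp_rw [inner_vpoly]
    refine ⟨integrable_smoothSq_sub_one hl (by fun_prop)
      (integrable_mpoly_pow _ _ (by norm_num)), ?_⟩
    have hdeg : ∀ S : Finset (Fin n), m < S.card → ⟪u, C S⟫ = 0 := by
      intro S hS
      simp [hC, noisyTruncation, not_le.2 hS]
    have h1 := abs_integral_smoothSq_gaussian_sub_rademacher_le hl hdeg hθ fun i =>
      (coeffInfluence_noisyTruncation_le hr₀ hr₁ m (hU1 u hu) i).trans (hi i)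
    have h2 := integral_rademacher_smoothSq_noisyTruncation_le hl hr₀ hr₁ m hf (hU1 u hu)
    have h3 : ∑ S, ⟪u, C S⟫ ^ 2 ≤ 1 := by
      refine (Finset.sum_le_sum fun S _ => ?_).trans hsum
      rw [← sq_abs]
      have : |⟪u, C S⟫| ≤ ‖C S‖ := (abs_real_inner_le_norm _ _).trans
        (mul_le_of_le_one_left (norm_nonneg _) (hU1 u hu))
      gcongr
    have h4 : 202 / l * (θ * 100 ^ m * (m * ∑ S, ⟪u, C S⟫ ^ 2)) ≤
        202 / l * (θ * 100 ^ m * m) := by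
      have : (m : ℝ) * ∑ S, ⟪u, C S⟫ ^ 2 ≤ m := mul_le_of_le_one_right (by positivity) h3
      gcongr
    have h5 := (abs_le.1 h1).2
    linarith
  have iP := integrable_norm_sq_vpoly (fun _ : Fin n => gaussianReal 0 1) C
  have iU : Integrable (fun x => ∑ u ∈ U, smoothSq l (⟪u, vpoly C x⟫ - 1)) (gaussianPi n) :=
    integrable_finsetSum _ fun u hu => (hone u hu).1
  have iR : Integrable (fun x => 2 * l + (2 * l + 2 * τ ^ 2) * ‖vpoly C x‖ ^ 2) (gaussianPi n) :=
    (integrable_const _).add (iP.const_mul _)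
  calc _ ≤ ∫ x, (2 * ∑ u ∈ U, smoothSq l (⟪u, vpoly C x⟫ - 1) +
        (2 * l + (2 * l + 2 * τ ^ 2) * ‖vpoly C x‖ ^ 2)) ∂(gaussianPi n) :=
        integral_mono_of_nonneg (Filter.Eventually.of_forall fun x => sq_nonneg _)
          ((iU.const_mul 2).add iR) (Filter.Eventually.of_forall fun x =>
            sq_norm_sub_ballRetraction_le hτ hl hU1 hU _)
    _ = 2 * ∑ u ∈ U, ∫ x, smoothSq l (⟪u, vpoly C x⟫ - 1) ∂(gaussianPi n) +
        (2 * l + (2 * l + 2 * τ ^ 2) * ∑ S, ‖C S‖ ^ 2) := by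
        rw [integral_add (iU.const_mul 2) iR, integral_const_mul,
          integral_finsetSum _ fun u hu => (hone u hu).1,
          integral_add (integrable_const _) (iP.const_mul _), integral_const_mul (2 * l + 2 * τ ^ 2),
          integral_norm_sq_vpoly]
        simp
    _ ≤ 2 * ∑ _u ∈ U, ((r ^ 2) ^ m + 202 / l * (θ * 100 ^ m * m)) +
        (2 * l + (2 * l + 2 * τ ^ 2) * 1) := by
        gcongr with u hu
        exact (hone u hu).2
    _ = _ := by
        rw [Finset.sum_const, nsmul_eq_mul]
        ring

/-! ### Choice of parameters and assembly of the proof. -/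

/-- Bernoulli gives `1 - q^j ≤ j (1 - q)`, and `j |ρ|^j` is bounded since `|ρ| < 1`; so a rate close
to 1 works for all degrees at once. -/
theorem exists_noise_rate {ρ κ : ℝ} (hρ₁ : -1 < ρ) (hρ₀ : ρ ≤ 0) (hκ : 0 < κ) :
    ∃ q : ℝ, 0 < q ∧ q < 1 ∧ ∀ j : ℕ, |ρ| ^ j * (1 - q ^ j) ≤ κ := by
  have hr : |ρ| < 1 := abs_lt.2 ⟨hρ₁, by linarith⟩
  obtain ⟨B, hB⟩ := (tendsto_self_mul_const_pow_of_lt_one (abs_nonneg ρ) hr).bddAbove_range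
  have hB' : ∀ j : ℕ, (j : ℝ) * |ρ| ^ j ≤ B := fun j => hB ⟨j, rfl⟩
  have hB0 : 0 ≤ B := by simpa using hB' 0
  have hd : 0 < min (κ / (B + 1)) (1 / 2) := by positivity
  set d := min (κ / (B + 1)) (1 / 2)
  have hd2 : d ≤ 1 / 2 := min_le_right _ _
  have hd1 : d * (B + 1) ≤ κ := (le_div_iff₀ (by positivity)).1 (min_le_left _ _)
  refine ⟨1 - d, by linarith, by linarith, fun j => ?_⟩
  have hbern := one_add_mul_le_pow (show (-2 : ℝ) ≤ -d by linarith) j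
  have h1 : 1 - (1 - d) ^ j ≤ j * d := by
    rw [← sub_eq_add_neg] at hbern
    linarith
  calc |ρ| ^ j * (1 - (1 - d) ^ j) ≤ |ρ| ^ j * (j * d) := by gcongr
    _ = (j * |ρ| ^ j) * d := by ring
    _ ≤ B * d := by gcongr; exact hB' j
    _ ≤ κ := by nlinarith

/-- On each level the multiplier of the Fourier weight changes by at most `κ`: through the noise up
to degree `m`, and through `|ρ|^m ≤ κ` above it. The total weight is at most 1. -/
theorem sum_noisyTruncation_le_boolStab {ρ κ r : ℝ} {m : ℕ} (hρ₁ : -1 < ρ) (hρ₀ : ρ ≤ 0)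
    (hr : ∀ j : ℕ, |ρ| ^ j * (1 - (r ^ 2) ^ j) ≤ κ) (hr₀ : 0 ≤ r) (hr₁ : r ≤ 1)
    (hm : |ρ| ^ m ≤ κ) {f : (Fin n → ℤˣ) → EuclideanSpace ℝ (Fin k)} (hf : ∀ x, ‖f x‖ ≤ 1) :
    ∑ S, ρ ^ S.card * ‖noisyTruncation r m f S‖ ^ 2 ≤ boolStab ρ f + κ := by
  have hκ : 0 ≤ κ := (pow_nonneg (abs_nonneg ρ) m).trans hm
  have hterm : ∀ S : Finset (Fin n), ρ ^ S.card * ‖noisyTruncation r m f S‖ ^ 2 ≤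
      ρ ^ S.card * ‖fourierCoeff f S‖ ^ 2 + κ * ‖fourierCoeff f S‖ ^ 2 := by
    intro S
    have hlow : -(|ρ| ^ S.card) ≤ ρ ^ S.card := by
      rw [← abs_pow]; exact neg_abs_le _
    by_cases hS : S.card ≤ m
    · rw [noisyTruncation, if_pos hS, norm_smul, mul_pow, Real.norm_eq_abs, sq_abs, ← pow_mul,
        mul_comm S.card 2, pow_mul]
      have h0 : 0 ≤ 1 - (r ^ 2) ^ S.card := by
        have : (r ^ 2) ^ S.card ≤ 1 := pow_le_one₀ (by positivity) (pow_le_one₀ hr₀ hr₁)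
        linarith
      have h1 : -κ ≤ ρ ^ S.card * (1 - (r ^ 2) ^ S.card) := by
        have := mul_le_mul_of_nonneg_right hlow h0
        linarith [hr S.card]
      nlinarith [sq_nonneg ‖fourierCoeff f S‖]
    · rw [noisyTruncation, if_neg hS]
      have h1 : |ρ| ^ S.card ≤ κ := (pow_le_pow_of_le_one (abs_nonneg ρ)
        (abs_le.2 ⟨hρ₁.le, by linarith⟩) (by omega)).trans hm
      simp only [norm_zero, ne_eq, OfNat.ofNat_ne_zero, not_false_eq_true, zero_pow, mul_zero]
      nlinarith [sq_nonneg ‖fourierCoeff f S‖]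
  calc _ ≤ ∑ S, (ρ ^ S.card * ‖fourierCoeff f S‖ ^ 2 + κ * ‖fourierCoeff f S‖ ^ 2) :=
        Finset.sum_le_sum fun S _ => hterm S
    _ ≤ boolStab ρ f + κ := by
        rw [Finset.sum_add_distrib, ← Finset.mul_sum, boolStab_eq_sum]
        have := sum_norm_sq_fourierCoeff_le hf
        nlinarith

/-- The lower bound on the noise stability, for a fixed dimension of the target. -/
theorem exists_delta_of_fixed_dimension (hB : VectorBorellConjecture) {ρ : ℝ} (hρ₁ : -1 < ρ)
    (hρ₀ : ρ ≤ 0) (hk : 1 ≤ k) {ε : ℝ} (hε : 0 < ε) :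
    ∃ δ : ℝ, 0 < δ ∧ ∃ m : ℕ, ∀ (n : ℕ) (f : (Fin n → ℤˣ) → EuclideanSpace ℝ (Fin k)),
      (∀ x, ‖f x‖ ≤ 1) → (∀ i, lowDegInfluence m i f ≤ δ) → FStar k ρ - ε ≤ boolStab ρ f := by
  -- One `κ` is lost on the Fourier side and `2κ` in retracting to the ball.
  set κ := ε / 3 with hκdef
  have hκ : 0 < κ := by positivity
  have hρsq : ρ ^ 2 ≤ 1 := by nlinarith
  obtain ⟨q, hq0, hq1, hq⟩ := exists_noise_rate hρ₁ hρ₀ hκ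
  -- Noise enters both arguments of the stability, so noise `√q` multiplies level `j` by `q^j`.
  have hr2 : √q ^ 2 = q := Real.sq_sqrt hq0.le
  have hr0 : 0 ≤ √q := Real.sqrt_nonneg q
  have hr1 : √q ≤ 1 := Real.sqrt_le_one.2 hq1.le
  -- The squared distance to the ball has budget `κ²`: smoothing takes `4 l = κ² / 4`, the net `2 (κ
  -- / 3)² = 2 κ² / 9`, and the tail together with the invariance error `κ² / 2`. The net is fixed
  -- before the degree `m`, and `θ` comes last since it must beat `100^m`.
  obtain ⟨U, hU1, hU⟩ := exists_finite_norming_set k (show 0 < κ / 3 by positivity)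
  set l := κ ^ 2 / 16 with hl
  have hl0 : 0 < l := by positivity
  set N : ℝ := U.card + 1 with hN
  have hN0 : 0 < N := by positivity
  obtain ⟨m1, hm1⟩ := exists_pow_lt_of_lt_one (show 0 < κ ^ 2 / (8 * N) by positivity) hq1
  obtain ⟨m2, hm2⟩ := exists_pow_lt_of_lt_one hκ (abs_lt.2 ⟨hρ₁, by linarith⟩ : |ρ| < 1)
  set m := max m1 m2
  have hqm : q ^ m ≤ κ ^ 2 / (8 * N) :=
    (pow_le_pow_of_le_one hq0.le hq1.le (le_max_left _ _)).trans hm1.le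
  have hρm : |ρ| ^ m ≤ κ :=
    (pow_le_pow_of_le_one (abs_nonneg ρ) (abs_le.2 ⟨hρ₁.le, by linarith⟩)
      (le_max_right _ _)).trans hm2.le
  set M : ℝ := 202 / l * (100 ^ m * m) + 1 with hM
  have hM0 : 0 < M := by positivity
  set θ := κ ^ 2 / (8 * N * M) with hθ
  have hθ0 : 0 < θ := by positivity
  refine ⟨θ ^ 2, by positivity, m, fun n f hf hi => ?_⟩
  set C := noisyTruncation (√q) m f
  have hW := integral_sq_norm_sub_ballRetraction_le (show 0 < κ / 3 by positivity) hl0 hU1 hU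
    hr0 hr1 hθ0 hf hi
  have hW2 : ∫ x, ‖vpoly C x - (ballRetraction ∘ vpoly C) x‖ ^ 2 ∂(gaussianPi n) ≤ κ ^ 2 := by
    refine hW.trans ?_
    rw [hr2]
    have h1 : 202 / l * (θ * 100 ^ m * m) ≤ κ ^ 2 / (8 * N) := by
      calc 202 / l * (θ * 100 ^ m * m) = θ * (M - 1) := by rw [hM]; ring
        _ ≤ θ * M := by gcongr; linarith
        _ = κ ^ 2 / (8 * N) := by rw [hθ]; field_simp
    have h2 : (U.card : ℝ) * (q ^ m + 202 / l * (θ * 100 ^ m * m)) ≤ κ ^ 2 / 4 := by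
      calc _ ≤ N * (κ ^ 2 / (8 * N) + κ ^ 2 / (8 * N)) := by
            gcongr
            rw [hN]; linarith
        _ = κ ^ 2 / 4 := by field_simp; norm_num
    have h3 : 4 * l = κ ^ 2 / 4 := by rw [hl]; ring
    nlinarith [sq_nonneg κ]
  have hcmp := abs_stabPi_sub_le_of_norm_sq hρsq (measurable_vpoly C)
    (measurable_ballRetraction.comp (measurable_vpoly C)) (fun x => norm_ballRetraction_le _)
    (integrable_norm_sq_vpoly _ C)
    (by rw [integral_norm_sq_vpoly]; exact sum_norm_sq_noisyTruncation_le hr0 hr1 m hf) hκ hW2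
  have hborell := hB.FStar_le_stabPi hk hρ₁ hρ₀
    (measurable_ballRetraction.comp (measurable_vpoly C)) (fun x => norm_ballRetraction_le _)
  have hbool := sum_noisyTruncation_le_boolStab (r := √q) (m := m) hρ₁ hρ₀
    (by rw [hr2]; exact hq) hr0 hr1 hρm hf
  rw [stabPi_vpoly hρsq] at hcmp
  have h5 := (abs_le.1 hcmp).1
  have h6 : κ = ε / 3 := hκdef
  linarith

end FixedDimension

/-- The lower bound on the noise stability, uniformly in the dimension of the target. -/
theorem exists_delta (hB : VectorBorellConjecture) {ρ : ℝ} (hρ₁ : -1 < ρ) (hρ₀ : ρ ≤ 0) {ε : ℝ}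
    (hε : 0 < ε) :
    ∃ δ : ℝ, 0 < δ ∧ ∃ m : ℕ, ∀ (k n : ℕ), 1 ≤ k →
      ∀ f : (Fin n → ℤˣ) → EuclideanSpace ℝ (Fin k),
      (∀ x, ‖f x‖ ≤ 1) → (∀ i, lowDegInfluence m i f ≤ δ) → FStar k ρ - ε ≤ boolStab ρ f := by
  -- Beyond `K`, `FStar_le_add` with `θ = ε / 2` gives `F*(k, ρ) ≤ ρ + ε`.
  obtain ⟨K, hK⟩ := exists_nat_gt (100 / (ε / 2) ^ 2)
  have hfix : ∀ k : ℕ, ∃ δ : ℝ, 0 < δ ∧ ∃ m : ℕ, 1 ≤ k →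
      ∀ (n : ℕ) (f : (Fin n → ℤˣ) → EuclideanSpace ℝ (Fin k)), (∀ x, ‖f x‖ ≤ 1) →
      (∀ i, lowDegInfluence m i f ≤ δ) → FStar k ρ - ε ≤ boolStab ρ f := by
    intro k
    by_cases hk : 1 ≤ k
    · obtain ⟨δ, hδ, m, h⟩ := exists_delta_of_fixed_dimension hB hρ₁ hρ₀ hk hε
      exact ⟨δ, hδ, m, fun _ => h⟩
    · exact ⟨1, one_pos, 0, fun h => absurd h hk⟩
  choose δ hδ m hm using hfix
  -- For the finitely many small `k`: the least `δ` and the largest `m`, as low-degree influences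
  -- grow with `m`.
  refine ⟨(Finset.range (K + 1)).inf' Finset.nonempty_range_add_one δ, ?_,
    (Finset.range (K + 1)).sup m, fun k n hk f hf hi => ?_⟩
  · rw [Finset.lt_inf'_iff]
    exact fun k _ => hδ k
  · rcases Nat.lt_or_ge k (K + 1) with hkK | hkK
    · have hmem : k ∈ Finset.range (K + 1) := Finset.mem_range.2 hkK
      exact hm k hk n f hf fun i => (lowDegInfluence_mono (Finset.le_sup hmem) i).trans
        ((hi i).trans (Finset.inf'_le _ hmem))
    · have hk0 : (0 : ℝ) < k := by exact_mod_cast hk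
      have hKk : (K : ℝ) ≤ k := by exact_mod_cast (Nat.le_succ K).trans hkK
      have h1 : 100 / (k : ℝ) ≤ (ε / 2) ^ 2 := by
        rw [div_le_iff₀ hk0]
        rw [div_lt_iff₀ (by positivity)] at hK
        nlinarith [sq_nonneg (ε / 2)]
      have h2 := FStar_le_add hk (ρ := ρ) (by nlinarith) (half_pos hε) h1
      have h3 := le_boolStab hρ₁.le hρ₀ hf
      linarith

end VectorBorell

end

theorem mainTheorem6 (hBorell : VectorBorell.VectorBorellConjecture)
    (ρ : ℝ) (hρ₁ : -1 < ρ) (hρ₀ : ρ ≤ 0) (ε : ℝ) (hε : 0 < ε) :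
    ∃ δ : ℝ, 0 < δ ∧ ∃ m : ℕ, ∀ (k n : ℕ), 1 ≤ k →
      ∀ f : (Fin n → ℤˣ) → EuclideanSpace ℝ (Fin k), (∀ x, ‖f x‖ ≤ 1) →
        (∀ i : Fin n, VectorBorell.lowDegInfluence m i f ≤ δ) →
          VectorBorell.FStar k ρ - ε ≤ VectorBorell.boolStab ρ f ∧
          VectorBorell.hypercubeValue ρ f ≤ 1 / 4 - 1 / 4 * VectorBorell.FStar k ρ + ε := by
  obtain ⟨δ, hδ, m, h⟩ := VectorBorell.exists_delta hBorell hρ₁ hρ₀ hε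
  refine ⟨δ, hδ, m, fun k n hk f hf hi => ?_⟩
  have h1 := h k n hk f hf hi
  refine ⟨h1, ?_⟩
  rw [VectorBorell.hypercubeValue_eq]
  linarith
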